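/- Consider a $K$-unit auction: a seller has $K\ge 1$ identical copies of an item, and there are $n\ge 1$ buyers $B_1,\dots,B_n$, each interested in one copy. The values $v_1,\dots,v_n$ of the buyers are independent. The distribution of $v_i$ is discrete: it is given by a finite support $U_i\subset[0,\infty)$ and probabilities $p_{iv}>0$ for $v\in U_i$, $\sum_{v\in U_i}p_{iv}=1$. All success probabilities $\tilde p_{ix}=\Pr[v_i\ge x]$ are integral multiples of $\frac1{10n^2}$ (so that $|U_i|\le 10n^2$). A (non-adaptive) sequential posted-price mechanism (SPM) is a sequence of offers $(B_{i_1},x_1),\dots,(B_{i_m},x_m)$, fixed in advance, with distinct buyers and prices $x_j\ge 0$. The offers are made in this order; as long as a copy is left, the buyer $B_{i_j}$ buys a copy and pays $x_j$ if $v_{i_j}\ge x_j$, and buys nothing otherwise; the process ends when all $K$ copies are sold or no offer is left. Let $\mathcal R(\sigma)$ be the expected total payment under the SPM $\sigma$. Algorithms are programs of a unit-cost real random access machine: it has one random access memory of natural numbers, with addition, truncated subtraction, comparison, natural constants and indirect addressing, and one of real numbers, addressed by natural numbers, with $+,-,\times,\div$, comparison and natural constants; every operation and memory access costs one step, and there is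 no rounding or conversion of reals into natural numbers. The input consists of $n$, $K$, $\epsilon$ and, for each buyer, the size of the support and the list of its points $v$ with their probabilities $p_{iv}$. Theorem. For every constant $K$ there is a PTAS for computing an optimal SPM, with running time $(nK/\epsilon)^{\mathrm{poly}(K,1/\epsilon)}$. Precisely: there are one algorithm, a constant $c$ and a polynomial $P$ in two variables with nonnegative integer coefficients such that for all $n,K\ge1$, all real $0<\epsilon<1$ and all auctions as above, the algorithm halts after at most $c\,(nK/\epsilon)^{P(K,1/\epsilon)}$ steps and outputs an SPM $\sigma$ with $\mathcal R(\sigma)\ge(1-\epsilon)\,\mathcal R(\tau)$ for every SPM $\tau$. -/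

import Mathlib

/-! # Sequential posted-price mechanisms in `K`-unit auctions -/

/-- `n` buyers with independent discrete value distributions: buyer `i` has value `val i j`
with probability `prob i j`, where `j` runs through the `supp i` points of its support. -/
structure Auction (n : ℕ) where
  supp : Fin n → ℕ
  val : (i : Fin n) → Fin (supp i) → ℝ
  prob : (i : Fin n) → Fin (supp i) → ℝ
  val_nonneg : ∀ i j, 0 ≤ val i j
  val_injective : ∀ i, Function.Injective (val i)
  prob_pos : ∀ i j, 0 < prob i j
  prob_sum : ∀ i, ∑ j, prob i j = 1

/-- The success probability of offering price `x` to buyer `i`: the probability that the value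
of buyer `i` is at least `x`. -/
noncomputable def Auction.successProb {n : ℕ} (A : Auction n) (i : Fin n) (x : ℝ) : ℝ :=
  ∑ j, if x ≤ A.val i j then A.prob i j else 0

/-- All success probabilities are integral multiples of `1 / (10 n²)`. Since support points have
positive probability, this also bounds every support size by `10 n²`. -/
def Auction.OnGrid {n : ℕ} (A : Auction n) : Prop :=
  ∀ (i : Fin n) (x : ℝ), ∃ m : ℕ, A.successProb i x = (m : ℝ) / (10 * (n : ℝ) ^ 2)

/-- A (non-adaptive) sequential posted-price mechanism: the entire sequence of offers
(buyer, price), fixed in advance, in which every buyer gets at most one offer. -/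
structure SPM (n : ℕ) where
  offers : List (Fin n × ℝ)
  nodup : (offers.map Prod.fst).Nodup
  price_nonneg : ∀ o ∈ offers, 0 ≤ o.2

/-- The revenue of a sequence of offers when `k` copies are left and the buyers have values `v`:
a buyer buys (and pays the posted price) iff its value is at least the price, and the process
ends when no copy or no offer is left. -/
noncomputable def realizedRevenue {n : ℕ} (v : Fin n → ℝ) : ℕ → List (Fin n × ℝ) → ℝ
  | 0, _ => 0
  | _ + 1, [] => 0
  | k + 1, (i, x) :: rest =>
      if x ≤ v i then x + realizedRevenue v k rest else realizedRevenue v (k + 1) rest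

/-- The expected revenue with `K` copies, for independently drawn values. -/
noncomputable def Auction.expectedRevenue {n : ℕ} (A : Auction n) (K : ℕ) (σ : SPM n) : ℝ :=
  ∑ j : (∀ i, Fin (A.supp i)),
    (∏ i, A.prob i (j i)) * realizedRevenue (fun i => A.val i (j i)) K σ.offers

/-! # A real random access machine with unit-cost operations

Programs of a structured language over two random access memories, one of natural numbers (used
for counters and addresses, with addition and truncated subtraction only) and one of real numbers
(with the four field operations). There are two read-only input tapes with random access and two
write-only output tapes. Real numbers are never rounded or turned into natural numbers, they only
enter into field operations and comparisons, and the only constants are natural numbers. Every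
constant, memory or tape access, arithmetic operation, test, and statement costs one step. -/

namespace RealRAM

structure Input where
  nat : ℕ → ℕ
  real : ℕ → ℝ

structure State where
  nat : ℕ → ℕ
  real : ℕ → ℝ
  outNat : List ℕ
  outReal : List ℝ

/-- All memory cells are zero and the output tapes are empty. -/
def State.init : State := ⟨fun _ => 0, fun _ => 0, [], []⟩

inductive NatExpr where
  | const (c : ℕ)
  | mem (addr : NatExpr)
  | inp (addr : NatExpr)
  | add (a b : NatExpr)
  | sub (a b : NatExpr)

inductive RealExpr where
  | const (c : ℕ)
  | mem (addr : NatExpr)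
  | inp (addr : NatExpr)
  | add (a b : RealExpr)
  | sub (a b : RealExpr)
  | mul (a b : RealExpr)
  | div (a b : RealExpr)

inductive Test where
  | natLe (a b : NatExpr)
  | realLe (a b : RealExpr)

inductive Cmd where
  | skip
  | setNat (addr : NatExpr) (e : NatExpr)
  | setReal (addr : NatExpr) (e : RealExpr)
  | writeNat (e : NatExpr)
  | writeReal (e : RealExpr)
  | seq (c d : Cmd)
  | ite (b : Test) (c d : Cmd)
  | loop (b : Test) (c : Cmd)

def NatExpr.eval (I : Input) (s : State) : NatExpr → ℕ
  | const c => c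
  | mem a => s.nat (a.eval I s)
  | inp a => I.nat (a.eval I s)
  | add a b => a.eval I s + b.eval I s
  | sub a b => a.eval I s - b.eval I s

def NatExpr.cost : NatExpr → ℕ
  | const _ => 1
  | mem a => a.cost + 1
  | inp a => a.cost + 1
  | add a b => a.cost + b.cost + 1
  | sub a b => a.cost + b.cost + 1

noncomputable def RealExpr.eval (I : Input) (s : State) : RealExpr → ℝ
  | const c => (c : ℝ)
  | mem a => s.real (a.eval I s)
  | inp a => I.real (a.eval I s)
  | add a b => a.eval I s + b.eval I s
  | sub a b => a.eval I s - b.eval I s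
  | mul a b => a.eval I s * b.eval I s
  | div a b => a.eval I s / b.eval I s

def RealExpr.cost : RealExpr → ℕ
  | const _ => 1
  | mem a => a.cost + 1
  | inp a => a.cost + 1
  | add a b => a.cost + b.cost + 1
  | sub a b => a.cost + b.cost + 1
  | mul a b => a.cost + b.cost + 1
  | div a b => a.cost + b.cost + 1

def Test.Holds (I : Input) (s : State) : Test → Prop
  | natLe a b => a.eval I s ≤ b.eval I s
  | realLe a b => a.eval I s ≤ b.eval I s

def Test.cost : Test → ℕ
  | natLe a b => a.cost + b.cost + 1
  | realLe a b => a.cost + b.cost + 1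

/-- `Exec I c s s' t`: on input `I`, the program `c` started in state `s` terminates in state `s'`
after exactly `t` steps. -/
inductive Exec (I : Input) : Cmd → State → State → ℕ → Prop where
  | skip (s : State) : Exec I .skip s s 1
  | setNat (addr e : NatExpr) (s : State) :
      Exec I (.setNat addr e) s
        { s with nat := Function.update s.nat (addr.eval I s) (e.eval I s) }
        (addr.cost + e.cost + 1)
  | setReal (addr : NatExpr) (e : RealExpr) (s : State) :
      Exec I (.setReal addr e) s
        { s with real := Function.update s.real (addr.eval I s) (e.eval I s) }
        (addr.cost + e.cost + 1)
  | writeNat (e : NatExpr) (s : State) :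
      Exec I (.writeNat e) s { s with outNat := s.outNat ++ [e.eval I s] } (e.cost + 1)
  | writeReal (e : RealExpr) (s : State) :
      Exec I (.writeReal e) s { s with outReal := s.outReal ++ [e.eval I s] } (e.cost + 1)
  | seq {c d : Cmd} {s s₁ s₂ : State} {t u : ℕ} :
      Exec I c s s₁ t → Exec I d s₁ s₂ u → Exec I (.seq c d) s s₂ (t + u)
  | ite_true {b : Test} {c d : Cmd} {s s' : State} {t : ℕ} :
      b.Holds I s → Exec I c s s' t → Exec I (.ite b c d) s s' (b.cost + t + 1)
  | ite_false {b : Test} {c d : Cmd} {s s' : State} {t : ℕ} :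
      ¬ b.Holds I s → Exec I d s s' t → Exec I (.ite b c d) s s' (b.cost + t + 1)
  | loop_false {b : Test} {c : Cmd} {s : State} :
      ¬ b.Holds I s → Exec I (.loop b c) s s (b.cost + 1)
  | loop_true {b : Test} {c : Cmd} {s s₁ s₂ : State} {t u : ℕ} :
      b.Holds I s → Exec I c s s₁ t → Exec I (.loop b c) s₁ s₂ u →
      Exec I (.loop b c) s s₂ (b.cost + t + u + 1)

end RealRAM

/-- The input tapes: the tape of natural numbers holds `n, K` and the `n` support sizes, the tape
of real numbers holds `ε` and then, buyer by buyer, the pairs (value, probability); the remaining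
cells are zero. -/
noncomputable def Auction.encode {n : ℕ} (A : Auction n) (K : ℕ) (ε : ℝ) : RealRAM.Input where
  nat := fun a => (n :: K :: List.ofFn A.supp).getD a 0
  real := fun a => (ε :: (List.finRange n).flatMap fun i =>
    (List.finRange (A.supp i)).flatMap fun j => [A.val i j, A.prob i j]).getD a 0

/-- The output tapes hold the mechanism `σ`: the buyers' indices `0, …, n - 1` in the order of the
offers on one tape and the posted prices, in the same order, on the other. -/
def RealRAM.State.Outputs {n : ℕ} (s : RealRAM.State) (σ : SPM n) : Prop :=
  s.outNat = σ.offers.map (fun o => (o.1 : ℕ)) ∧ s.outReal = σ.offers.map Prod.snd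

/-!
# A polynomial-time approximation scheme for sequential posted prices

Two reductions make the optimization finite. Making expensive offers first does not lose revenue
(`rev_swap_le`), and of the offers in this order only a prefix of total acceptance probability
`O(K + 1 / ε)` matters: by a Chernoff bound (`surv_le_exp`) copies are rarely left after it, and the
offers behind it are cheaper than the ones in it (`rev_append_mul_le`). A greedy partition
(`exists_segments`) cuts the prefix into `O((K + 1 / ε) ^ 3)` segments, each of which is a single
offer or has total acceptance probability at most `δ`, where `1 / δ` is of order `(K + 1 / ε) ^ 2`.
Replacing each segment by one offer with the same acceptance probability and the same expected
payment changes the revenue by an error of second order in `δ` per segment, and by a factor `1 - δ`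
at most overall (`rev_flatten_le_merged`, `merged_le_rev_flatten`). So it suffices to maximize this
merged revenue over the plans, which assign the buyers to segments and prices
(`expectedRevenue_optimal_plan`).

The merged revenue is the sum over the segments of the expected payment in the segment times the
probability that a copy is left there (`merged_ofFn`), and the latter depends on the total acceptance
probabilities of the segments only. Being multiples of `1 / (10 * n ^ 2)`, these take polynomially
many values. Together with the numbers of offers in the segments, which tell whether a plan is
admissible, they are the digits of one natural number, the code of the plan. The code is a sum of
contributions of the single buyers (`Plan.code`), and for a given code so is the merged revenue
(`Plan.sum_optGain`). Hence, for each code, a knapsack-like dynamic program over the buyers finds the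
best plan with this code (`run_fillTable`, `run_traceBack`), and the search runs through all codes
(`run_search`).

The machine has no arrays, no counting loops and no multiplication of natural numbers. The program is
therefore written in a small language with named arrays and loops with fixed bounds, whose semantics
is a total function (`Com.run`). A translation into machine programs is correct (`Com.exec_compile`)
and takes a number of steps that is polynomial in the largest loop bound (`Com.exists_cost_le`). The
largest bound is the number of codes, `(10 * n ^ 3 + 1) ^ O((K + 1 / ε) ^ 3)`. Only the integer that
stands for `1 / ε` has to be found by a loop of the machine language itself (`exec_count`).
-/


/-! ### A structured language with named arrays and counting loops -/

namespace PostedPrice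

open RealRAM

/-- The arrays of natural numbers; a scalar is the cell `0` of its array. From `buyers` to `codes`
these are parameters; `invEps` is an integer that stands for `1 / ε`. The arrays `pow` and `dig`
hold the powers of `base` and the digits of `target`, `chSeg` and `chCost` the choices recorded for
the table entries, and `bestSeg` the segments of the buyers in the best plan found. The other
variables are loop counters and scratch registers. -/
inductive NVar
  | buyers | copies | invEps | scale | units | slack | segs | digits | base | codes
  | target | d | s | i | j | k | t | c
  | pow | dig | chSeg | chCost | bestSeg
  | quo | rem | ok | acc | row | off | cost | ptr | cur
  deriving DecidableEq

/-- The arrays of real numbers; a scalar is the cell `0` of its array. The arrays `surv` and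
`weight` hold the probabilities that copies are left at the segments, `table` the dynamic program,
and `chPrice` and `bestPrice` the prices that belong to `chSeg` and `bestSeg`. -/
inductive RVar
  | invEps | units | mass | surv | weight | table | chPrice | bestPrice | best | prob | cnt | gain
  deriving DecidableEq

/-- The number of arrays that are interleaved in one memory: cell `i` of the array with number `a`
has address `a + stride * i`. -/
def stride : ℕ := 32

theorem NVar.ctorIdx_lt (v : NVar) : v.ctorIdx < stride := by
  cases v <;> decide

theorem RVar.ctorIdx_lt (v : RVar) : v.ctorIdx < stride := by
  cases v <;> decide

theorem NVar.ctorIdx_inj {v w : NVar} (h : v.ctorIdx = w.ctorIdx) : v = w := by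
  rw [← NVar.ofNat_ctorIdx v, h, NVar.ofNat_ctorIdx]

theorem RVar.ctorIdx_inj {v w : RVar} (h : v.ctorIdx = w.ctorIdx) : v = w := by
  rw [← RVar.ofNat_ctorIdx v, h, RVar.ofNat_ctorIdx]

/-- A machine state, seen as a family of named arrays. -/
structure Mem where
  nat : NVar → ℕ → ℕ
  real : RVar → ℕ → ℝ
  outNat : List ℕ
  outReal : List ℝ

/-- Expressions for natural numbers; `get v i` is cell `i` of the array `v`. -/
inductive NExp
  | const (c : ℕ)
  | get (v : NVar) (i : NExp)
  | inp (i : NExp)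
  | add (a b : NExp)
  | sub (a b : NExp)

/-- Expressions for real numbers, which are indexed by natural numbers. -/
inductive RExp
  | const (c : ℕ)
  | get (v : RVar) (i : NExp)
  | inp (i : NExp)
  | add (a b : RExp)
  | sub (a b : RExp)
  | mul (a b : RExp)
  | div (a b : RExp)

/-- Tests. -/
inductive BExp
  | natLe (a b : NExp)
  | realLe (a b : RExp)

/-- Commands. The loop `loop x b c` runs `c` for `x = 0, 1, …` below the value of the scalar
`b`. -/
inductive Com
  | skip
  | setNat (v : NVar) (i e : NExp)
  | setReal (v : RVar) (i : NExp) (e : RExp)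
  | writeNat (e : NExp)
  | writeReal (e : RExp)
  | seq (c d : Com)
  | ite (b : BExp) (c d : Com)
  | loop (x b : NVar) (c : Com)

namespace Mem

def setNat (m : Mem) (v : NVar) (i x : ℕ) : Mem :=
  { m with nat := fun w j => if w = v ∧ j = i then x else m.nat w j }

def setReal (m : Mem) (v : RVar) (i : ℕ) (x : ℝ) : Mem :=
  { m with real := fun w j => if w = v ∧ j = i then x else m.real w j }

def writeNat (m : Mem) (x : ℕ) : Mem := { m with outNat := m.outNat ++ [x] }

def writeReal (m : Mem) (x : ℝ) : Mem := { m with outReal := m.outReal ++ [x] }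

@[simp] theorem nat_setNat (m : Mem) (v w : NVar) (i x j : ℕ) :
    (m.setNat v i x).nat w j = if w = v ∧ j = i then x else m.nat w j := rfl
@[simp] theorem real_setNat (m : Mem) (v : NVar) (i x : ℕ) :
    (m.setNat v i x).real = m.real := rfl
@[simp] theorem outNat_setNat (m : Mem) (v : NVar) (i x : ℕ) :
    (m.setNat v i x).outNat = m.outNat := rfl
@[simp] theorem outReal_setNat (m : Mem) (v : NVar) (i x : ℕ) :
    (m.setNat v i x).outReal = m.outReal := rfl
@[simp] theorem real_setReal (m : Mem) (v w : RVar) (i : ℕ) (x : ℝ) (j : ℕ) :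
    (m.setReal v i x).real w j = if w = v ∧ j = i then x else m.real w j := rfl
@[simp] theorem nat_setReal (m : Mem) (v : RVar) (i : ℕ) (x : ℝ) :
    (m.setReal v i x).nat = m.nat := rfl
@[simp] theorem outNat_setReal (m : Mem) (v : RVar) (i : ℕ) (x : ℝ) :
    (m.setReal v i x).outNat = m.outNat := rfl
@[simp] theorem outReal_setReal (m : Mem) (v : RVar) (i : ℕ) (x : ℝ) :
    (m.setReal v i x).outReal = m.outReal := rfl
@[simp] theorem nat_writeNat (m : Mem) (x : ℕ) : (m.writeNat x).nat = m.nat := rfl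
@[simp] theorem real_writeNat (m : Mem) (x : ℕ) : (m.writeNat x).real = m.real := rfl
@[simp] theorem outNat_writeNat (m : Mem) (x : ℕ) :
    (m.writeNat x).outNat = m.outNat ++ [x] := rfl
@[simp] theorem outReal_writeNat (m : Mem) (x : ℕ) :
    (m.writeNat x).outReal = m.outReal := rfl
@[simp] theorem nat_writeReal (m : Mem) (x : ℝ) : (m.writeReal x).nat = m.nat := rfl
@[simp] theorem real_writeReal (m : Mem) (x : ℝ) : (m.writeReal x).real = m.real := rfl
@[simp] theorem outNat_writeReal (m : Mem) (x : ℝ) :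
    (m.writeReal x).outNat = m.outNat := rfl
@[simp] theorem outReal_writeReal (m : Mem) (x : ℝ) :
    (m.writeReal x).outReal = m.outReal ++ [x] := rfl

end Mem

namespace NExp

instance : Add NExp := ⟨add⟩
instance : Sub NExp := ⟨sub⟩
instance (c : ℕ) : OfNat NExp c := ⟨const c⟩
instance : Coe NVar NExp := ⟨fun v => get v (const 0)⟩

def eval (I : Input) (m : Mem) : NExp → ℕ
  | const c => c
  | get v i => m.nat v (i.eval I m)
  | inp i => I.nat (i.eval I m)
  | add a b => a.eval I m + b.eval I m
  | sub a b => a.eval I m - b.eval I m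

variable (I : Input) (m : Mem)

@[simp] theorem eval_ofNat (c : ℕ) : eval I m ofNat(c) = (OfNat.ofNat c : ℕ) := rfl
@[simp] theorem eval_const (c : ℕ) : eval I m (const c) = c := rfl
@[simp] theorem eval_get (v : NVar) (i : NExp) : eval I m (get v i) = m.nat v (i.eval I m) := rfl
@[simp] theorem eval_inp (i : NExp) : eval I m (inp i) = I.nat (i.eval I m) := rfl
@[simp] theorem eval_add (a b : NExp) : eval I m (a + b) = a.eval I m + b.eval I m := rfl
@[simp] theorem eval_sub (a b : NExp) : eval I m (a - b) = a.eval I m - b.eval I m := rfl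

/-- The expression `k * a`, written as a sum, since the machine cannot multiply natural
numbers. -/
def nsmul (a : NatExpr) : ℕ → NatExpr
  | 0 => .const 0
  | k + 1 => .add (nsmul a k) a

def compile : NExp → NatExpr
  | const c => .const c
  | get v i => .mem (.add (.const v.ctorIdx) (nsmul i.compile stride))
  | inp i => .inp i.compile
  | add a b => .add a.compile b.compile
  | sub a b => .sub a.compile b.compile

end NExp

namespace RExp

instance : Add RExp := ⟨add⟩
instance : Sub RExp := ⟨sub⟩
instance : Mul RExp := ⟨mul⟩
instance : Div RExp := ⟨div⟩
instance (c : ℕ) : OfNat RExp c := ⟨const c⟩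
instance : Coe RVar RExp := ⟨fun v => get v (.const 0)⟩

noncomputable def eval (I : Input) (m : Mem) : RExp → ℝ
  | const c => (c : ℝ)
  | get v i => m.real v (i.eval I m)
  | inp i => I.real (i.eval I m)
  | add a b => a.eval I m + b.eval I m
  | sub a b => a.eval I m - b.eval I m
  | mul a b => a.eval I m * b.eval I m
  | div a b => a.eval I m / b.eval I m

variable (I : Input) (m : Mem)

@[simp] theorem eval_ofNat (c : ℕ) : eval I m ofNat(c) = ((OfNat.ofNat c : ℕ) : ℝ) := rfl
@[simp] theorem eval_get (v : RVar) (i : NExp) : eval I m (get v i) = m.real v (i.eval I m) := rfl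
@[simp] theorem eval_inp (i : NExp) : eval I m (inp i) = I.real (i.eval I m) := rfl
@[simp] theorem eval_add (a b : RExp) : eval I m (a + b) = a.eval I m + b.eval I m := rfl
@[simp] theorem eval_sub (a b : RExp) : eval I m (a - b) = a.eval I m - b.eval I m := rfl
@[simp] theorem eval_mul (a b : RExp) : eval I m (a * b) = a.eval I m * b.eval I m := rfl
@[simp] theorem eval_div (a b : RExp) : eval I m (a / b) = a.eval I m / b.eval I m := rfl

def compile : RExp → RealExpr
  | const c => .const c
  | get v i => .mem (.add (.const v.ctorIdx) (NExp.nsmul i.compile stride))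
  | inp i => .inp i.compile
  | add a b => .add a.compile b.compile
  | sub a b => .sub a.compile b.compile
  | mul a b => .mul a.compile b.compile
  | div a b => .div a.compile b.compile

end RExp

namespace BExp

def Holds (I : Input) (m : Mem) : BExp → Prop
  | natLe a b => a.eval I m ≤ b.eval I m
  | realLe a b => a.eval I m ≤ b.eval I m

@[simp] theorem holds_natLe (I : Input) (m : Mem) (a b : NExp) :
    Holds I m (natLe a b) ↔ a.eval I m ≤ b.eval I m := Iff.rfl
@[simp] theorem holds_realLe (I : Input) (m : Mem) (a b : RExp) :
    Holds I m (realLe a b) ↔ a.eval I m ≤ b.eval I m := Iff.rfl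

def compile : BExp → Test
  | natLe a b => .natLe a.compile b.compile
  | realLe a b => .realLe a.compile b.compile

end BExp

infix:50 " ≼ " => BExp.natLe
infix:50 " ≼ᵣ " => BExp.realLe
infixr:35 " ;; " => Com.seq

namespace Com

open Classical in
/-- The final memory. -/
noncomputable def run (I : Input) : Com → Mem → Mem
  | skip, m => m
  | setNat v i e, m => m.setNat v (i.eval I m) (e.eval I m)
  | setReal v i e, m => m.setReal v (i.eval I m) (e.eval I m)
  | writeNat e, m => m.writeNat (e.eval I m)
  | writeReal e, m => m.writeReal (e.eval I m)
  | seq c d, m => d.run I (c.run I m)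
  | ite b c d, m => if b.Holds I m then c.run I m else d.run I m
  | loop x b c, m => Nat.rec (m.setNat x 0 0)
      (fun k m' => (c.run I m').setNat x 0 (k + 1)) (m.nat b 0)

/-- Whether `c` may change the array `v` of natural numbers. -/
def setsNat (v : NVar) : Com → Bool
  | setNat w _ _ => w == v
  | seq c d => c.setsNat v || d.setsNat v
  | ite _ c d => c.setsNat v || d.setsNat v
  | loop x _ c => x == v || c.setsNat v
  | _ => false

/-- Whether `c` may change the array `v` of real numbers. -/
def setsReal (v : RVar) : Com → Bool
  | setReal w _ _ => w == v
  | seq c d => c.setsReal v || d.setsReal v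
  | ite _ c d => c.setsReal v || d.setsReal v
  | loop _ _ c => c.setsReal v
  | _ => false

/-- Whether `c` contains no output statement. -/
def silent : Com → Bool
  | writeNat _ => false
  | writeReal _ => false
  | seq c d => c.silent && d.silent
  | ite _ c d => c.silent && d.silent
  | loop _ _ c => c.silent
  | _ => true

/-- No loop body changes its counter, and the bounds of all loops are scalars in `fx`, none of
which is changed by `c`. -/
def WellFormed (fx : NVar → Bool) : Com → Bool
  | setNat v _ _ => !fx v
  | seq c d => c.WellFormed fx && d.WellFormed fx
  | ite _ c d => c.WellFormed fx && d.WellFormed fx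
  | loop x b c => !fx x && fx b && !c.setsNat x && c.WellFormed fx
  | _ => true

/-- The address of cell `i` of the array with number `a`. -/
def address (a : ℕ) (i : NExp) : NatExpr := .add (.const a) (NExp.nsmul i.compile stride)

/-- The machine program of a command. -/
def compile : Com → Cmd
  | skip => .skip
  | setNat v i e => .setNat (address v.ctorIdx i) e.compile
  | setReal v i e => .setReal (address v.ctorIdx i) e.compile
  | writeNat e => .writeNat e.compile
  | writeReal e => .writeReal e.compile
  | seq c d => .seq c.compile d.compile
  | ite b c d => .ite b.compile c.compile d.compile
  | loop x b c => .seq (.setNat (address x.ctorIdx 0) (.const 0))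
      (.loop (x + 1 ≼ b : BExp).compile
        (.seq c.compile (.setNat (address x.ctorIdx 0) (x + 1 : NExp).compile)))

/-- An upper bound for the number of steps when all loop bounds are at most `N`. -/
def cost (N : ℕ) : Com → ℕ
  | seq c d => c.cost N + d.cost N
  | ite b c d => b.compile.cost + c.cost N + d.cost N + 1
  | loop x b c => (address x.ctorIdx 0).cost + 2 +
      N * ((x + 1 ≼ b : BExp).compile.cost + c.cost N +
        ((address x.ctorIdx 0).cost + (x + 1 : NExp).compile.cost + 1) + 1) +
      ((x + 1 ≼ b : BExp).compile.cost + 1)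
  | skip => 1
  | setNat v i e => (address v.ctorIdx i).cost + e.compile.cost + 1
  | setReal v i e => (address v.ctorIdx i).cost + e.compile.cost + 1
  | writeNat e => e.compile.cost + 1
  | writeReal e => e.compile.cost + 1

variable (I : Input)

section Semantics
variable (m : Mem)

@[simp] theorem run_skip : run I skip m = m := rfl
@[simp] theorem run_setNat (v : NVar) (i e : NExp) :
    run I (setNat v i e) m = m.setNat v (i.eval I m) (e.eval I m) := rfl
@[simp] theorem run_setReal (v : RVar) (i : NExp) (e : RExp) :
    run I (setReal v i e) m = m.setReal v (i.eval I m) (e.eval I m) := rfl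
@[simp] theorem run_writeNat (e : NExp) : run I (writeNat e) m = m.writeNat (e.eval I m) := rfl
@[simp] theorem run_writeReal (e : RExp) : run I (writeReal e) m = m.writeReal (e.eval I m) := rfl
@[simp] theorem run_seq (c d : Com) : run I (c ;; d) m = run I d (run I c m) := rfl

open Classical in
theorem run_ite (b : BExp) (c d : Com) :
    run I (ite b c d) m = if b.Holds I m then c.run I m else d.run I m := rfl

variable {I m}

theorem run_ite_pos {b : BExp} {c d : Com} (h : b.Holds I m) :
    run I (ite b c d) m = run I c m := by
  rw [run_ite, if_pos h]

theorem run_ite_neg {b : BExp} {c d : Com} (h : ¬ b.Holds I m) :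
    run I (ite b c d) m = run I d m := by
  rw [run_ite, if_neg h]

end Semantics

/-- A command leaves alone the arrays that it does not assign to. -/
theorem run_nat_frame (v : NVar) (c : Com) (m : Mem) (h : c.setsNat v = false) :
    (c.run I m).nat v = m.nat v := by
  induction c generalizing m with
  | skip | setReal | writeNat | writeReal => rfl
  | setNat w i e =>
    have : w ≠ v := by simpa [setsNat] using h
    funext j
    simp [this.symm]
  | seq c d hc hd =>
    simp only [setsNat, Bool.or_eq_false_iff] at h
    rw [run_seq, hd _ h.2, hc _ h.1]
  | ite b c d hc hd =>
    simp only [setsNat, Bool.or_eq_false_iff] at h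
    rw [run_ite]
    split_ifs
    exacts [hc _ h.1, hd _ h.2]
  | loop x b c hc =>
    simp only [setsNat, Bool.or_eq_false_iff, beq_eq_false_iff_ne] at h
    simp only [run]
    induction m.nat b 0 with
    | zero => funext j; simp [h.1.symm]
    | succ k ih => funext j; simp [h.1.symm, hc _ h.2, ih]

/-- A command leaves alone the arrays that it does not assign to. -/
theorem run_real_frame (v : RVar) (c : Com) (m : Mem) (h : c.setsReal v = false) :
    (c.run I m).real v = m.real v := by
  induction c generalizing m with
  | skip | setNat | writeNat | writeReal => rfl
  | setReal w i e =>
    have : w ≠ v := by simpa [setsReal] using h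
    funext j
    simp [this.symm]
  | seq c d hc hd =>
    simp only [setsReal, Bool.or_eq_false_iff] at h
    rw [run_seq, hd _ h.2, hc _ h.1]
  | ite b c d hc hd =>
    simp only [setsReal, Bool.or_eq_false_iff] at h
    rw [run_ite]
    split_ifs
    exacts [hc _ h.1, hd _ h.2]
  | loop x b c hc =>
    simp only [setsReal] at h
    simp only [run]
    induction m.nat b 0 with
    | zero => rfl
    | succ k ih => simp [hc _ h, ih]

theorem run_out_frame (c : Com) (m : Mem) (h : c.silent = true) :
    (c.run I m).outNat = m.outNat ∧ (c.run I m).outReal = m.outReal := by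
  induction c generalizing m with
  | skip | setNat | setReal => exact ⟨rfl, rfl⟩
  | writeNat | writeReal => simp [silent] at h
  | seq c d hc hd =>
    simp only [silent, Bool.and_eq_true] at h
    rw [run_seq, (hd _ h.2).1, (hd _ h.2).2]
    exact hc _ h.1
  | ite b c d hc hd =>
    simp only [silent, Bool.and_eq_true] at h
    rw [run_ite]
    split_ifs
    exacts [hc _ h.1, hd _ h.2]
  | loop x b c hc =>
    simp only [silent] at h
    simp only [run]
    induction m.nat b 0 with
    | zero => exact ⟨rfl, rfl⟩
    | succ k ih => simpa [hc _ h] using ih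

/-- The invariant rule for loops. In the induction step, everything that the body does not change
may be assumed to be as it was before the loop. -/
theorem loop_induction {x b : NVar} {c : Com} {m : Mem} (P : ℕ → Mem → Prop)
    (zero : P 0 (m.setNat x 0 0))
    (step : ∀ k < m.nat b 0, ∀ m' : Mem, m'.nat x 0 = k →
      (∀ v, c.setsNat v = false → v ≠ x → m'.nat v = m.nat v) →
      (∀ v, c.setsReal v = false → m'.real v = m.real v) →
      P k m' → P (k + 1) ((c.run I m').setNat x 0 (k + 1))) :
    P (m.nat b 0) ((loop x b c).run I m) := by
  simp only [run]
  suffices H : ∀ N ≤ m.nat b 0, ∀ m' : Mem, m' = Nat.rec (m.setNat x 0 0)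
      (fun k m' => (c.run I m').setNat x 0 (k + 1)) N →
      m'.nat x 0 = N ∧ (∀ v, c.setsNat v = false → v ≠ x → m'.nat v = m.nat v) ∧
      (∀ v, c.setsReal v = false → m'.real v = m.real v) ∧ P N m' from
    (H _ le_rfl _ rfl).2.2.2
  intro N
  induction N with
  | zero =>
    rintro - m' rfl
    refine ⟨by simp, fun v _ hv => ?_, fun v _ => rfl, zero⟩
    funext j
    simp [hv]
  | succ k ih =>
    rintro hk m' rfl
    obtain ⟨h1, h2, h3, h4⟩ := ih (by omega) _ rfl
    refine ⟨by simp, fun v hv hvx => ?_, fun v hv => ?_, step k (by omega) _ h1 h2 h3 h4⟩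
    · funext j
      simp only [Mem.nat_setNat, hvx, false_and, if_false]
      rw [run_nat_frame I v c _ hv, h2 v hv hvx]
    · simp only [Mem.real_setNat]
      rw [run_real_frame I v c _ hv, h3 v hv]

end Com

/-! ### Correctness of the compilation -/

/-- The machine state `s` represents the family of arrays `m`. -/
structure Mem.Repr (m : Mem) (s : State) : Prop where
  nat : ∀ v i, s.nat (v.ctorIdx + stride * i) = m.nat v i
  real : ∀ v i, s.real (v.ctorIdx + stride * i) = m.real v i
  outNat : s.outNat = m.outNat
  outReal : s.outReal = m.outReal

variable {I : Input} {m : Mem} {s : State}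

theorem NExp.eval_nsmul (e : NatExpr) (k : ℕ) : (nsmul e k).eval I s = k * e.eval I s := by
  induction k with
  | zero => simp [nsmul, NatExpr.eval]
  | succ k ih => simp [nsmul, NatExpr.eval, ih]; ring

theorem NExp.eval_compile (h : m.Repr s) (e : NExp) : e.compile.eval I s = e.eval I m := by
  induction e with
  | const => rfl
  | get v i ih => simp only [compile, NatExpr.eval, eval_nsmul, ih, h.nat, eval]
  | inp i ih => simp only [compile, NatExpr.eval, ih, eval]
  | add a b ha hb => simp only [compile, NatExpr.eval, ha, hb, eval]
  | sub a b ha hb => simp only [compile, NatExpr.eval, ha, hb, eval]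

theorem RExp.eval_compile (h : m.Repr s) (e : RExp) : e.compile.eval I s = e.eval I m := by
  induction e with
  | const => rfl
  | get v i => simp only [compile, NatExpr.eval, RealExpr.eval, NExp.eval_nsmul,
      NExp.eval_compile h, h.real, eval]
  | inp i => simp only [compile, RealExpr.eval, NExp.eval_compile h, eval]
  | add a b ha hb => simp only [compile, RealExpr.eval, ha, hb, eval]
  | sub a b ha hb => simp only [compile, RealExpr.eval, ha, hb, eval]
  | mul a b ha hb => simp only [compile, RealExpr.eval, ha, hb, eval]
  | div a b ha hb => simp only [compile, RealExpr.eval, ha, hb, eval]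

theorem BExp.holds_compile (h : m.Repr s) (b : BExp) : b.compile.Holds I s ↔ b.Holds I m := by
  cases b <;> simp [compile, Test.Holds, NExp.eval_compile h, RExp.eval_compile h]

theorem Com.eval_address (h : m.Repr s) (a : ℕ) (i : NExp) :
    (address a i).eval I s = a + stride * i.eval I m := by
  simp only [address, NatExpr.eval, NExp.eval_nsmul, NExp.eval_compile h]

theorem stride_injective {a b i j : ℕ} (ha : a < stride) (hb : b < stride)
    (h : a + stride * i = b + stride * j) : a = b ∧ i = j := by
  unfold stride at *
  omega

theorem Mem.Repr.setNat (h : m.Repr s) (v : NVar) (i x : ℕ) :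
    (m.setNat v i x).Repr
      { s with nat := Function.update s.nat (v.ctorIdx + stride * i) x } where
  nat w j := by
    by_cases hw : w = v ∧ j = i
    · obtain ⟨rfl, rfl⟩ := hw
      simp
    · rw [Mem.nat_setNat, if_neg hw, ← h.nat]
      refine Function.update_of_ne (fun e => ?_) _ _
      obtain ⟨h1, h2⟩ := stride_injective w.ctorIdx_lt v.ctorIdx_lt e
      exact hw ⟨NVar.ctorIdx_inj h1, h2⟩
  real := h.real
  outNat := h.outNat
  outReal := h.outReal

theorem Mem.Repr.setReal (h : m.Repr s) (v : RVar) (i : ℕ) (x : ℝ) :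
    (m.setReal v i x).Repr
      { s with real := Function.update s.real (v.ctorIdx + stride * i) x } where
  nat := h.nat
  real w j := by
    by_cases hw : w = v ∧ j = i
    · obtain ⟨rfl, rfl⟩ := hw
      simp
    · rw [Mem.real_setReal, if_neg hw, ← h.real]
      refine Function.update_of_ne (fun e => ?_) _ _
      obtain ⟨h1, h2⟩ := stride_injective w.ctorIdx_lt v.ctorIdx_lt e
      exact hw ⟨RVar.ctorIdx_inj h1, h2⟩
  outNat := h.outNat
  outReal := h.outReal

namespace Com

theorem exec_setNat (h : m.Repr s) (v : NVar) (i e : NExp) :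
    ∃ s', Exec I (.setNat (address v.ctorIdx i) e.compile) s s'
      ((address v.ctorIdx i).cost + e.compile.cost + 1) ∧
      ((setNat v i e).run I m).Repr s' := by
  refine ⟨_, Exec.setNat _ _ s, ?_⟩
  rw [eval_address h, NExp.eval_compile h]
  exact h.setNat _ _ _

/-- Compiled programs do what they should, within the time given by `cost`. Termination is built in,
because the bounds of all loops stay fixed. -/
theorem exec_compile {fx : NVar → Bool} {N : ℕ} (c : Com) (hc : c.WellFormed fx = true)
    (hN : ∀ v, fx v = true → m.nat v 0 ≤ N) (h : m.Repr s) :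
    ∃ s' t, Exec I c.compile s s' t ∧ t ≤ c.cost N ∧ (c.run I m).Repr s' := by
  have frame : ∀ (c : Com), c.WellFormed fx = true → ∀ v, fx v = true → c.setsNat v = false := by
    intro c hc v hv
    induction c with
    | skip | setReal | writeNat | writeReal => rfl
    | setNat w i e =>
      simp only [WellFormed, Bool.not_eq_true'] at hc
      simp only [setsNat, beq_eq_false_iff_ne]
      rintro rfl
      simp [hc] at hv
    | seq c d h1 h2 =>
      simp only [WellFormed, Bool.and_eq_true] at hc
      simp [setsNat, h1 hc.1, h2 hc.2]
    | ite b c d h1 h2 =>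
      simp only [WellFormed, Bool.and_eq_true] at hc
      simp [setsNat, h1 hc.1, h2 hc.2]
    | loop x b c h1 =>
      simp only [WellFormed, Bool.and_eq_true, Bool.not_eq_true'] at hc
      simp only [setsNat, h1 hc.2, Bool.or_false, beq_eq_false_iff_ne]
      rintro rfl
      simp [hc.1.1.1] at hv
  induction c generalizing m s with
  | skip => exact ⟨_, _, Exec.skip s, le_rfl, h⟩
  | setNat v i e =>
    obtain ⟨s', h1, h2⟩ := exec_setNat (I := I) h v i e
    exact ⟨s', _, h1, le_rfl, h2⟩
  | setReal v i e =>
    refine ⟨_, _, Exec.setReal _ _ s, le_rfl, ?_⟩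
    rw [eval_address h, RExp.eval_compile h]
    exact h.setReal _ _ _
  | writeNat e =>
    refine ⟨_, _, Exec.writeNat _ s, le_rfl, h.nat, h.real, ?_, h.outReal⟩
    simp [h.outNat, NExp.eval_compile h]
  | writeReal e =>
    refine ⟨_, _, Exec.writeReal _ s, le_rfl, h.nat, h.real, h.outNat, ?_⟩
    simp [h.outReal, RExp.eval_compile h]
  | seq c d h1 h2 =>
    simp only [WellFormed, Bool.and_eq_true] at hc
    obtain ⟨s', t, e1, l1, r1⟩ := h1 hc.1 hN h
    obtain ⟨s'', u, e2, l2, r2⟩ := h2 hc.2 (m := c.run I m) (fun v hv => by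
      rw [run_nat_frame I v c m (frame c hc.1 v hv)]; exact hN v hv) r1
    exact ⟨s'', _, Exec.seq e1 e2, Nat.add_le_add l1 l2, r2⟩
  | ite b c d h1 h2 =>
    simp only [WellFormed, Bool.and_eq_true] at hc
    rw [run_ite]
    split_ifs with hb
    · obtain ⟨s', t, e1, l1, r1⟩ := h1 hc.1 hN h
      refine ⟨s', _, Exec.ite_true ((BExp.holds_compile h b).2 hb) e1, ?_, r1⟩
      simp only [cost]
      omega
    · obtain ⟨s', t, e1, l1, r1⟩ := h2 hc.2 hN h
      refine ⟨s', _, Exec.ite_false (fun h' => hb ((BExp.holds_compile h b).1 h')) e1, ?_, r1⟩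
      simp only [cost]
      omega
  | loop x b c h1 =>
    simp only [WellFormed, Bool.and_eq_true, Bool.not_eq_true'] at hc
    obtain ⟨⟨⟨hx, hb⟩, hcx⟩, hc⟩ := hc
    have hbx : b ≠ x := by
      rintro rfl
      simp [hx] at hb
    obtain ⟨s₀, e0, r0⟩ := exec_setNat (I := I) h x 0 0
    -- The iterations from the `k`-th one on; induction on the number `j` of iterations left.
    have key : ∀ j k : ℕ, k + j = m.nat b 0 → ∀ (m' : Mem) (s' : State), m'.Repr s' →
        m' = Nat.rec (m.setNat x 0 0) (fun k m' => (c.run I m').setNat x 0 (k + 1)) k →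
        m'.nat x 0 = k → (∀ v, fx v = true → m'.nat v 0 = m.nat v 0) →
        ∃ s'' t, Exec I (.loop (x + 1 ≼ b : BExp).compile
          (.seq c.compile (.setNat (address x.ctorIdx 0) (x + 1 : NExp).compile))) s' s'' t ∧
          t ≤ j * ((x + 1 ≼ b : BExp).compile.cost + c.cost N +
            ((address x.ctorIdx 0).cost + (x + 1 : NExp).compile.cost + 1) + 1) +
            ((x + 1 ≼ b : BExp).compile.cost + 1) ∧ ((loop x b c).run I m).Repr s'' := by
      intro j
      induction j with
      | zero =>
        intro k hk m' s' hr hm hk' hf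
        refine ⟨s', _, Exec.loop_false ?_, by omega, ?_⟩
        · rw [BExp.holds_compile hr]
          simp [hk', hf b hb, ← hk]
        · simp only [run, ← hk]
          rw [Nat.add_zero, ← hm]
          exact hr
      | succ j ih =>
        intro k hk m' s' hr hm hk' hf
        have hcond : (x + 1 ≼ b : BExp).compile.Holds I s' := by
          rw [BExp.holds_compile hr]
          simp [hk', hf b hb]
          omega
        obtain ⟨s₁, t₁, e₁, l₁, r₁⟩ := h1 hc (m := m') (fun v hv => by
          rw [hf v hv]; exact hN v hv) hr
        obtain ⟨s₂, e₂, r₂⟩ := exec_setNat (I := I) r₁ x 0 (x + 1)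
        have hx' : (c.run I m').nat x 0 = k := by rw [run_nat_frame I x c m' hcx, hk']
        obtain ⟨s₃, t₃, e₃, l₃, r₃⟩ := ih (k + 1) (by omega)
          ((setNat x 0 (x + 1)).run I (c.run I m')) s₂ r₂ (by simp [hx', ← hm]) (by simp [hx'])
          (fun v hv => by
            have hvx : v ≠ x := by
              rintro rfl
              simp [hx] at hv
            simp [hvx, run_nat_frame I v c m' (frame c hc v hv), hf v hv])
        refine ⟨s₃, _, Exec.loop_true hcond (Exec.seq e₁ e₂) e₃, ?_, r₃⟩
        rw [Nat.succ_mul]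
        omega
    obtain ⟨s₁, t₁, e₁, l₁, r₁⟩ := key (m.nat b 0) 0 (by omega) _ s₀ r0 rfl (by simp)
      (fun v hv => by
        have hvx : v ≠ x := by
          rintro rfl
          simp [hx] at hv
        simp [hvx])
    refine ⟨s₁, _, Exec.seq e0 e₁, ?_, r₁⟩
    have := Nat.mul_le_mul_right ((x + 1 ≼ b : BExp).compile.cost + c.cost N +
            ((address x.ctorIdx 0).cost + (x + 1 : NExp).compile.cost + 1) + 1) (hN b hb)
    have h0 : (0 : NExp).compile.cost = 1 := rfl
    simp only [cost]
    omega

/-- The running time is polynomial in the largest loop bound. -/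
theorem exists_cost_le (c : Com) : ∃ C d : ℕ, ∀ N, c.cost N ≤ C * (N + 1) ^ d := by
  have triv : ∀ {f : ℕ → ℕ} (C : ℕ), (∀ N, f N ≤ C) → ∃ C d : ℕ, ∀ N, f N ≤ C * (N + 1) ^ d :=
    fun C h => ⟨C, 0, fun N => by simpa using h N⟩
  have add : ∀ {f g : ℕ → ℕ}, (∃ C d : ℕ, ∀ N, f N ≤ C * (N + 1) ^ d) →
      (∃ C d : ℕ, ∀ N, g N ≤ C * (N + 1) ^ d) →
      ∃ C d : ℕ, ∀ N, f N + g N ≤ C * (N + 1) ^ d := by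
    rintro f g ⟨C, d, h⟩ ⟨C', d', h'⟩
    refine ⟨C + C', d + d', fun N => ?_⟩
    have h1 : (N + 1) ^ d ≤ (N + 1) ^ (d + d') := Nat.pow_le_pow_right (by omega) (by omega)
    have h2 : (N + 1) ^ d' ≤ (N + 1) ^ (d + d') := Nat.pow_le_pow_right (by omega) (by omega)
    calc f N + g N ≤ C * (N + 1) ^ d + C' * (N + 1) ^ d' := Nat.add_le_add (h N) (h' N)
      _ ≤ C * (N + 1) ^ (d + d') + C' * (N + 1) ^ (d + d') := by gcongr
      _ = _ := by ring
  induction c with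
  | skip => exact triv 1 fun N => le_rfl
  | setNat v i e => exact triv _ fun N => le_rfl
  | setReal v i e => exact triv _ fun N => le_rfl
  | writeNat e => exact triv _ fun N => le_rfl
  | writeReal e => exact triv _ fun N => le_rfl
  | seq c d hc hd => exact add hc hd
  | ite b c d hc hd =>
    exact add (add (add (triv _ fun N => le_rfl) hc) hd) (triv 1 fun N => le_rfl)
  | loop x b c hc =>
    refine add (add (triv _ fun N => le_rfl) ?_) (triv _ fun N => le_rfl)
    obtain ⟨C, d, h⟩ := add (add (add (triv (x + 1 ≼ b : BExp).compile.cost fun N => le_rfl) hc)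
      (triv ((address x.ctorIdx 0).cost + (x + 1 : NExp).compile.cost + 1) fun N => le_rfl))
      (triv 1 fun N => le_rfl)
    refine ⟨C, d + 1, fun N => ?_⟩
    calc _ ≤ (N + 1) * (C * (N + 1) ^ d) := Nat.mul_le_mul (by omega) (h N)
      _ = _ := by ring

end Com
end PostedPrice

/-! ### Expected revenue of a list of offers -/

namespace PostedPrice

/-- The expected revenue, with `k` copies, of a list of offers that are accepted independently of
each other; an offer is a pair (acceptance probability, price). -/
noncomputable def rev : ℕ → List (ℝ × ℝ) → ℝ
  | 0, _ => 0
  | _ + 1, [] => 0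
  | k + 1, o :: l => o.1 * (o.2 + rev k l) + (1 - o.1) * rev (k + 1) l

/-- The probability that fewer than `k` offers are accepted, for independent offers with the
given acceptance probabilities. -/
noncomputable def surv : ℕ → List ℝ → ℝ
  | 0, _ => 0
  | _ + 1, [] => 1
  | k + 1, q :: l => q * surv k l + (1 - q) * surv (k + 1) l

/-- Acceptance probabilities are probabilities, and prices are nonnegative. -/
def IsOffer (o : ℝ × ℝ) : Prop := 0 ≤ o.1 ∧ o.1 ≤ 1 ∧ 0 ≤ o.2

/-- The expected number of accepted offers, ignoring the supply. -/
def mass (l : List (ℝ × ℝ)) : ℝ := (l.map Prod.fst).sum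

/-- The expected payment of a list of offers, ignoring the supply. -/
def worth (l : List (ℝ × ℝ)) : ℝ := (l.map fun o => o.1 * o.2).sum

@[simp] theorem rev_zero (l : List (ℝ × ℝ)) : rev 0 l = 0 := by cases l <;> rfl
@[simp] theorem rev_nil (k : ℕ) : rev k [] = 0 := by cases k <;> rfl
theorem rev_cons (k : ℕ) (o : ℝ × ℝ) (l : List (ℝ × ℝ)) :
    rev (k + 1) (o :: l) = o.1 * (o.2 + rev k l) + (1 - o.1) * rev (k + 1) l := rfl
@[simp] theorem surv_zero (l : List ℝ) : surv 0 l = 0 := by cases l <;> rfl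
@[simp] theorem surv_nil (k : ℕ) : surv (k + 1) [] = 1 := rfl
theorem surv_cons (k : ℕ) (q : ℝ) (l : List ℝ) :
    surv (k + 1) (q :: l) = q * surv k l + (1 - q) * surv (k + 1) l := rfl
@[simp] theorem mass_nil : mass [] = 0 := rfl
@[simp] theorem mass_cons (o : ℝ × ℝ) (l : List (ℝ × ℝ)) : mass (o :: l) = o.1 + mass l := by
  simp [mass]
@[simp] theorem worth_nil : worth [] = 0 := rfl
@[simp] theorem worth_cons (o : ℝ × ℝ) (l : List (ℝ × ℝ)) :
    worth (o :: l) = o.1 * o.2 + worth l := by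
  simp [worth]

theorem mass_nonneg {l : List (ℝ × ℝ)} (hl : ∀ o ∈ l, IsOffer o) : 0 ≤ mass l := by
  refine List.sum_nonneg fun x hx => ?_
  obtain ⟨o, ho, rfl⟩ := List.mem_map.1 hx
  exact (hl o ho).1

theorem worth_nonneg {l : List (ℝ × ℝ)} (hl : ∀ o ∈ l, IsOffer o) : 0 ≤ worth l := by
  refine List.sum_nonneg fun x hx => ?_
  obtain ⟨o, ho, rfl⟩ := List.mem_map.1 hx
  exact mul_nonneg (hl o ho).1 (hl o ho).2.2

theorem rev_nonneg {l : List (ℝ × ℝ)} (hl : ∀ o ∈ l, IsOffer o) (k : ℕ) : 0 ≤ rev k l := by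
  induction l generalizing k with
  | nil => simp
  | cons o l ih =>
    cases k with
    | zero => simp
    | succ k =>
      rw [List.forall_mem_cons] at hl
      obtain ⟨h0, h1, h2⟩ := hl.1
      rw [rev_cons]
      have := ih hl.2 k
      have := ih hl.2 (k + 1)
      have : 0 ≤ 1 - o.1 := by linarith
      positivity

theorem rev_le_succ {l : List (ℝ × ℝ)} (hl : ∀ o ∈ l, IsOffer o) (k : ℕ) :
    rev k l ≤ rev (k + 1) l := by
  induction l generalizing k with
  | nil => simp
  | cons o l ih =>
    have h := hl
    rw [List.forall_mem_cons] at hl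
    obtain ⟨h0, h1, h2⟩ := hl.1
    cases k with
    | zero => simpa using rev_nonneg h 1
    | succ k =>
      rw [rev_cons, rev_cons]
      have h3 : 0 ≤ 1 - o.1 := by linarith
      have := ih hl.2 k
      have := ih hl.2 (k + 1)
      gcongr

theorem surv_mem_Icc {l : List ℝ} (hl : ∀ q ∈ l, 0 ≤ q ∧ q ≤ 1) (k : ℕ) :
    0 ≤ surv k l ∧ surv k l ≤ 1 := by
  induction l generalizing k with
  | nil => cases k <;> simp [surv]
  | cons q l ih =>
    rw [List.forall_mem_cons] at hl
    cases k with
    | zero => simp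
    | succ k =>
      rw [surv_cons]
      obtain ⟨a0, a1⟩ := ih hl.2 k
      obtain ⟨b0, b1⟩ := ih hl.2 (k + 1)
      have h1 : 0 ≤ 1 - q := by linarith [hl.1.2]
      have h2 := hl.1.1
      constructor
      · positivity
      · nlinarith

/-- A Chernoff bound, from the exponential moment of the number of accepted offers at base
`1 / 2`. -/
theorem surv_le_exp {l : List ℝ} (hl : ∀ q ∈ l, 0 ≤ q ∧ q ≤ 1) (k : ℕ) :
    surv k l ≤ 2 ^ k * Real.exp (-l.sum / 2) := by
  induction l generalizing k with
  | nil =>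
    cases k with
    | zero => simp
    | succ k => simpa using one_le_pow₀ (by norm_num : (1 : ℝ) ≤ 2)
  | cons q l ih =>
    rw [List.forall_mem_cons] at hl
    obtain ⟨h0, h1⟩ := hl.1
    cases k with
    | zero => simp [Real.exp_nonneg]
    | succ k =>
      have ha := ih hl.2 k
      have hb := ih hl.2 (k + 1)
      have h3 : 0 ≤ 1 - q := by linarith
      have he : 1 - q / 2 ≤ Real.exp (-q / 2) := by linarith [Real.add_one_le_exp (-q / 2)]
      calc surv (k + 1) (q :: l)
          ≤ q * (2 ^ k * Real.exp (-l.sum / 2)) +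
            (1 - q) * (2 ^ (k + 1) * Real.exp (-l.sum / 2)) := by
            rw [surv_cons]
            gcongr
        _ = 2 ^ (k + 1) * ((1 - q / 2) * Real.exp (-l.sum / 2)) := by ring
        _ ≤ 2 ^ (k + 1) * (Real.exp (-q / 2) * Real.exp (-l.sum / 2)) := by gcongr
        _ = 2 ^ (k + 1) * Real.exp (-(q :: l).sum / 2) := by
            rw [← Real.exp_add]
            congr 2
            simp
            ring

/-! ### Sorting and truncating a list of offers -/

theorem rev_cons_mono {l l' : List (ℝ × ℝ)} {o : ℝ × ℝ} (ho : IsOffer o)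
    (h : ∀ k, rev k l ≤ rev k l') (k : ℕ) : rev k (o :: l) ≤ rev k (o :: l') := by
  cases k with
  | zero => simp
  | succ k =>
    rw [rev_cons, rev_cons]
    have h3 : 0 ≤ 1 - o.1 := by linarith [ho.2.1]
    have h0 := ho.1
    have := h k
    have := h (k + 1)
    gcongr

/-- It is better to make the more expensive one of two neighbouring offers first. -/
theorem rev_swap_le {o o' : ℝ × ℝ} (ho : IsOffer o) (ho' : IsOffer o') (h : o.2 ≤ o'.2)
    (l : List (ℝ × ℝ)) (k : ℕ) : rev k (o :: o' :: l) ≤ rev k (o' :: o :: l) := by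
  match k with
  | 0 => simp
  | 1 =>
    simp only [rev_cons, rev_zero]
    have := mul_nonneg (mul_nonneg ho.1 ho'.1) (sub_nonneg.2 h)
    nlinarith
  | k + 2 =>
    simp only [rev_cons]
    apply le_of_eq
    ring

/-- The relation that sorts offers by decreasing price. -/
def PriceGE (o o' : ℝ × ℝ) : Prop := o'.2 ≤ o.2

noncomputable instance : DecidableRel PriceGE := fun _ _ => Classical.dec _

theorem rev_cons_le_orderedInsert {o : ℝ × ℝ} {l : List (ℝ × ℝ)} (ho : IsOffer o)
    (hl : ∀ o ∈ l, IsOffer o) (k : ℕ) :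
    rev k (o :: l) ≤ rev k (l.orderedInsert PriceGE o) := by
  induction l generalizing k with
  | nil => simp
  | cons o' l ih =>
    rw [List.forall_mem_cons] at hl
    by_cases h : PriceGE o o'
    · rw [List.orderedInsert_cons_of_le _ _ h]
    · rw [List.orderedInsert_of_not_le _ _ h]
      exact (rev_swap_le ho hl.1 (le_of_not_ge h) l k).trans
        (rev_cons_mono hl.1 (ih hl.2) k)

theorem rev_le_insertionSort {l : List (ℝ × ℝ)} (hl : ∀ o ∈ l, IsOffer o) (k : ℕ) :
    rev k l ≤ rev k (l.insertionSort PriceGE) := by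
  induction l generalizing k with
  | nil => simp
  | cons o l ih =>
    rw [List.forall_mem_cons] at hl
    rw [List.insertionSort_cons]
    exact (rev_cons_mono hl.1 (ih hl.2) k).trans (rev_cons_le_orderedInsert hl.1
      (fun o ho => hl.2 o ((List.perm_insertionSort _ _).mem_iff.1 ho)) k)

theorem rev_le_mul {l : List (ℝ × ℝ)} {x : ℝ} (hx : 0 ≤ x) (hl : ∀ o ∈ l, IsOffer o ∧ o.2 ≤ x)
    (k : ℕ) : rev k l ≤ k * x := by
  induction l generalizing k with
  | nil => simpa using by positivity
  | cons o l ih =>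
    rw [List.forall_mem_cons] at hl
    cases k with
    | zero => simp
    | succ k =>
      obtain ⟨⟨h0, h1, h2⟩, h3⟩ := hl.1
      have ha := ih hl.2 k
      have hb := ih hl.2 (k + 1)
      have h4 : 0 ≤ 1 - o.1 := by linarith
      rw [rev_cons]
      calc o.1 * (o.2 + rev k l) + (1 - o.1) * rev (k + 1) l
          ≤ o.1 * (x + k * x) + (1 - o.1) * ((k + 1 : ℕ) * x) := by gcongr
        _ = (k + 1 : ℕ) * x := by push_cast; ring

/-- Cheap offers after the list `l` pay at most `K * x`, and only if copies are left after `l`. -/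
theorem rev_append_le {l l' : List (ℝ × ℝ)} {x : ℝ} (hx : 0 ≤ x) (hl : ∀ o ∈ l, IsOffer o)
    (hl' : ∀ o ∈ l', IsOffer o ∧ o.2 ≤ x) {k K : ℕ} (hk : k ≤ K) :
    rev k (l ++ l') ≤ rev k l + K * x * surv k (l.map Prod.fst) := by
  induction l generalizing k with
  | nil =>
    cases k with
    | zero => simp
    | succ k =>
      have h1 := rev_le_mul hx hl' (k + 1)
      have h2 : ((k + 1 : ℕ) : ℝ) * x ≤ K * x := by gcongr
      simpa using h1.trans h2
  | cons o l ih =>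
    cases k with
    | zero => simp
    | succ k =>
      rw [List.forall_mem_cons] at hl
      obtain ⟨h0, h1, h2⟩ := hl.1
      have h4 : 0 ≤ 1 - o.1 := by linarith
      have ha := mul_le_mul_of_nonneg_left (ih hl.2 (k := k) (by omega)) h0
      have hb := mul_le_mul_of_nonneg_left (ih hl.2 hk) h4
      rw [List.cons_append, List.map_cons, rev_cons, rev_cons, surv_cons]
      linarith

/-- If all copies are sold by a list of expensive offers, the payment is at least `k * x`. -/
theorem le_rev {l : List (ℝ × ℝ)} {x : ℝ} (hx : 0 ≤ x) (hl : ∀ o ∈ l, IsOffer o ∧ x ≤ o.2)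
    (k : ℕ) : k * x * (1 - surv k (l.map Prod.fst)) ≤ rev k l := by
  induction l generalizing k with
  | nil => cases k <;> simp
  | cons o l ih =>
    rw [List.forall_mem_cons] at hl
    cases k with
    | zero => simp
    | succ k =>
      obtain ⟨⟨h0, h1, h2⟩, h3⟩ := hl.1
      have h4 : 0 ≤ 1 - o.1 := by linarith
      have ha := mul_le_mul_of_nonneg_left (ih hl.2 k) h0
      have hb := mul_le_mul_of_nonneg_left (ih hl.2 (k + 1)) h4
      have hs : 0 ≤ surv k (l.map Prod.fst) := (surv_mem_Icc (by
        intro q hq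
        obtain ⟨o, ho, rfl⟩ := List.mem_map.1 hq
        exact ⟨(hl.2 o ho).1.1, (hl.2 o ho).1.2.1⟩) k).1
      have hc := mul_le_mul_of_nonneg_left h3 h0
      have hd := mul_nonneg (mul_nonneg h0 hx) hs
      rw [List.map_cons, rev_cons, surv_cons]
      push_cast at hb ⊢
      linarith

/-- If all offers after the list `l` are cheaper than those in `l`, they contribute at most the
fraction of the revenue that is the probability that copies are left after `l`. -/
theorem rev_append_mul_le {l l' : List (ℝ × ℝ)} {x : ℝ} (hx : 0 ≤ x)
    (hl : ∀ o ∈ l, IsOffer o ∧ x ≤ o.2) (hl' : ∀ o ∈ l', IsOffer o ∧ o.2 ≤ x) (K : ℕ) :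
    (1 - surv K (l.map Prod.fst)) * rev K (l ++ l') ≤ rev K l := by
  have h1 := rev_append_le hx (fun o ho => (hl o ho).1) hl' (le_refl K)
  have h2 := le_rev hx hl K
  obtain ⟨hs0, hs1⟩ := surv_mem_Icc (l := l.map Prod.fst) (by
        intro q hq
        obtain ⟨o, ho, rfl⟩ := List.mem_map.1 hq
        exact ⟨(hl o ho).1.1, (hl o ho).1.2.1⟩) K
  set p := surv K (l.map Prod.fst)
  have h3 := mul_le_mul_of_nonneg_left h1 (sub_nonneg.2 hs1)
  have h4 := mul_le_mul_of_nonneg_left h2 hs0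
  nlinarith

/-- A prefix of total acceptance probability between `T` and `T + 1`, or the whole list. -/
theorem exists_append_mass {l : List (ℝ × ℝ)} (hl : ∀ o ∈ l, IsOffer o) {T : ℝ} (hT : 0 ≤ T) :
    ∃ l₁ l₂, l = l₁ ++ l₂ ∧ mass l₁ ≤ T + 1 ∧ (l₂ = [] ∨ T ≤ mass l₁) := by
  induction l generalizing T with
  | nil => exact ⟨[], [], rfl, by simp; linarith, Or.inl rfl⟩
  | cons o l ih =>
    rw [List.forall_mem_cons] at hl
    obtain ⟨h0, h1, h2⟩ := hl.1
    by_cases h : o.1 ≤ T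
    · obtain ⟨l₁, l₂, e, hm, h'⟩ := ih hl.2 (T := T - o.1) (by linarith)
      refine ⟨o :: l₁, l₂, by simp [e], by simp; linarith, h'.imp_right fun h' => ?_⟩
      simp
      linarith
    · exact ⟨[o], l, rfl, by simp; linarith, Or.inr (by simp; linarith)⟩

/-! ### Merging segments of offers -/

/-- The lists of offers that may be treated as one offer: a single offer, or several offers that
are accepted with small total probability. -/
def IsSegment (δ : ℝ) (l : List (ℝ × ℝ)) : Prop := l.length ≤ 1 ∨ mass l ≤ δ

/-- The expected revenue when every segment is replaced by a single offer, which is accepted with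
the total probability of the segment, and has the same expected payment as the segment. -/
noncomputable def merged : ℕ → List (List (ℝ × ℝ)) → ℝ
  | 0, _ => 0
  | _ + 1, [] => 0
  | k + 1, g :: l => worth g + mass g * merged k l + (1 - mass g) * merged (k + 1) l

@[simp] theorem merged_zero (l : List (List (ℝ × ℝ))) : merged 0 l = 0 := by cases l <;> rfl
@[simp] theorem merged_nil (k : ℕ) : merged k [] = 0 := by cases k <;> rfl
theorem merged_cons (k : ℕ) (g : List (ℝ × ℝ)) (l : List (List (ℝ × ℝ))) :
    merged (k + 1) (g :: l) = worth g + mass g * merged k l + (1 - mass g) * merged (k + 1) l :=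
  rfl

theorem IsSegment.mass_le_one {δ : ℝ} (hδ : δ ≤ 1) {g : List (ℝ × ℝ)} (h : IsSegment δ g)
    (hg : ∀ o ∈ g, IsOffer o) : mass g ≤ 1 := by
  rcases h with h | h
  · match g, h with
    | [], _ => simp
    | [o], _ => simpa using (hg o (by simp)).2.1
  · linarith

theorem rev_append_le_add {g l : List (ℝ × ℝ)} (hg : ∀ o ∈ g, IsOffer o)
    (hl : ∀ o ∈ l, IsOffer o) (k : ℕ) : rev k (g ++ l) ≤ worth g + rev k l := by
  induction g generalizing k with
  | nil => simp
  | cons o g ih =>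
    cases k with
    | zero => simpa using worth_nonneg hg
    | succ k =>
      rw [List.forall_mem_cons] at hg
      obtain ⟨h0, h1, h2⟩ := hg.1
      have h4 : 0 ≤ 1 - o.1 := by linarith
      have ha := mul_le_mul_of_nonneg_left (ih hg.2 k) h0
      have hb := mul_le_mul_of_nonneg_left (ih hg.2 (k + 1)) h4
      have hc := mul_le_mul_of_nonneg_left (rev_le_succ hl k) h0
      rw [List.cons_append, rev_cons, worth_cons]
      linarith

/-- The probability that no offer of a segment of total probability `μ` is accepted is at most
`1 - μ + μ ^ 2`. -/
theorem rev_append_le_merge {g l : List (ℝ × ℝ)} (hg : ∀ o ∈ g, IsOffer o)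
    (hl : ∀ o ∈ l, IsOffer o) (k : ℕ) :
    rev (k + 1) (g ++ l) ≤ worth g + (1 - mass g + mass g ^ 2) * rev (k + 1) l +
      (mass g - mass g ^ 2) * rev k l := by
  induction g with
  | nil => simp
  | cons o g ih =>
    rw [List.forall_mem_cons] at hg
    obtain ⟨h0, h1, h2⟩ := hg.1
    have h4 : 0 ≤ 1 - o.1 := by linarith
    have hm := mass_nonneg hg.2
    have ha := mul_le_mul_of_nonneg_left (rev_append_le_add hg.2 hl k) h0
    have hb := mul_le_mul_of_nonneg_left (ih hg.2) h4
    have hw : 0 ≤ worth g := worth_nonneg hg.2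
    have hc := sub_nonneg.2 (rev_le_succ hl k)
    have hd : 0 ≤ (o.1 * mass g + o.1 ^ 2 + o.1 * mass g ^ 2) *
        (rev (k + 1) l - rev k l) := mul_nonneg (by positivity) hc
    rw [List.cons_append, rev_cons, worth_cons, mass_cons]
    nlinarith

theorem le_rev_append {g l : List (ℝ × ℝ)} (hg : ∀ o ∈ g, IsOffer o)
    (hl : ∀ o ∈ l, IsOffer o) (k : ℕ) (h : mass g ≤ 1) :
    (1 - mass g) * rev k l ≤ rev k (g ++ l) := by
  induction g generalizing k with
  | nil => simp
  | cons o g ih =>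
    cases k with
    | zero => simp
    | succ k =>
      rw [List.forall_mem_cons] at hg
      obtain ⟨h0, h1, h2⟩ := hg.1
      rw [mass_cons] at h ⊢
      have h4 : 0 ≤ 1 - o.1 := by linarith
      have hm := mass_nonneg hg.2
      have hb := mul_le_mul_of_nonneg_left (ih hg.2 (k + 1) (by linarith)) h4
      have ha : 0 ≤ rev k (g ++ l) := rev_nonneg (by
        intro o ho
        rcases List.mem_append.1 ho with ho | ho
        exacts [hg.2 o ho, hl o ho]) k
      have hr := rev_nonneg hl (k + 1)
      rw [List.cons_append, rev_cons]
      have : 0 ≤ o.1 * (o.2 + rev k (g ++ l)) := by positivity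
      have : 0 ≤ o.1 * mass g * rev (k + 1) l := by positivity
      linarith

/-- The counterpart of `rev_append_le_merge`: the probability that exactly one offer of a segment
of total probability `μ` is accepted is at least `μ - μ ^ 2`. -/
theorem merge_le_rev_append {g l : List (ℝ × ℝ)} (hg : ∀ o ∈ g, IsOffer o)
    (hl : ∀ o ∈ l, IsOffer o) (k : ℕ) (h : mass g ≤ 1) :
    (1 - mass g) * worth g + (1 - mass g) * rev (k + 1) l + (mass g - mass g ^ 2) * rev k l ≤
      rev (k + 1) (g ++ l) := by
  induction g with
  | nil => simp
  | cons o g ih =>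
    rw [List.forall_mem_cons] at hg
    obtain ⟨h0, h1, h2⟩ := hg.1
    rw [mass_cons] at h
    have h4 : 0 ≤ 1 - o.1 := by linarith
    have hm := mass_nonneg hg.2
    have hw : 0 ≤ worth g := worth_nonneg hg.2
    have ha := mul_le_mul_of_nonneg_left (le_rev_append hg.2 hl k (by linarith)) h0
    have hb := mul_le_mul_of_nonneg_left (ih hg.2 (by linarith)) h4
    have hr := rev_nonneg hl k
    have hr' := rev_nonneg hl (k + 1)
    have e1 : 0 ≤ o.1 * mass g * worth g := by positivity
    have e2 : 0 ≤ o.1 * mass g * rev (k + 1) l := by positivity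
    have e3 : 0 ≤ (o.1 ^ 2 + o.1 * mass g ^ 2) * rev k l := by positivity
    have e4 : 0 ≤ (o.1 + mass g) * (o.1 * o.2) := by positivity
    rw [List.cons_append, rev_cons, worth_cons, mass_cons]
    nlinarith

theorem merged_nonneg_and_le_succ {δ : ℝ} (hδ : δ ≤ 1) {l : List (List (ℝ × ℝ))}
    (hl : ∀ g ∈ l, IsSegment δ g ∧ ∀ o ∈ g, IsOffer o) (k : ℕ) :
    0 ≤ merged k l ∧ merged k l ≤ merged (k + 1) l := by
  induction l generalizing k with
  | nil => simp
  | cons g l ih =>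
    rw [List.forall_mem_cons] at hl
    have h0 := mass_nonneg hl.1.2
    have h1 := hl.1.1.mass_le_one hδ hl.1.2
    have h2 := worth_nonneg hl.1.2
    have h4 : 0 ≤ 1 - mass g := by linarith
    have key : ∀ k, 0 ≤ merged (k + 1) (g :: l) := fun k => by
      have a := (ih hl.2 k).1
      have b := (ih hl.2 (k + 1)).1
      rw [merged_cons]
      positivity
    cases k with
    | zero => simpa using key 0
    | succ k =>
      refine ⟨key k, ?_⟩
      rw [merged_cons, merged_cons]
      have a := (ih hl.2 k).2
      have b := (ih hl.2 (k + 1)).2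
      gcongr

theorem rev_singleton_append (o : ℝ × ℝ) (l : List (ℝ × ℝ)) (k : ℕ) :
    rev (k + 1) ([o] ++ l) =
      worth [o] + mass [o] * rev k l + (1 - mass [o]) * rev (k + 1) l := by
  simp [rev_cons]
  ring

theorem isOffer_flatten {l : List (List (ℝ × ℝ))} (hl : ∀ g ∈ l, ∀ o ∈ g, IsOffer o) :
    ∀ o ∈ l.flatten, IsOffer o := by
  intro o ho
  obtain ⟨g, hg, h⟩ := List.mem_flatten.1 ho
  exact hl g hg o h

/-- Merging the segments of a list of offers does not lose much. -/
theorem rev_flatten_le_merged {δ : ℝ} (hδ : δ ≤ 1 / 2) {l : List (List (ℝ × ℝ))}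
    (hl : ∀ g ∈ l, IsSegment δ g ∧ ∀ o ∈ g, IsOffer o) (k : ℕ) :
    rev k l.flatten ≤ (1 + 2 * δ ^ 2) ^ l.length * merged k l := by
  induction l generalizing k with
  | nil => simp
  | cons g l ih =>
    cases k with
    | zero => simp
    | succ k =>
      rw [List.forall_mem_cons] at hl
      have hf := isOffer_flatten fun g hg => (hl.2 g hg).2
      have h0 := mass_nonneg hl.1.2
      have h1 := hl.1.1.mass_le_one (by linarith) hl.1.2
      have h2 := worth_nonneg hl.1.2
      have h4 : 0 ≤ 1 - mass g := by linarith
      have r0 := rev_nonneg hf k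
      have r1 := rev_le_succ hf k
      have step : rev (k + 1) (g ++ l.flatten) ≤ worth g +
          (1 + 2 * δ ^ 2) * (mass g * rev k l.flatten + (1 - mass g) * rev (k + 1) l.flatten) := by
        rcases hl.1.1 with h | h
        · match g, h with
          | [], _ =>
            have : 0 ≤ 2 * δ ^ 2 * rev (k + 1) l.flatten :=
              mul_nonneg (by positivity) (r0.trans r1)
            simp
            linarith
          | [o], _ =>
            rw [rev_singleton_append]
            have : 0 ≤ 2 * δ ^ 2 * (mass [o] * rev k l.flatten +
                (1 - mass [o]) * rev (k + 1) l.flatten) :=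
              mul_nonneg (by positivity) (add_nonneg (mul_nonneg h0 r0)
                (mul_nonneg h4 (r0.trans r1)))
            linarith
        · have hm := rev_append_le_merge hl.1.2 hf k
          have e1 : mass g ^ 2 ≤ δ ^ 2 := pow_le_pow_left₀ h0 h 2
          have e2 : 1 / 2 ≤ 1 - mass g := by linarith
          have e3 : 0 ≤ rev (k + 1) l.flatten := r0.trans r1
          have e4 : mass g ^ 2 * rev (k + 1) l.flatten ≤ δ ^ 2 * rev (k + 1) l.flatten := by
            gcongr
          have e5 : δ ^ 2 * rev (k + 1) l.flatten ≤
              2 * δ ^ 2 * ((1 - mass g) * rev (k + 1) l.flatten) := by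
            nlinarith [mul_nonneg (sq_nonneg δ) e3]
          have e6 : 0 ≤ 2 * δ ^ 2 * (mass g * rev k l.flatten) := by positivity
          have e7 : 0 ≤ mass g ^ 2 * rev k l.flatten := by positivity
          linarith
      have hp : 1 ≤ (1 + 2 * δ ^ 2) ^ (l.length + 1) :=
        one_le_pow₀ (by linarith [sq_nonneg δ])
      have ha := ih hl.2 k
      have hb := ih hl.2 (k + 1)
      rw [List.flatten_cons, List.length_cons, merged_cons]
      calc rev (k + 1) (g ++ l.flatten) ≤ 1 * worth g + (1 + 2 * δ ^ 2) *
            (mass g * ((1 + 2 * δ ^ 2) ^ l.length * merged k l) +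
              (1 - mass g) * ((1 + 2 * δ ^ 2) ^ l.length * merged (k + 1) l)) := by
            refine step.trans ?_
            rw [one_mul]
            gcongr
        _ ≤ (1 + 2 * δ ^ 2) ^ (l.length + 1) * worth g + (1 + 2 * δ ^ 2) *
            (mass g * ((1 + 2 * δ ^ 2) ^ l.length * merged k l) +
              (1 - mass g) * ((1 + 2 * δ ^ 2) ^ l.length * merged (k + 1) l)) := by gcongr
        _ = _ := by ring

/-- Merging the segments of a list of offers does not gain much. -/
theorem merged_le_rev_flatten {δ : ℝ} (hδ0 : 0 ≤ δ) (hδ : δ ≤ 1 / 2) {l : List (List (ℝ × ℝ))}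
    (hl : ∀ g ∈ l, IsSegment δ g ∧ ∀ o ∈ g, IsOffer o) (k : ℕ) :
    (1 - δ) * (1 - 2 * δ ^ 2) ^ l.length * merged k l ≤ rev k l.flatten := by
  induction l generalizing k with
  | nil => simp
  | cons g l ih =>
    cases k with
    | zero => simp
    | succ k =>
      rw [List.forall_mem_cons] at hl
      have hf := isOffer_flatten fun g hg => (hl.2 g hg).2
      have h0 := mass_nonneg hl.1.2
      have h1 := hl.1.1.mass_le_one (by linarith) hl.1.2
      have h2 := worth_nonneg hl.1.2
      have h4 : 0 ≤ 1 - mass g := by linarith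
      have r0 := rev_nonneg hf k
      have r1 := rev_le_succ hf k
      have e3 : 0 ≤ rev (k + 1) l.flatten := r0.trans r1
      have hq0 : 0 ≤ 1 - 2 * δ ^ 2 := by nlinarith
      have hq1 : 1 - 2 * δ ^ 2 ≤ 1 := by linarith [sq_nonneg δ]
      have step : (1 - δ) * worth g + (1 - 2 * δ ^ 2) *
          (mass g * rev k l.flatten + (1 - mass g) * rev (k + 1) l.flatten) ≤
          rev (k + 1) (g ++ l.flatten) := by
        have hδw : 0 ≤ δ * worth g := by positivity
        rcases hl.1.1 with h | h
        · match g, h with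
          | [], _ =>
            have : 0 ≤ 2 * δ ^ 2 * rev (k + 1) l.flatten := by positivity
            simp
            linarith
          | [o], _ =>
            rw [rev_singleton_append]
            have : 0 ≤ 2 * δ ^ 2 * (mass [o] * rev k l.flatten +
                (1 - mass [o]) * rev (k + 1) l.flatten) := by positivity
            linarith
        · have hm := merge_le_rev_append hl.1.2 hf k h1
          have e1 : mass g ^ 2 * rev k l.flatten ≤ δ ^ 2 * rev (k + 1) l.flatten := by gcongr
          have e2 : 1 / 2 ≤ 1 - mass g := by linarith
          have e5 : δ ^ 2 * rev (k + 1) l.flatten ≤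
              2 * δ ^ 2 * ((1 - mass g) * rev (k + 1) l.flatten) := by
            nlinarith [mul_nonneg (sq_nonneg δ) e3]
          have e6 : 0 ≤ 2 * δ ^ 2 * (mass g * rev k l.flatten) := by positivity
          have e8 : mass g * worth g ≤ δ * worth g := by gcongr
          linarith
      have hp : (1 - 2 * δ ^ 2) ^ (l.length + 1) ≤ 1 := pow_le_one₀ hq0 hq1
      have ha := ih hl.2 k
      have hb := ih hl.2 (k + 1)
      have hδ1 : 0 ≤ 1 - δ := by linarith
      rw [List.flatten_cons, List.length_cons, merged_cons]
      calc _ = (1 - δ) * ((1 - 2 * δ ^ 2) ^ (l.length + 1) * worth g) + (1 - 2 * δ ^ 2) *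
            (mass g * ((1 - δ) * (1 - 2 * δ ^ 2) ^ l.length * merged k l) +
              (1 - mass g) * ((1 - δ) * (1 - 2 * δ ^ 2) ^ l.length * merged (k + 1) l)) := by ring
        _ ≤ (1 - δ) * (1 * worth g) + (1 - 2 * δ ^ 2) *
            (mass g * rev k l.flatten + (1 - mass g) * rev (k + 1) l.flatten) := by gcongr
        _ ≤ _ := by rw [one_mul]; exact step

theorem merged_append_nil (k : ℕ) (l : List (List (ℝ × ℝ))) (r : ℕ) :
    merged k (l ++ List.replicate r []) = merged k l := by
  have h : ∀ (r k : ℕ), merged k (List.replicate r []) = 0 := by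
    intro r
    induction r with
    | zero => simp
    | succ r ih =>
      intro k
      cases k with
      | zero => simp
      | succ k => simp [List.replicate_succ, merged_cons, ih]
  induction l generalizing k with
  | nil => simpa using h r k
  | cons g l ih =>
    cases k with
    | zero => simp
    | succ k => rw [List.cons_append, merged_cons, merged_cons, ih, ih]

/-- A greedy partition into few segments: two neighbouring segments have total mass
above `δ`. -/
theorem exists_segments {δ : ℝ} (hδ : 0 ≤ δ) {l : List (ℝ × ℝ)} (hl : ∀ o ∈ l, IsOffer o) :
    ∃ L : List (List (ℝ × ℝ)), L.flatten = l ∧ (∀ g ∈ L, IsSegment δ g) ∧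
      L.length * δ ≤ 2 * mass l - mass (L.headD []) + δ := by
  induction l with
  | nil => exact ⟨[], rfl, by simp, by simpa using hδ⟩
  | cons o l ih =>
    rw [List.forall_mem_cons] at hl
    obtain ⟨L, rfl, hs, hc⟩ := ih hl.2
    have h0 := hl.1.1
    have hnew : δ ≤ o.1 + mass (L.headD []) →
        ([o] :: L).length * δ ≤ 2 * mass (o :: L.flatten) - mass [o] + δ := by
      intro h
      simp only [List.length_cons, Nat.cast_add, Nat.cast_one, mass_cons, mass_nil]
      linarith
    match L, hs, hc, hnew with
    | [], hs, hc, hnew =>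
      by_cases h : δ ≤ o.1
      · exact ⟨[[o]], by simp, by simp [IsSegment], hnew (by simpa using h)⟩
      · refine ⟨[[o]], by simp, by simp [IsSegment], ?_⟩
        simp
        linarith
    | g :: L, hs, hc, hnew =>
      rw [List.forall_mem_cons] at hs
      by_cases h : o.1 + mass g ≤ δ
      · refine ⟨(o :: g) :: L, by simp, ?_, ?_⟩
        · rw [List.forall_mem_cons]
          exact ⟨Or.inr (by simpa using h), hs.2⟩
        · simp only [List.headD_cons, List.length_cons, mass_cons, List.flatten_cons] at hc ⊢
          linarith
      · refine ⟨[o] :: g :: L, by simp, ?_, hnew (by simp; linarith)⟩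
        rw [List.forall_mem_cons, List.forall_mem_cons]
        exact ⟨Or.inl (by simp), hs⟩

/-- The revenue of the merged segments, summed over the segments: segment `s` contributes its
worth times the probability that a copy is left when it is reached. -/
theorem merged_ofFn {L : ℕ} (g : Fin L → List (ℝ × ℝ)) (k : ℕ) :
    merged k (List.ofFn g) =
      ∑ s : Fin L, surv k ((List.ofFn fun s => mass (g s)).take s) * worth (g s) := by
  induction L generalizing k with
  | zero => simp
  | succ L ih =>
    cases k with
    | zero => simp
    | succ k =>
      rw [List.ofFn_succ, merged_cons, ih, ih, Fin.sum_univ_succ, Finset.mul_sum, Finset.mul_sum,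
        add_assoc, ← Finset.sum_add_distrib]
      congr 1
      · simp
      · refine Finset.sum_congr rfl fun s _ => ?_
        rw [List.ofFn_succ, Fin.val_succ, List.take_succ_cons, surv_cons]
        ring

/-- The recursion by which the survival probabilities of all prefixes can be computed from left to
right. -/
theorem surv_append_singleton (k : ℕ) (l : List ℝ) (q : ℝ) :
    surv (k + 1) (l ++ [q]) = (1 - q) * surv (k + 1) l + q * surv k l := by
  induction l generalizing k with
  | nil => cases k <;> simp [surv]
  | cons a l ih =>
    cases k with
    | zero => simp only [List.cons_append, surv_cons, ih, surv_zero]; ring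
    | succ k => simp only [List.cons_append, surv_cons, ih]; ring

end PostedPrice

/-! ### Expected revenue of a mechanism -/

namespace PostedPrice

variable {n : ℕ} (A : Auction n)

theorem successProb_mem_Icc (i : Fin n) (x : ℝ) :
    0 ≤ A.successProb i x ∧ A.successProb i x ≤ 1 := by
  constructor
  · refine Finset.sum_nonneg fun j _ => ?_
    split_ifs
    exacts [(A.prob_pos i j).le, le_rfl]
  · rw [← A.prob_sum i]
    refine Finset.sum_le_sum fun j _ => ?_
    split_ifs
    exacts [le_rfl, (A.prob_pos i j).le]

/-- Drawing the value of buyer `i` once more does not change expectations. -/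
theorem sum_resample (i : Fin n) (f : (∀ i, Fin (A.supp i)) → ℝ) :
    ∑ v : (∀ i, Fin (A.supp i)), (∏ i, A.prob i (v i)) * f v =
      ∑ v : (∀ i, Fin (A.supp i)), (∏ i, A.prob i (v i)) *
        ∑ y, A.prob i y * f (Function.update v i y) := by
  have h1 : ∀ v : (∀ i, Fin (A.supp i)), (∏ i, A.prob i (v i)) * f v =
      ∑ y, (∏ i, A.prob i (v i)) * A.prob i y * f v := fun v => by
    rw [← Finset.sum_mul, ← Finset.mul_sum, A.prob_sum, mul_one]
  simp_rw [h1, Finset.mul_sum]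
  rw [← Fintype.sum_prod_type', ← Fintype.sum_prod_type']
  -- Exchange the value of buyer `i` with the value drawn anew.
  refine Finset.sum_nbij' (fun p => (Function.update p.1 i p.2, p.1 i))
    (fun p => (Function.update p.1 i p.2, p.1 i)) (by simp) (by simp) ?_ ?_ ?_
  · rintro ⟨v, y⟩ -
    simp
  · rintro ⟨v, y⟩ -
    simp
  · rintro ⟨v, y⟩ -
    have h2 : ∀ w : (∀ i, Fin (A.supp i)), ∏ i, A.prob i (w i) =
        A.prob i (w i) * ∏ i' ∈ Finset.univ.erase i, A.prob i' (w i') := fun w =>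
      (Finset.mul_prod_erase _ _ (Finset.mem_univ i)).symm
    have h3 : ∏ i' ∈ Finset.univ.erase i, A.prob i' (Function.update v i y i') =
        ∏ i' ∈ Finset.univ.erase i, A.prob i' (v i') :=
      Finset.prod_congr rfl fun i' hi' => by
        rw [Function.update_of_ne (Finset.ne_of_mem_erase hi')]
    simp only [Function.update_idem, Function.update_eq_self]
    rw [h2 v, h2 (Function.update v i y), h3, Function.update_self]
    ring

/-- The revenue does not depend on the value of a buyer without an offer. -/
theorem realizedRevenue_update (v : ∀ i, Fin (A.supp i)) (i : Fin n) (y : Fin (A.supp i))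
    {l : List (Fin n × ℝ)} (hl : i ∉ l.map Prod.fst) (k : ℕ) :
    realizedRevenue (fun i' => A.val i' (Function.update v i y i')) k l =
      realizedRevenue (fun i' => A.val i' (v i')) k l := by
  induction l generalizing k with
  | nil => cases k <;> rfl
  | cons o l ih =>
    obtain ⟨i', x⟩ := o
    rw [List.map_cons, List.mem_cons, not_or] at hl
    cases k with
    | zero => rfl
    | succ k =>
      simp only [realizedRevenue, ih hl.2, Function.update_of_ne (Ne.symm hl.1)]

/-- The acceptance probability and the price of an offer. -/
noncomputable def offerOf (o : Fin n × ℝ) : ℝ × ℝ := (A.successProb o.1 o.2, o.2)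

theorem expectation_realizedRevenue {l : List (Fin n × ℝ)} (hl : (l.map Prod.fst).Nodup)
    (k : ℕ) :
    ∑ v : (∀ i, Fin (A.supp i)), (∏ i, A.prob i (v i)) *
      realizedRevenue (fun i => A.val i (v i)) k l = rev k (l.map (offerOf A)) := by
  induction l generalizing k with
  | nil => cases k <;> simp [realizedRevenue]
  | cons o l ih =>
    obtain ⟨i, x⟩ := o
    cases k with
    | zero => simp [realizedRevenue]
    | succ k =>
      rw [List.map_cons, List.nodup_cons] at hl
      have total : ∑ v : (∀ i, Fin (A.supp i)), ∏ i, A.prob i (v i) = 1 := by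
        rw [← Fintype.prod_sum]
        simp [A.prob_sum]
      have h1 : ∀ v : (∀ i, Fin (A.supp i)), ∑ y, A.prob i y * realizedRevenue
          (fun i' => A.val i' (Function.update v i y i')) (k + 1) ((i, x) :: l) =
          A.successProb i x * (x + realizedRevenue (fun i' => A.val i' (v i')) k l) +
          (1 - A.successProb i x) * realizedRevenue (fun i' => A.val i' (v i')) (k + 1) l := by
        intro v
        simp only [realizedRevenue, realizedRevenue_update A v i _ hl.1, Function.update_self]
        rw [← A.prob_sum i, Auction.successProb, ← Finset.sum_sub_distrib, Finset.sum_mul,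
          Finset.sum_mul, ← Finset.sum_add_distrib]
        refine Finset.sum_congr rfl fun y _ => ?_
        split_ifs <;> ring
      rw [sum_resample A i]
      simp_rw [h1, mul_add, ← mul_assoc, mul_comm _ (A.successProb i x),
        mul_comm _ (1 - A.successProb i x), mul_assoc]
      rw [Finset.sum_add_distrib, Finset.sum_add_distrib, ← Finset.mul_sum, ← Finset.mul_sum,
        ← Finset.mul_sum, ih hl.2, ih hl.2, ← Finset.sum_mul, total, List.map_cons, rev_cons,
        offerOf]
      ring

theorem expectedRevenue_eq_rev (K : ℕ) (σ : SPM n) :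
    A.expectedRevenue K σ = rev K (σ.offers.map (offerOf A)) :=
  expectation_realizedRevenue A σ.nodup K

/-! ### Plans: assignments of buyers to segments and prices -/

/-- A buyer together with a point of its support. -/
abbrev Point := Σ i : Fin n, Fin (A.supp i)

/-- The acceptance probability and the price of offering to the buyer this point of its support. -/
noncomputable def Point.offer {A : Auction n} (e : Point A) : ℝ × ℝ :=
  (A.successProb e.1 (A.val e.1 e.2), A.val e.1 e.2)

/-- An assignment of some of the buyers to `L` segments of the mechanism, together with the prices
that are offered to them. -/
abbrev Plan (L : ℕ) := ∀ i : Fin n, Option (Fin L × Fin (A.supp i))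

variable {A}

theorem Point.isOffer (e : Point A) : IsOffer e.offer :=
  ⟨(successProb_mem_Icc A _ _).1, (successProb_mem_Icc A _ _).2, A.val_nonneg _ _⟩

theorem isOffer_map_offer (l : List (Point A)) : ∀ o ∈ l.map Point.offer, IsOffer o := by
  intro o ho
  obtain ⟨e, -, rfl⟩ := List.mem_map.1 ho
  exact e.isOffer

namespace Plan

variable {L : ℕ} (a : Plan A L)

/-- The sum of `f` over the offers in segment `s`. -/
def segSum {M : Type} [AddCommMonoid M] (s : Fin L) (f : Point A → M) : M :=
  ∑ i, (a i).elim 0 fun o => if o.1 = s then f ⟨i, o.2⟩ else 0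

/-- The offers in segment `s`. -/
def seg (s : Fin L) : List (Point A) :=
  (List.finRange n).filterMap fun i =>
    (a i).bind fun o => if o.1 = s then some ⟨i, o.2⟩ else none

theorem sum_map_seg {M : Type} [AddCommMonoid M] (s : Fin L) (f : Point A → M) :
    ((a.seg s).map f).sum = a.segSum s f := by
  have h : ∀ l : List (Fin n), ((l.filterMap fun i =>
      (a i).bind fun o => if o.1 = s then some (⟨i, o.2⟩ : Point A) else none).map f).sum =
      (l.map fun i => (a i).elim 0 fun o => if o.1 = s then f ⟨i, o.2⟩ else 0).sum := by
    intro l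
    induction l with
    | nil => rfl
    | cons i l ih =>
      rw [List.map_cons, List.sum_cons, ← ih]
      cases hi : a i with
      | none => simp [hi]
      | some o =>
        by_cases ho : o.1 = s <;> simp [hi, ho]
  rw [seg, h, segSum, Fin.sum_univ_def]

/-- The acceptance probability of a support point in units of `1 / (10 * n ^ 2)`. -/
noncomputable def _root_.PostedPrice.Point.units (e : Point A) : ℕ :=
  ⌊A.successProb e.1 (A.val e.1 e.2) * (10 * (n : ℝ) ^ 2)⌋₊

/-- The total acceptance probability of segment `s` in units of `1 / (10 * n ^ 2)`. -/
noncomputable def massUnits (s : Fin L) : ℕ := a.segSum s Point.units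

/-- The number of offers in segment `s`. -/
def count (s : Fin L) : ℕ := a.segSum s fun _ => 1

/-- Every segment has at most one offer, or total acceptance probability at most `1 / D`. -/
def Valid (D : ℕ) : Prop := ∀ s, a.count s ≤ 1 ∨ a.massUnits s * D ≤ 10 * n ^ 2

/-- The revenue of the plan when its segments are merged. -/
noncomputable def approx (K : ℕ) : ℝ :=
  ∑ s : Fin L, surv K ((List.ofFn fun s => (a.massUnits s : ℝ) / (10 * (n : ℝ) ^ 2)).take s) *
    a.segSum s fun e => e.offer.1 * e.offer.2

/-- The offers of the plan, segment by segment. -/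
def points : List (Point A) := (List.ofFn a.seg).flatten

theorem mem_seg {s : Fin L} {e : Point A} : e ∈ a.seg s ↔ a e.1 = some (s, e.2) := by
  obtain ⟨i, j⟩ := e
  simp only [seg, List.mem_filterMap, List.mem_finRange, true_and, Option.bind_eq_some_iff]
  constructor
  · rintro ⟨i', ⟨s', j'⟩, h1, h2⟩
    split_ifs at h2 with h
    cases h
    simp only [Option.some.injEq] at h2
    cases h2
    exact h1
  · intro h
    exact ⟨i, _, h, by simp⟩

theorem nodup_points : (a.points.map Sigma.fst).Nodup := by
  rw [points, List.map_flatten, List.map_ofFn, List.nodup_flatten]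
  constructor
  · intro l hl
    obtain ⟨s, rfl⟩ := (List.mem_ofFn' _ _).1 hl
    have h : ((a.seg s).map Sigma.fst).Sublist (List.finRange n) := by
      rw [seg, List.map_filterMap]
      have : ∀ l : List (Fin n), (l.filterMap fun i => Option.map Sigma.fst
          ((a i).bind fun o => if o.1 = s then some (⟨i, o.2⟩ : Point A) else none)).Sublist l := by
        intro l
        induction l with
        | nil => simp
        | cons i l ih =>
          rw [List.filterMap_cons]
          split
          · exact ih.cons _
          · rename_i i' h
            have : i' = i := by
              cases hi : a i with
              | none => simp [hi] at h
              | some o =>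
                simp only [hi, Option.bind_some] at h
                split_ifs at h
                · simpa using h.symm
                · simp at h
            rw [this]
            exact ih.cons_cons _
      exact this _
    exact (List.nodup_finRange n).sublist h
  · rw [List.pairwise_ofFn]
    intro s s' hs i hi hi'
    simp only [Function.comp, List.mem_map] at hi hi'
    obtain ⟨⟨i, j⟩, h, rfl⟩ := hi
    obtain ⟨⟨i', j'⟩, h', rfl⟩ := hi'
    rw [mem_seg] at h h'
    rw [h] at h'
    simp only [Option.some.injEq, Prod.mk.injEq] at h'
    exact hs.ne h'.1

/-- The mechanism that makes the offers of the plan segment by segment. -/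
noncomputable def toSPM : SPM n where
  offers := a.points.map fun e => (e.1, A.val e.1 e.2)
  nodup := by
    rw [List.map_map]
    exact a.nodup_points
  price_nonneg := by
    intro o ho
    obtain ⟨e, -, rfl⟩ := List.mem_map.1 ho
    exact A.val_nonneg _ _

theorem expectedRevenue_toSPM (K : ℕ) :
    A.expectedRevenue K a.toSPM =
      rev K (List.ofFn fun s => (a.seg s).map Point.offer).flatten := by
  rw [expectedRevenue_eq_rev, toSPM, List.map_map, points, List.map_flatten, List.map_ofFn]
  rfl

/-- Any lists of offers to distinct buyers are the segments of a plan, up to order. -/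
theorem exists_segSum_eq (g : Fin L → List (Point A))
    (hg : ((List.ofFn g).flatten.map Sigma.fst).Nodup) :
    ∃ a : Plan A L, ∀ (M : Type) [AddCommMonoid M] (s : Fin L) (f : Point A → M),
      a.segSum s f = ((g s).map f).sum := by
  have key : ∀ l : List (Fin L × Point A), (l.map fun e => e.2.1).Nodup →
      ∃ a : Plan A L, (∀ i, i ∉ l.map (fun e => e.2.1) → a i = none) ∧
        ∀ (M : Type) [AddCommMonoid M] (s : Fin L) (f : Point A → M),
          a.segSum s f = (l.map fun e => if e.1 = s then f e.2 else 0).sum := by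
    intro l
    induction l with
    | nil => exact fun _ => ⟨fun _ => none, by simp, by simp [segSum]⟩
    | cons e l ih =>
      intro hl
      rw [List.map_cons, List.nodup_cons] at hl
      obtain ⟨a, h1, h2⟩ := ih hl.2
      obtain ⟨s', i', j'⟩ := e
      refine ⟨Function.update a i' (some (s', j')), ?_, ?_⟩
      · intro i hi
        rw [List.map_cons, List.mem_cons, not_or] at hi
        rw [Function.update_of_ne hi.1]
        exact h1 i hi.2
      · intro M _ s f
        rw [List.map_cons, List.sum_cons, ← h2, segSum, segSum,
          ← Finset.add_sum_erase _ _ (Finset.mem_univ i'),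
          ← Finset.add_sum_erase (a := i') _ (fun i => (a i).elim 0 _) (Finset.mem_univ i'),
          h1 i' hl.1]
        simp only [Function.update_self, Option.elim_some, Option.elim_none, zero_add]
        congr 1
        refine Finset.sum_congr rfl fun i hi => ?_
        rw [Function.update_of_ne (Finset.ne_of_mem_erase hi)]
  obtain ⟨a, -, ha⟩ := key ((List.finRange L).flatMap fun s => (g s).map fun e => (s, e)) (by
    rw [List.map_flatMap]
    simp only [List.map_map]
    rw [List.map_flatten, List.map_ofFn, List.ofFn_eq_map, ← List.flatMap_def] at hg
    exact hg)
  refine ⟨a, fun M _ s f => ?_⟩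
  rw [ha, List.map_flatMap]
  simp only [List.map_map]
  rw [List.flatMap_def, List.sum_flatten, List.map_map, ← Fin.sum_univ_def,
    Finset.sum_eq_single s]
  · simp [Function.comp_def]
  · intro s' _ hs'
    simp [Function.comp_def, hs']
  · simp

end Plan

theorem Point.units_eq (hA : A.OnGrid) (hn : 1 ≤ n) (e : Point A) :
    (e.units : ℝ) = e.offer.1 * (10 * (n : ℝ) ^ 2) := by
  obtain ⟨m, hm⟩ := hA e.1 (A.val e.1 e.2)
  have : (0 : ℝ) < 10 * (n : ℝ) ^ 2 := by positivity
  rw [Point.units, Point.offer, hm, div_mul_cancel₀ _ this.ne', Nat.floor_natCast]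

theorem Point.offer_eq_div (hA : A.OnGrid) (hn : 1 ≤ n) (e : Point A) :
    e.offer.1 = (e.units : ℝ) / (10 * (n : ℝ) ^ 2) := by
  rw [e.units_eq hA hn, mul_div_cancel_right₀]
  positivity

theorem mass_map_offer (hA : A.OnGrid) (hn : 1 ≤ n) (l : List (Point A)) :
    mass (l.map Point.offer) = ((l.map Point.units).sum : ℕ) / (10 * (n : ℝ) ^ 2) := by
  induction l with
  | nil => simp
  | cons e l ih =>
    rw [List.map_cons, mass_cons, ih, List.map_cons, List.sum_cons, Nat.cast_add, add_div,
      e.offer_eq_div hA hn]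

theorem worth_map_offer (l : List (Point A)) :
    worth (l.map Point.offer) = (l.map fun e => e.offer.1 * e.offer.2).sum := by
  rw [worth, List.map_map]
  rfl

/-- The merged revenue of a plan and of lists of offers that have the same sums. -/
theorem Plan.approx_eq_merged {L : ℕ} (hA : A.OnGrid) (hn : 1 ≤ n) {a : Plan A L}
    {g : Fin L → List (Point A)}
    (h : ∀ (M : Type) [AddCommMonoid M] (s : Fin L) (f : Point A → M),
      a.segSum s f = ((g s).map f).sum) (K : ℕ) :
    a.approx K = merged K (List.ofFn fun s => (g s).map Point.offer) := by
  rw [merged_ofFn, approx]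
  simp only [mass_map_offer hA hn, worth_map_offer, massUnits, h]

theorem isSegment_iff {l : List (Point A)} (hA : A.OnGrid) (hn : 1 ≤ n) {D : ℕ} (hD : 1 ≤ D) :
    IsSegment (1 / D) (l.map Point.offer) ↔
      (l.map fun _ => 1).sum ≤ 1 ∨ (l.map Point.units).sum * D ≤ 10 * n ^ 2 := by
  have h1 : (0 : ℝ) < 10 * (n : ℝ) ^ 2 := by positivity
  have h2 : (0 : ℝ) < D := by positivity
  rw [IsSegment, mass_map_offer hA hn, div_le_div_iff₀ h1 h2, one_mul, List.length_map]
  simp only [List.map_const', List.sum_replicate, smul_eq_mul, mul_one]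
  exact_mod_cast Iff.rfl

theorem Plan.valid_iff {L : ℕ} (hA : A.OnGrid) (hn : 1 ≤ n) {D : ℕ} (hD : 1 ≤ D) {a : Plan A L}
    {g : Fin L → List (Point A)}
    (h : ∀ (M : Type) [AddCommMonoid M] (s : Fin L) (f : Point A → M),
      a.segSum s f = ((g s).map f).sum) :
    a.Valid D ↔ ∀ s, IsSegment (1 / D) ((g s).map Point.offer) := by
  simp only [isSegment_iff hA hn hD, Valid, count, massUnits, h]

/-- Offers may be made at support points only: raising a price to the next support point does not
change the acceptance probability. -/
theorem exists_points_rev_le (l : List (Fin n × ℝ)) (hl : (l.map Prod.fst).Nodup)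
    (hx : ∀ o ∈ l, 0 ≤ o.2) :
    ∃ l' : List (Point A), (l'.map Sigma.fst).Nodup ∧
      (∀ e ∈ l', e.1 ∈ l.map Prod.fst) ∧
      ∀ k, rev k (l.map (offerOf A)) ≤ rev k (l'.map Point.offer) := by
  induction l with
  | nil => exact ⟨[], by simp⟩
  | cons o l ih =>
    obtain ⟨i, x⟩ := o
    rw [List.map_cons, List.nodup_cons] at hl
    rw [List.forall_mem_cons] at hx
    obtain ⟨l', h1, h2, h3⟩ := ih hl.2 hx.2
    have ho : IsOffer (offerOf A (i, x)) :=
      ⟨(successProb_mem_Icc A _ _).1, (successProb_mem_Icc A _ _).2, hx.1⟩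
    by_cases hne : (Finset.univ.filter fun j => x ≤ A.val i j).Nonempty
    · obtain ⟨j, hj, hmin⟩ := Finset.exists_min_image _ (A.val i) hne
      simp only [Finset.mem_filter, Finset.mem_univ, true_and] at hj hmin
      have hq : A.successProb i x = A.successProb i (A.val i j) := by
        refine Finset.sum_congr rfl fun j' _ => ?_
        have : x ≤ A.val i j' ↔ A.val i j ≤ A.val i j' := ⟨hmin j', hj.trans⟩
        simp only [this]
      refine ⟨⟨i, j⟩ :: l', ?_, ?_, fun k => ?_⟩
      · rw [List.map_cons, List.nodup_cons]
        refine ⟨fun h => ?_, h1⟩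
        obtain ⟨e, he, hei⟩ := List.mem_map.1 h
        exact hl.1 (by rw [← show e.1 = i from hei]; exact h2 e he)
      · rw [List.forall_mem_cons]
        exact ⟨by simp, fun e he => List.mem_cons_of_mem _ (h2 e he)⟩
      · rw [List.map_cons, List.map_cons]
        refine (rev_cons_mono ho h3 k).trans ?_
        cases k with
        | zero => simp
        | succ k =>
          have h0 := ho.1
          simp only [offerOf] at h0
          simp only [rev_cons, offerOf, Point.offer, ← hq]
          gcongr
    · refine ⟨l', h1, fun e he => List.mem_cons_of_mem _ (h2 e he), fun k => ?_⟩
      have hq : A.successProb i x = 0 := by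
        refine Finset.sum_eq_zero fun j _ => if_neg fun hj => hne ⟨j, by simpa using hj⟩
      refine le_trans (le_of_eq ?_) (h3 k)
      cases k with
      | zero => simp
      | succ k => simp [rev_cons, offerOf, hq]

/-- A partition of the image of a list into segments comes from a partition of the list. -/
theorem exists_flatten_eq_of_map {α β : Type} (f : α → β) {l : List α} {L : List (List β)}
    (h : l.map f = L.flatten) :
    ∃ L' : List (List α), L'.flatten = l ∧ L'.map (List.map f) = L := by
  induction L generalizing l with
  | nil => exact ⟨[], by simpa using h.symm, rfl⟩
  | cons g L ih =>
    rw [List.flatten_cons, List.map_eq_append_iff] at h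
    obtain ⟨l₁, l₂, rfl, h1, h2⟩ := h
    obtain ⟨L', rfl, h3⟩ := ih h2
    exact ⟨l₁ :: L', rfl, by simp [h1, h3]⟩

/-- The numerical core of the error analysis, with `δ = 1 / (82 * H ^ 2)` and `820 * H ^ 3`
segments; `T = 4 * H` bounds the total acceptance probability that is kept. -/
theorem approximation_factor {K E : ℕ} {ε : ℝ} (hK : 1 ≤ K) (hE : 1 ≤ (E : ℝ) * ε) (hε : ε < 1) :
    let H : ℝ := K + E
    let δ : ℝ := 1 / (82 * H ^ 2)
    (1 - ε) * (1 + 2 * δ ^ 2) ^ (820 * (K + E) ^ 3) ≤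
      (1 - δ) * (1 - 2 * δ ^ 2) ^ (820 * (K + E) ^ 3) *
        (1 - 2 ^ K * Real.exp (-(4 * H) / 2)) := by
  intro H δ
  have hE0 : (0 : ℝ) < E := by
    rcases Nat.eq_zero_or_pos E with h | h
    · simp [h] at hE
      linarith
    · exact_mod_cast h
  have hK' : (1 : ℝ) ≤ K := by exact_mod_cast hK
  have hH : 1 ≤ H := by simp only [H]; linarith
  have hEH : (E : ℝ) ≤ H := by simp only [H]; linarith
  have hε0 : 0 < ε := by
    by_contra h
    nlinarith
  have hEε : 1 / (E : ℝ) ≤ ε := by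
    rw [div_le_iff₀ hE0]
    linarith
  have hδ0 : 0 < δ := by positivity
  have hδH : δ * (82 * H ^ 2) = 1 := by
    simp only [δ]
    field_simp
  have hδ1 : δ ≤ 1 / 82 := by
    simp only [δ]
    apply one_div_le_one_div_of_le <;> nlinarith
  -- The truncation error.
  have htrunc : 2 ^ K * Real.exp (-(4 * H) / 2) ≤ ε / 2 := by
    have h1 : (2 : ℝ) ^ K ≤ Real.exp K := by
      rw [← Real.exp_one_pow]
      exact pow_le_pow_left₀ (by norm_num) (by linarith [Real.add_one_le_exp (1 : ℝ)]) K
    have h2 : 2 * (E : ℝ) ≤ Real.exp (2 * E) := by linarith [Real.add_one_le_exp (2 * (E : ℝ))]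
    calc 2 ^ K * Real.exp (-(4 * H) / 2) ≤ Real.exp K * Real.exp (-(4 * H) / 2) := by gcongr
      _ = Real.exp (-K - 2 * E) := by
        rw [← Real.exp_add]
        congr 1
        simp only [H]
        ring
      _ ≤ Real.exp (-(2 * E)) := Real.exp_le_exp.2 (by linarith)
      _ = 1 / Real.exp (2 * E) := by rw [Real.exp_neg, one_div]
      _ ≤ 1 / (2 * E) := one_div_le_one_div_of_le (by positivity) h2
      _ = (1 / E) / 2 := by field_simp
      _ ≤ ε / 2 := by linarith
  set N := 820 * (K + E) ^ 3 with hN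
  have hNH : (N : ℝ) = 820 * H ^ 3 := by simp [hN, H]
  set y := 2 * δ ^ 2 with hy
  have hy0 : 0 ≤ y := by positivity
  have hy1 : y ≤ 1 / 4 := by rw [hy]; nlinarith
  -- The merging error is at most `41 * H * δ = 1 / (2 * H)`.
  have hmerge : δ + 2 * y * N ≤ ε / 2 := by
    have h1 : δ ^ 2 * (82 * H ^ 2) = δ := by rw [sq, mul_assoc, hδH, mul_one]
    have h2 : δ + 2 * y * N ≤ 41 * H * δ := by
      have : 2 * y * N = 40 * H * δ := by
        rw [hNH, hy]
        linear_combination 40 * H * h1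
      nlinarith
    have h3 : 41 * H * δ * (2 * E) ≤ 1 := by
      nlinarith
    have h4 : 41 * H * δ ≤ 1 / (2 * E) := by
      rw [le_div_iff₀ (by positivity)]
      exact h3
    have h5 : 1 / (2 * (E : ℝ)) = 1 / E / 2 := by field_simp
    linarith
  have hbern : 1 - 2 * y * N ≤ (1 - 2 * y) ^ N := by
    have := one_add_mul_le_pow (a := -(2 * y)) (by linarith) N
    calc 1 - 2 * y * N = 1 + N * -(2 * y) := by ring
      _ ≤ (1 + -(2 * y)) ^ N := this
      _ = _ := by ring
  have hratio : (1 + y) ^ N * (1 - 2 * y * N) ≤ (1 - y) ^ N := by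
    calc (1 + y) ^ N * (1 - 2 * y * N) ≤ (1 + y) ^ N * (1 - 2 * y) ^ N := by gcongr
      _ = ((1 + y) * (1 - 2 * y)) ^ N := (mul_pow _ _ _).symm
      _ ≤ (1 - y) ^ N := by
        refine pow_le_pow_left₀ (mul_nonneg (by linarith) (by linarith)) (by nlinarith) N
  set p := 2 ^ K * Real.exp (-(4 * H) / 2) with hp
  have hp0 : 0 ≤ p := by positivity
  have hyN : 0 ≤ 2 * y * N := by positivity
  have hfac : 1 - ε ≤ (1 - δ) * (1 - 2 * y * N) * (1 - p) := by
    have e1 : 1 - ε / 2 ≤ (1 - δ) * (1 - 2 * y * N) := by nlinarith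
    have e2 : (1 - ε / 2) * (1 - ε / 2) ≤ (1 - δ) * (1 - 2 * y * N) * (1 - p) :=
      mul_le_mul e1 (by linarith) (by linarith) (by linarith)
    nlinarith
  have hP : 0 ≤ (1 + y) ^ N := by positivity
  calc (1 - ε) * (1 + y) ^ N ≤ (1 - δ) * (1 - 2 * y * N) * (1 - p) * (1 + y) ^ N := by gcongr
    _ = (1 - δ) * ((1 + y) ^ N * (1 - 2 * y * N)) * (1 - p) := by ring
    _ ≤ (1 - δ) * (1 - y) ^ N * (1 - p) := by
      have : 0 ≤ 1 - p := by linarith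
      have : 0 ≤ 1 - δ := by linarith
      gcongr

/-- Every mechanism is nearly matched by the merged revenue of a valid plan. -/
theorem exists_valid_plan (hA : A.OnGrid) (hn : 1 ≤ n) {K E : ℕ} (hK : 1 ≤ K)
    (hE : 1 ≤ E) (τ : SPM n) :
    ∃ b : Plan A (820 * (K + E) ^ 3), b.Valid (82 * (K + E) ^ 2) ∧
      (1 - 2 ^ K * Real.exp (-(4 * (K + E : ℝ)) / 2)) * A.expectedRevenue K τ ≤
        (1 + 2 * (1 / (82 * (K + E : ℝ) ^ 2)) ^ 2) ^ (820 * (K + E) ^ 3) * b.approx K := by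
  obtain ⟨l, hnd, -, hrev⟩ := exists_points_rev_le (A := A) τ.offers τ.nodup τ.price_nonneg
  set D := 82 * (K + E) ^ 2 with hD
  set N := 820 * (K + E) ^ 3 with hN
  set δ : ℝ := 1 / D with hδ
  have hD1 : 1 ≤ D := by
    have : 1 ≤ (K + E) ^ 2 := Nat.one_le_pow _ _ (by omega)
    omega
  have hDr : (D : ℝ) = 82 * (K + E : ℝ) ^ 2 := by simp [hD]
  have hK' : (1 : ℝ) ≤ K := by exact_mod_cast hK
  have hH2 : (2 : ℝ) ≤ K + E := by exact_mod_cast (by omega : 2 ≤ K + E)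
  have hH : (1 : ℝ) ≤ K + E := by linarith
  have hδ0 : 0 < δ := by positivity
  have hδ1 : δ ≤ 1 / 2 := by
    rw [hδ]
    apply one_div_le_one_div_of_le (by norm_num)
    rw [hDr]
    nlinarith
  -- Sort by decreasing price, and keep a prefix of total acceptance probability `4 * (K + E)`.
  let r : Point A → Point A → Prop := fun e e' => PriceGE e.offer e'.offer
  let _ : DecidableRel r := fun _ _ => Classical.dec _
  have htot : Std.Total r := ⟨fun a b => le_total b.offer.2 a.offer.2⟩
  have htrans : IsTrans (Point A) r := ⟨fun _ _ _ h h' => le_trans (α := ℝ) h' h⟩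
  set l' := l.insertionSort r with hl'
  have hmap : l'.map Point.offer = (l.map Point.offer).insertionSort PriceGE :=
    List.map_insertionSort r PriceGE Point.offer l (fun _ _ _ _ => Iff.rfl)
  have hperm : l'.Perm l := List.perm_insertionSort r l
  have hsorted : l'.Pairwise r := List.pairwise_insertionSort r l
  have hrev' : A.expectedRevenue K τ ≤ rev K (l'.map Point.offer) := by
    rw [expectedRevenue_eq_rev, hmap]
    exact (hrev K).trans (rev_le_insertionSort (isOffer_map_offer l) K)
  obtain ⟨m₁, m₂, hm, hmass, hm₂⟩ := exists_append_mass (isOffer_map_offer l')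
    (T := 4 * (K + E : ℝ)) (by positivity)
  obtain ⟨l₁, l₂, hl₁₂, rfl, rfl⟩ := List.map_eq_append_iff.1 hm
  have htrunc : (1 - 2 ^ K * Real.exp (-(4 * (K + E : ℝ)) / 2)) * rev K (l'.map Point.offer) ≤
      rev K (l₁.map Point.offer) := by
    have hpos := rev_nonneg (isOffer_map_offer l₁) K
    have hpos' := rev_nonneg (isOffer_map_offer l') K
    rcases hm₂ with h | h
    · have : 0 ≤ 2 ^ K * Real.exp (-(4 * (K + E : ℝ)) / 2) * rev K (l'.map Point.offer) := by
        positivity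
      rw [h, List.append_nil] at hm
      rw [← hm]
      linarith
    · have h0 := surv_le_exp (l := (l₁.map Point.offer).map Prod.fst) (by
        intro q hq
        obtain ⟨o, ho, rfl⟩ := List.mem_map.1 hq
        have := isOffer_map_offer l₁ o ho
        exact ⟨this.1, this.2.1⟩) K
      have h1 : (2 : ℝ) ^ K * Real.exp (-((l₁.map Point.offer).map Prod.fst).sum / 2) ≤
          2 ^ K * Real.exp (-(4 * (K + E : ℝ)) / 2) := by
        gcongr
        exact h
      have h2 : (1 - surv K ((l₁.map Point.offer).map Prod.fst)) * rev K (l'.map Point.offer) ≤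
          rev K (l₁.map Point.offer) := by
        match l₂, hl₁₂ with
        | [], h =>
          have hs := (surv_mem_Icc (l := (l₁.map Point.offer).map Prod.fst) (by
            intro q hq
            obtain ⟨o, ho, rfl⟩ := List.mem_map.1 hq
            have := isOffer_map_offer l₁ o ho
            exact ⟨this.1, this.2.1⟩) K).1
          rw [h, List.append_nil]
          nlinarith
        | e :: l₂, h =>
          rw [h, List.pairwise_append, List.pairwise_cons] at hsorted
          rw [h, List.map_append]
          refine rev_append_mul_le (x := e.offer.2) e.isOffer.2.2 ?_ ?_ K
          · intro o ho
            refine ⟨isOffer_map_offer _ o ho, ?_⟩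
            obtain ⟨e', he', rfl⟩ := List.mem_map.1 ho
            exact hsorted.2.2 e' he' e (by simp)
          · intro o ho
            refine ⟨isOffer_map_offer _ o ho, ?_⟩
            obtain ⟨e', he', rfl⟩ := List.mem_map.1 ho
            rcases List.mem_cons.1 he' with rfl | he'
            · exact le_rfl
            · exact hsorted.2.1.1 e' he'
      refine le_trans ?_ h2
      gcongr
      linarith
  obtain ⟨S, hS, hseg, hcount⟩ := exists_segments hδ0.le (isOffer_map_offer l₁)
  obtain ⟨S', hS', rfl⟩ := exists_flatten_eq_of_map Point.offer hS.symm
  -- With `H = K + E`, there are at most `(2 * (4 * H + 1) + δ) * 82 * H ^ 2` segments, and `2 ≤ H`.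
  have hlen : S'.length ≤ N := by
    rw [List.length_map] at hcount
    have h1 : 0 ≤ mass ((S'.map (List.map Point.offer)).headD []) := by
      apply mass_nonneg
      cases S' with
      | nil => simp
      | cons g S' => exact isOffer_map_offer g
    have h2 : (S'.length : ℝ) * δ ≤ 2 * (4 * (K + E : ℝ) + 1) + δ := by linarith
    have h3 : δ * D = 1 := by rw [hδ]; field_simp
    have h4 : (S'.length : ℝ) ≤ N := by
      have h5 : (S'.length : ℝ) * δ * D ≤ (2 * (4 * (K + E : ℝ) + 1) + δ) * D := by gcongr
      rw [mul_assoc, h3, add_mul, h3, hDr] at h5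
      have h6 : (N : ℝ) = 820 * (K + E : ℝ) ^ 3 := by simp [hN]
      rw [h6]
      nlinarith [mul_nonneg (sub_nonneg.2 hH2) (sq_nonneg (K + E : ℝ))]
    exact_mod_cast h4
  let g : Fin N → List (Point A) := fun s => S'.getD s []
  have hg : List.ofFn g = S' ++ List.replicate (N - S'.length) [] := by
    apply List.ext_getElem
    · simp
      omega
    · intro s h1 h2
      rw [List.getElem_ofFn, List.getElem_append]
      by_cases h : s < S'.length
      · simp [g, h]
      · simp [g, h]
  have hgflat : (List.ofFn g).flatten = l₁ := by
    rw [hg, List.flatten_append, hS']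
    simp
  obtain ⟨b, hb⟩ := Plan.exists_segSum_eq g (by
    rw [hgflat]
    have h1 : (l'.map Sigma.fst).Nodup := (hperm.map Sigma.fst).nodup_iff.2 hnd
    rw [hl₁₂, List.map_append] at h1
    exact h1.of_append_left)
  have hmaps : List.ofFn (fun s => (g s).map Point.offer) =
      S'.map (List.map Point.offer) ++ List.replicate (N - S'.length) [] := by
    have := congrArg (List.map (List.map Point.offer)) hg
    rw [List.map_ofFn, List.map_append, List.map_replicate] at this
    exact this
  refine ⟨b, ?_, ?_⟩
  · rw [Plan.valid_iff hA hn hD1 hb]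
    intro s
    by_cases h : (s : ℕ) < S'.length
    · apply hseg
      simp only [g, List.getD_eq_getElem?_getD, List.getElem?_eq_getElem h, Option.getD_some]
      exact List.mem_map_of_mem (List.getElem_mem h)
    · left
      simp [g, h]
  · have hmerge := rev_flatten_le_merged hδ1 (l := S'.map (List.map Point.offer)) (by
      intro x hx
      refine ⟨hseg x hx, ?_⟩
      obtain ⟨x', -, rfl⟩ := List.mem_map.1 hx
      exact isOffer_map_offer x') K
    have hpos : 0 ≤ merged K (S'.map (List.map Point.offer)) :=
      (merged_nonneg_and_le_succ (δ := δ) (by linarith) (by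
        intro x hx
        refine ⟨hseg x hx, ?_⟩
        obtain ⟨x', -, rfl⟩ := List.mem_map.1 hx
        exact isOffer_map_offer x') K).1
    rw [Plan.approx_eq_merged hA hn hb, hmaps, merged_append_nil, ← hDr]
    by_cases hp : 0 ≤ 1 - 2 ^ K * Real.exp (-(4 * (K + E : ℝ)) / 2)
    · calc _ ≤ (1 - 2 ^ K * Real.exp (-(4 * (K + E : ℝ)) / 2)) * rev K (l'.map Point.offer) := by
            gcongr
        _ ≤ rev K (l₁.map Point.offer) := htrunc
        _ ≤ _ := by
            rw [← hS]
            refine hmerge.trans ?_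
            gcongr
            · linarith [sq_nonneg δ]
            · simpa using hlen
    · have h1 : 0 ≤ A.expectedRevenue K τ := by
        rw [expectedRevenue_eq_rev]
        refine rev_nonneg ?_ K
        intro o ho
        obtain ⟨o', ho', rfl⟩ := List.mem_map.1 ho
        exact ⟨(successProb_mem_Icc A _ _).1, (successProb_mem_Icc A _ _).2, τ.price_nonneg o' ho'⟩
      have h2 : (1 - 2 ^ K * Real.exp (-(4 * (K + E : ℝ)) / 2)) * A.expectedRevenue K τ ≤ 0 :=
        mul_nonpos_of_nonpos_of_nonneg (by linarith) h1
      exact h2.trans (by positivity)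

/-- The revenue of the mechanism of a valid plan is not much below its merged revenue. -/
theorem approx_le_expectedRevenue (hA : A.OnGrid) (hn : 1 ≤ n) {K L D : ℕ} (hD : 2 ≤ D)
    {a : Plan A L} (ha : a.Valid D) :
    (1 - 1 / D) * (1 - 2 * (1 / D : ℝ) ^ 2) ^ L * a.approx K ≤
      A.expectedRevenue K a.toSPM := by
  have hsum : ∀ (M : Type) [AddCommMonoid M] (s : Fin L) (f : Point A → M),
      a.segSum s f = ((a.seg s).map f).sum := fun M _ s f => (a.sum_map_seg s f).symm
  have hseg := (Plan.valid_iff hA hn (by omega) hsum).1 ha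
  have hD' : (2 : ℝ) ≤ D := by exact_mod_cast hD
  rw [Plan.approx_eq_merged hA hn hsum, Plan.expectedRevenue_toSPM]
  have := merged_le_rev_flatten (δ := 1 / (D : ℝ)) (by positivity)
    (one_div_le_one_div_of_le (by norm_num) hD')
    (l := List.ofFn fun s => (a.seg s).map Point.offer) (by
      intro x hx
      obtain ⟨s, rfl⟩ := (List.mem_ofFn' _ _).1 hx
      exact ⟨hseg s, isOffer_map_offer _⟩) K
  rwa [List.length_ofFn] at this

/-- A plan that is optimal with respect to merged revenue is a nearly optimal mechanism. -/
theorem expectedRevenue_optimal_plan (hA : A.OnGrid) (hn : 1 ≤ n) {K E : ℕ} {ε : ℝ} (hK : 1 ≤ K)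
    (hE : 1 ≤ (E : ℝ) * ε) (hε : ε < 1) {a : Plan A (820 * (K + E) ^ 3)}
    (ha : a.Valid (82 * (K + E) ^ 2))
    (hopt : ∀ b : Plan A (820 * (K + E) ^ 3), b.Valid (82 * (K + E) ^ 2) →
      b.approx K ≤ a.approx K) (τ : SPM n) :
    (1 - ε) * A.expectedRevenue K τ ≤ A.expectedRevenue K a.toSPM := by
  have hE1 : 1 ≤ E := by
    rcases Nat.eq_zero_or_pos E with h | h
    · norm_num [h] at hE
    · exact h
  obtain ⟨b, hb, h1⟩ := exists_valid_plan hA hn hK hE1 τ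
  have h2 := approx_le_expectedRevenue hA hn (K := K) (by
    have : 1 ≤ (K + E) ^ 2 := Nat.one_le_pow _ _ (by omega)
    omega) ha
  have h3 := approximation_factor hK hE hε
  simp only at h3
  have hD : ((82 * (K + E) ^ 2 : ℕ) : ℝ) = 82 * (K + E : ℝ) ^ 2 := by push_cast; ring
  rw [hD] at h2
  have hK' : (1 : ℝ) ≤ K := by exact_mod_cast hK
  have hH : (1 : ℝ) ≤ K + E := by linarith [(Nat.cast_nonneg E : (0 : ℝ) ≤ E)]
  have hδ : 1 / (82 * (K + E : ℝ) ^ 2) ≤ 1 / 2 :=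
    one_div_le_one_div_of_le (by norm_num) (by nlinarith)
  have hδ0 : 0 < 1 / (82 * (K + E : ℝ) ^ 2) := by positivity
  set δ := 1 / (82 * (K + E : ℝ) ^ 2)
  set p := 2 ^ K * Real.exp (-(4 * (K + E : ℝ)) / 2)
  set R := A.expectedRevenue K τ
  have hR : 0 ≤ R := by
    simp only [R]
    rw [expectedRevenue_eq_rev]
    refine rev_nonneg ?_ K
    intro o ho
    obtain ⟨o', ho', rfl⟩ := List.mem_map.1 ho
    exact ⟨(successProb_mem_Icc A _ _).1, (successProb_mem_Icc A _ _).2, τ.price_nonneg o' ho'⟩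
  have hP : 0 < (1 + 2 * δ ^ 2) ^ (820 * (K + E) ^ 3) := by positivity
  have hQ : 0 ≤ (1 - δ) * (1 - 2 * δ ^ 2) ^ (820 * (K + E) ^ 3) :=
    mul_nonneg (by linarith) (pow_nonneg (by nlinarith) _)
  refine le_of_mul_le_mul_left ?_ hP
  set P := (1 + 2 * δ ^ 2) ^ (820 * (K + E) ^ 3)
  set Q := (1 - δ) * (1 - 2 * δ ^ 2) ^ (820 * (K + E) ^ 3)
  calc P * ((1 - ε) * R) = (1 - ε) * P * R := by ring
    _ ≤ Q * (1 - p) * R := by gcongr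
    _ = Q * ((1 - p) * R) := by ring
    _ ≤ Q * (P * b.approx K) := by gcongr
    _ ≤ Q * (P * a.approx K) := by
      have := hopt b hb
      gcongr
    _ = P * (Q * a.approx K) := by ring
    _ ≤ _ := by gcongr

end PostedPrice

/-! ### The algorithm -/

namespace PostedPrice

open RealRAM

namespace Prog

/-- The value of entry `e` of the list of all support points. -/
def valueAt (e : NExp) : RExp := .inp (e + e + 1)

/-- The probability of entry `e` of the list of all support points. -/
def probAt (e : NExp) : RExp := .inp (e + e + 2)

/-- Divide `quo` by `base`, with remainder `rem`. -/
def divide : Com :=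
  .setNat .rem 0 NVar.quo ;;
  .setNat .quo 0 0 ;;
  .loop .t .codes
    (.ite (NVar.base ≼ NVar.rem)
      (.setNat .rem 0 (NVar.rem - NVar.base) ;; .setNat .quo 0 (NVar.quo + 1)) .skip)

/-- The digits of `target` to base `base`. -/
def decode : Com :=
  .setNat .quo 0 NVar.target ;;
  .loop .d .digits (divide ;; .setNat .dig NVar.d NVar.rem)

/-- The total acceptance probability of segment `s`. -/
def segMass : Com :=
  .setReal .mass 0 0 ;;
  .loop .t .base
    (.ite (NVar.t + 1 ≼ .get .dig (NVar.s + NVar.s)) (.setReal .mass 0 (RVar.mass + 1)) .skip) ;;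
  .setReal .mass 0 (RVar.mass / RVar.units)

/-- The survival probabilities after a segment, from those before it. Row `s` of the array `surv`
starts at `ptr` and has `copies + 1` entries. -/
def nextSurv : Com :=
  .setReal .surv (NVar.ptr + NVar.copies + 1) 0 ;;
  .loop .k .copies
    (.setReal .surv (NVar.ptr + NVar.copies + 1 + (NVar.k + 1))
      ((1 - RVar.mass) * .get .surv (NVar.ptr + (NVar.k + 1)) +
        RVar.mass * .get .surv (NVar.ptr + NVar.k)))

/-- Reset `ok` if segment `s` violates the validity of the plan. -/
def checkSeg : Com :=
  .setNat .acc 0 0 ;;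
  .loop .t .slack (.setNat .acc 0 (NVar.acc + .get .dig (NVar.s + NVar.s))) ;;
  .ite (.get .dig (NVar.s + NVar.s + 1) ≼ 1) .skip
    (.ite (NVar.acc ≼ NVar.units) .skip (.setNat .ok 0 0))

/-- Compute the weight of segment `s`, move on to the next row of `surv`, and check the segment. -/
def segStep : Com :=
  .setReal .weight NVar.s (.get .surv (NVar.ptr + NVar.copies)) ;;
  segMass ;; nextSurv ;;
  .setNat .ptr 0 (NVar.ptr + NVar.copies + 1) ;;
  checkSeg

/-- The weights of the segments, for plans whose code is `target`, and their validity. -/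
def weights : Com :=
  .setNat .ok 0 1 ;;
  .setReal .surv 0 0 ;;
  .loop .k .copies (.setReal .surv (NVar.k + 1) 1) ;;
  .setNat .ptr 0 0 ;;
  .loop .s .segs segStep

/-- The acceptance probability, cost and weighted worth of offering to buyer `i` the support point
`j` in segment `s`. -/
def optionData : Com :=
  .setReal .prob 0 0 ;;
  .loop .t .units
    (.ite (NVar.t + 1 ≼ .inp (NVar.i + 2))
      (.ite (valueAt (NVar.off + NVar.j) ≼ᵣ valueAt (NVar.off + NVar.t))
        (.setReal .prob 0 (RVar.prob + probAt (NVar.off + NVar.t))) .skip) .skip) ;;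
  .setNat .cost 0 (.get .pow (NVar.s + NVar.s + 1)) ;;
  .setReal .cnt 0 0 ;;
  .loop .t .units
    (.ite (RVar.cnt + 1 ≼ᵣ RVar.prob * RVar.units)
      (.setReal .cnt 0 (RVar.cnt + 1) ;;
        .setNat .cost 0 (NVar.cost + .get .pow (NVar.s + NVar.s))) .skip) ;;
  .setReal .gain 0 (.get .weight NVar.s * (RVar.prob * valueAt (NVar.off + NVar.j)))

/-- Improve the next row of the table by a single option for buyer `i`. -/
def relax : Com :=
  .loop .c .codes
    (.ite (NVar.cost ≼ NVar.c)
      (.ite (0 ≼ᵣ .get .table (NVar.row + (NVar.c - NVar.cost)))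
        (.ite (.get .table (NVar.row + NVar.codes + NVar.c) ≼ᵣ
            .get .table (NVar.row + (NVar.c - NVar.cost)) + RVar.gain)
          (.setReal .table (NVar.row + NVar.codes + NVar.c)
              (.get .table (NVar.row + (NVar.c - NVar.cost)) + RVar.gain) ;;
            .setReal .chPrice (NVar.row + NVar.codes + NVar.c) (valueAt (NVar.off + NVar.j)) ;;
            .setNat .chSeg (NVar.row + NVar.codes + NVar.c) (NVar.s + 1) ;;
            .setNat .chCost (NVar.row + NVar.codes + NVar.c) NVar.cost)
          .skip) .skip) .skip)

/-- Start the next row of the table as a copy of the current one. -/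
def copyRow : Com :=
  .loop .c .codes
    (.setReal .table (NVar.row + NVar.codes + NVar.c) (.get .table (NVar.row + NVar.c)) ;;
      .setNat .chSeg (NVar.row + NVar.codes + NVar.c) 0 ;;
      .setNat .chCost (NVar.row + NVar.codes + NVar.c) 0)

/-- Improve the next row of the table by all options for buyer `i`. -/
def tryOptions : Com :=
  .loop .s .segs (.loop .j .units
    (.ite (NVar.j + 1 ≼ .inp (NVar.i + 2)) (optionData ;; relax) .skip))

/-- Row `i` of the table starts at `i * codes`. Its entry at `c` is the largest weighted worth of
an assignment of the first `i` buyers with code `c`, or `-1` if there is none. -/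
def fillTable : Com :=
  .loop .c .codes (.setReal .table NVar.c (0 - 1)) ;;
  .setReal .table 0 0 ;;
  .setNat .row 0 0 ;;
  .setNat .off 0 0 ;;
  .loop .i .buyers (copyRow ;; tryOptions ;;
    .setNat .row 0 (NVar.row + NVar.codes) ;;
    .setNat .off 0 (NVar.off + .inp (NVar.i + 2)))

/-- Read off the plan behind the table entry at `target`, from the last buyer to the first. -/
def traceBack : Com :=
  .setNat .cur 0 NVar.target ;;
  .loop .t .buyers
    (.setNat .bestSeg (NVar.buyers - (NVar.t + 1)) (.get .chSeg (NVar.row + NVar.cur)) ;;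
      .setReal .bestPrice (NVar.buyers - (NVar.t + 1)) (.get .chPrice (NVar.row + NVar.cur)) ;;
      .setNat .cur 0 (NVar.cur - .get .chCost (NVar.row + NVar.cur)) ;;
      .setNat .row 0 (NVar.row - NVar.codes))

/-- Store the plan behind the table entry at `target` if it is valid and the best one so far. -/
def keepBest : Com :=
  .ite (1 ≼ NVar.ok)
    (.ite (RVar.best ≼ᵣ .get .table (NVar.row + NVar.target))
      (.setReal .best 0 (.get .table (NVar.row + NVar.target)) ;; traceBack) .skip) .skip

/-- Try all codes. -/
def search : Com := .loop .target .codes (decode ;; weights ;; fillTable ;; keepBest)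

/-- Write the offers of the stored plan, segment by segment. -/
def output : Com :=
  .loop .s .segs (.loop .i .buyers
    (.ite (.get .bestSeg NVar.i ≼ NVar.s + 1)
      (.ite (NVar.s + 1 ≼ .get .bestSeg NVar.i)
        (.writeNat NVar.i ;; .writeReal (.get .bestPrice NVar.i)) .skip) .skip))

/-- The parameters that are polynomials in `n` and in `scale`, the sum of `K` and of the integer
that stands for `1 / ε`. -/
def parameters : Com :=
  .setNat .base 0 1 ;;
  .loop .i .buyers (.loop .j .buyers (
    .setNat .units 0 (NVar.units + 10) ;; .setReal .units 0 (RVar.units + 10) ;;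
    .loop .k .buyers (.setNat .base 0 (NVar.base + 10)))) ;;
  .loop .i .scale (.loop .j .scale (
    .setNat .slack 0 (NVar.slack + 82) ;;
    .loop .k .scale (.setNat .segs 0 (NVar.segs + 820) ;;
      .setNat .digits 0 (NVar.digits + 1640))))

/-- The powers of `base`. -/
def powers : Com :=
  .setNat .pow 0 1 ;;
  .loop .d .digits (
    .setNat .acc 0 0 ;;
    .loop .t .base (.setNat .acc 0 (NVar.acc + .get .pow NVar.d)) ;;
    .setNat .pow (NVar.d + 1) NVar.acc)

/-- Read `n` and `K`. -/
def readInput : Com :=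
  .setNat .buyers 0 (.inp 0) ;;
  .setNat .copies 0 (.inp 1) ;;
  .setNat .scale 0 (.inp 1 + NVar.invEps)

/-- Set the number of codes, which bounds all the loops of the search. -/
def setCodes : Com := .setNat .codes 0 (.get .pow NVar.digits)

end Prog
end PostedPrice

/-! ### Codes of plans -/

namespace PostedPrice

/-- A number that exceeds the number of offers and the total acceptance probability, in units of
`1 / (10 * n ^ 2)`, of every segment. -/
def codeBase (n : ℕ) : ℕ := 10 * n ^ 3 + 1

theorem sum_mul_pow_lt {b L : ℕ} (x : ℕ → ℕ) (hx : ∀ s < L, x s < b) :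
    ∑ s ∈ Finset.range L, x s * b ^ s < b ^ L := by
  induction L with
  | zero => simp
  | succ L ih =>
    rw [Finset.sum_range_succ, pow_succ]
    have h1 := ih fun s hs => hx s (by omega)
    have h2 : (x L + 1) * b ^ L ≤ b * b ^ L := Nat.mul_le_mul_right _ (hx L (by omega))
    nlinarith

theorem sum_mul_pow_div_mod {b L s : ℕ} (x : ℕ → ℕ) (hx : ∀ s < L, x s < b) (hs : s < L) :
    (∑ s ∈ Finset.range L, x s * b ^ s) / b ^ s % b = x s := by
  have hb : 0 < b := by have := hx s hs; omega
  induction L with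
  | zero => omega
  | succ L ih =>
    rw [Finset.sum_range_succ]
    rcases Nat.lt_succ_iff_lt_or_eq.1 hs with h | rfl
    · obtain ⟨r, rfl⟩ := Nat.exists_eq_add_of_lt h
      have e : x (s + r + 1) * b ^ (s + r + 1) = (x (s + r + 1) * b ^ r * b) * b ^ s := by ring
      rw [e, Nat.add_mul_div_right _ _ (pow_pos hb s), Nat.add_mul_mod_self_right]
      exact ih (fun s hs => hx s (by omega)) h
    · rw [Nat.add_mul_div_right _ _ (pow_pos hb s),
        Nat.div_eq_of_lt (sum_mul_pow_lt x fun s hs => hx s (by omega)), zero_add,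
        Nat.mod_eq_of_lt (hx s hs)]

variable {n : ℕ} {A : Auction n} {L : ℕ}

/-- The contribution to the code of offering the support point `e` in segment `s`. -/
noncomputable def pointCost (s : ℕ) (e : Point A) : ℕ :=
  e.units * codeBase n ^ (s + s) + codeBase n ^ (s + s + 1)

/-- The expected payment for the support point `e` in a segment of weight `w`. -/
noncomputable def pointGain (w : ℝ) (e : Point A) : ℝ := w * (e.offer.1 * e.offer.2)

/-- The contribution of buyer `i` to the code of a plan. -/
noncomputable def optCost (i : Fin n) (o : Option (Fin L × Fin (A.supp i))) : ℕ :=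
  o.elim 0 fun o => pointCost o.1 (⟨i, o.2⟩ : Point A)

/-- The contribution of buyer `i` to the merged revenue of a plan, when `w` are the probabilities
that copies are left at the segments. -/
noncomputable def optGain (w : ℕ → ℝ) (i : Fin n) (o : Option (Fin L × Fin (A.supp i))) : ℝ :=
  o.elim 0 fun o => pointGain (w o.1) (⟨i, o.2⟩ : Point A)

@[simp] theorem optCost_none (i : Fin n) :
    optCost i (none : Option (Fin L × Fin (A.supp i))) = 0 := rfl
@[simp] theorem optCost_some (i : Fin n) (o : Fin L × Fin (A.supp i)) :
    optCost i (some o) = pointCost o.1 (⟨i, o.2⟩ : Point A) := rfl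
@[simp] theorem optGain_none (w : ℕ → ℝ) (i : Fin n) :
    optGain w i (none : Option (Fin L × Fin (A.supp i))) = 0 := rfl
@[simp] theorem optGain_some (w : ℕ → ℝ) (i : Fin n) (o : Fin L × Fin (A.supp i)) :
    optGain w i (some o) = pointGain (w o.1) (⟨i, o.2⟩ : Point A) := rfl

theorem Point.units_le (e : Point A) : e.units ≤ 10 * n ^ 2 := by
  have h : e.units ≤ ⌊((10 * n ^ 2 : ℕ) : ℝ)⌋₊ := by
    refine Nat.floor_le_floor ?_
    push_cast
    exact mul_le_of_le_one_left (by positivity) e.isOffer.2.1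
  rwa [Nat.floor_natCast] at h

namespace Plan

variable (a : Plan A L)

/-- The number that encodes the total acceptance probabilities and the numbers of offers of all
segments, which are its digits to base `codeBase n`. -/
noncomputable def code : ℕ := ∑ i, optCost i (a i)

theorem massUnits_lt (s : Fin L) : a.massUnits s < codeBase n := by
  have h : a.massUnits s ≤ ∑ _i : Fin n, 10 * n ^ 2 := by
    unfold massUnits segSum
    gcongr with i
    cases a i with
    | none => simp
    | some o =>
      simp only [Option.elim_some]
      split_ifs
      exacts [Point.units_le _, by simp]
  rw [Finset.sum_const, Finset.card_univ, Fintype.card_fin, smul_eq_mul] at h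
  have : n * (10 * n ^ 2) = 10 * n ^ 3 := by ring
  unfold codeBase
  omega

theorem count_lt (s : Fin L) : a.count s < codeBase n := by
  have h : a.count s ≤ ∑ _i : Fin n, 1 := by
    unfold count segSum
    gcongr with i
    cases a i with
    | none => simp
    | some o =>
      simp only [Option.elim_some]
      split_ifs <;> simp
  rw [Finset.sum_const, Finset.card_univ, Fintype.card_fin, smul_eq_mul, mul_one] at h
  have : n ≤ n ^ 3 := Nat.le_self_pow (by norm_num) n
  unfold codeBase
  omega

theorem sum_segSum {M : Type} [AddCommMonoid M] (f : Fin L → Point A → M) :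
    ∑ s, a.segSum s (f s) = ∑ i, (a i).elim 0 fun o => f o.1 ⟨i, o.2⟩ := by
  simp only [segSum]
  rw [Finset.sum_comm]
  refine Finset.sum_congr rfl fun i _ => ?_
  cases a i with
  | none => simp
  | some o => simp

theorem code_eq : a.code =
    ∑ s : Fin L, (a.massUnits s + a.count s * codeBase n) * (codeBase n ^ 2) ^ (s : ℕ) := by
  have h := a.sum_segSum (fun s e => pointCost s e)
  rw [code]
  refine h.symm.trans (Finset.sum_congr rfl fun s _ => ?_)
  rw [massUnits, count, segSum, segSum, segSum, Finset.sum_mul, ← Finset.sum_add_distrib,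
    Finset.sum_mul]
  refine Finset.sum_congr rfl fun i _ => ?_
  cases a i with
  | none => simp
  | some o =>
    simp only [Option.elim_some]
    split_ifs
    · rw [pointCost]
      ring
    · simp

theorem exists_digits : ∃ x : ℕ → ℕ, (∀ s < L, x s < codeBase n ^ 2) ∧
    (∀ s : Fin L, x s = a.massUnits s + a.count s * codeBase n) ∧
    a.code = ∑ s ∈ Finset.range L, x s * (codeBase n ^ 2) ^ s := by
  refine ⟨fun s => if h : s < L then a.massUnits ⟨s, h⟩ + a.count ⟨s, h⟩ * codeBase n else 0,
    fun s hs => ?_, fun s => by simp, ?_⟩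
  · simp only [hs, dif_pos]
    have h1 := a.massUnits_lt ⟨s, hs⟩
    have h2 := Nat.mul_le_mul_right (codeBase n) (Nat.succ_le_of_lt (a.count_lt ⟨s, hs⟩))
    rw [Nat.succ_mul] at h2
    rw [sq]
    omega
  · rw [code_eq, ← Fin.sum_univ_eq_sum_range]
    simp

theorem code_lt : a.code < codeBase n ^ (2 * L) := by
  obtain ⟨x, hx, -, h⟩ := a.exists_digits
  rw [h, pow_mul]
  exact sum_mul_pow_lt x hx

theorem code_div_mod_sq (s : Fin L) :
    a.code / codeBase n ^ (s + s : ℕ) % (codeBase n * codeBase n) =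
      a.massUnits s + a.count s * codeBase n := by
  obtain ⟨x, hx, hs, h⟩ := a.exists_digits
  rw [h, ← hs, ← sum_mul_pow_div_mod x hx s.2]
  rw [← two_mul, pow_mul, ← sq]

theorem code_digit_mass (s : Fin L) :
    a.code / codeBase n ^ (s + s : ℕ) % codeBase n = a.massUnits s := by
  rw [← Nat.mod_mod_of_dvd _ (Dvd.intro _ rfl : codeBase n ∣ codeBase n * codeBase n),
    code_div_mod_sq, Nat.add_mul_mod_self_right, Nat.mod_eq_of_lt (a.massUnits_lt s)]

theorem code_digit_count (s : Fin L) :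
    a.code / codeBase n ^ (s + s + 1 : ℕ) % codeBase n = a.count s := by
  have h0 : 0 < codeBase n := Nat.succ_pos _
  rw [pow_succ, ← Nat.div_div_eq_div_mul, ← Nat.mod_mul_right_div_self, code_div_mod_sq,
    Nat.add_mul_div_right _ _ h0, Nat.div_eq_of_lt (a.massUnits_lt s), zero_add]

end Plan

/-- The probability that a copy is left at segment `s` of the merged mechanism, for plans with
code `T`. -/
noncomputable def segWeight (n K T s : ℕ) : ℝ :=
  surv K ((List.range s).map fun s' =>
    ((T / codeBase n ^ (s' + s') % codeBase n : ℕ) : ℝ) / (10 * (n : ℝ) ^ 2))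

/-- Whether the plans with code `T` are valid. -/
def ValidCode (n L D T : ℕ) : Prop :=
  ∀ s < L, T / codeBase n ^ (s + s + 1) % codeBase n ≤ 1 ∨
    T / codeBase n ^ (s + s) % codeBase n * D ≤ 10 * n ^ 2

theorem Plan.validCode_iff (a : Plan A L) (D : ℕ) : ValidCode n L D a.code ↔ a.Valid D := by
  constructor
  · intro h s
    have := h s s.2
    rwa [a.code_digit_mass, a.code_digit_count] at this
  · intro h s hs
    have := h ⟨s, hs⟩
    rwa [← a.code_digit_mass, ← a.code_digit_count] at this

theorem Plan.sum_optGain (a : Plan A L) (K : ℕ) :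
    ∑ i, optGain (segWeight n K a.code) i (a i) = a.approx K := by
  have h := a.sum_segSum (fun s e => pointGain (segWeight n K a.code s) e)
  refine h.symm.trans (Finset.sum_congr rfl fun s _ => ?_)
  have h1 : (List.ofFn fun s => (a.massUnits s : ℝ) / (10 * (n : ℝ) ^ 2)).take s =
      (List.range s).map fun s' =>
        ((a.code / codeBase n ^ (s' + s') % codeBase n : ℕ) : ℝ) / (10 * (n : ℝ) ^ 2) := by
    apply List.ext_getElem
    · simp
    · intro s' h1 h2
      have h3 : s' < L := by
        simp at h2
        omega
      rw [List.getElem_take, List.getElem_ofFn, List.getElem_map, List.getElem_range,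
        ← a.code_digit_mass ⟨s', h3⟩]
  rw [h1, ← segWeight, segSum, segSum, Finset.mul_sum]
  refine Finset.sum_congr rfl fun i _ => ?_
  cases a i with
  | none => simp
  | some o =>
    simp only [Option.elim_some]
    split_ifs
    · rfl
    · simp

/-! ### The input tapes -/

/-- The number of support points of the buyers before buyer `i`. -/
def offset (A : Auction n) (i : ℕ) : ℕ := (((List.finRange n).take i).map A.supp).sum

theorem offset_zero : offset A 0 = 0 := rfl

theorem take_finRange_succ (i : Fin n) :
    (List.finRange n).take (i + 1) = (List.finRange n).take i ++ [i] := by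
  rw [← List.take_concat_get' _ _ (by simp), List.getElem_finRange]
  simp

theorem offset_succ (i : Fin n) : offset A (i + 1) = offset A i + A.supp i := by
  simp [offset, take_finRange_succ]

theorem encode_nat_zero (K : ℕ) (ε : ℝ) : (A.encode K ε).nat 0 = n := rfl

theorem encode_nat_one (K : ℕ) (ε : ℝ) : (A.encode K ε).nat 1 = K := rfl

theorem encode_nat_supp (K : ℕ) (ε : ℝ) (i : Fin n) : (A.encode K ε).nat (i + 2) = A.supp i := by
  simp [Auction.encode]

theorem encode_real_zero (K : ℕ) (ε : ℝ) : (A.encode K ε).real 0 = ε := rfl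

theorem length_pairs {m : ℕ} (f g : Fin m → ℝ) (l : List (Fin m)) :
    (l.flatMap fun j => [f j, g j]).length = 2 * l.length := by
  induction l with
  | nil => rfl
  | cons j l ih => simp only [List.flatMap_cons, List.length_append, ih, List.length_cons]; simp; ring

theorem getElem?_pairs {m : ℕ} (f g : Fin m → ℝ) (l : List (Fin m)) (l' : List ℝ) (j : ℕ)
    (hj : j < l.length) :
    ((l.flatMap fun j => [f j, g j]) ++ l')[j + j]? = some (f l[j]) ∧
      ((l.flatMap fun j => [f j, g j]) ++ l')[j + j + 1]? = some (g l[j]) := by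
  induction l generalizing j with
  | nil => simp at hj
  | cons a l ih =>
    cases j with
    | zero => simp
    | succ j =>
      have e : j + 1 + (j + 1) = j + j + 2 := by ring
      simp only [e, List.flatMap_cons, List.cons_append, List.nil_append,
        List.getElem?_cons_succ, List.getElem_cons_succ]
      exact ih j (by simpa using hj)

theorem encode_real (K : ℕ) (ε : ℝ) (i : Fin n) (j : Fin (A.supp i)) :
    (A.encode K ε).real (offset A i + j + (offset A i + j) + 1) = A.val i j ∧
    (A.encode K ε).real (offset A i + j + (offset A i + j) + 2) = A.prob i j := by
  let F : Fin n → List ℝ := fun i =>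
    (List.finRange (A.supp i)).flatMap fun j => [A.val i j, A.prob i j]
  have hlen : ∀ l : List (Fin n), (l.flatMap F).length = 2 * (l.map A.supp).sum := by
    intro l
    induction l with
    | nil => rfl
    | cons i l ih =>
      rw [List.flatMap_cons, List.length_append, ih, length_pairs, List.length_finRange]
      simp
      ring
  have hsplit : (List.finRange n).flatMap F =
      ((List.finRange n).take i).flatMap F ++ (F i ++ ((List.finRange n).drop (i + 1)).flatMap F) := by
    conv_lhs => rw [← List.take_append_drop (i + 1) (List.finRange n), take_finRange_succ]
    simp
  have hl : (((List.finRange n).take i).flatMap F).length = 2 * offset A i := hlen _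
  have key := getElem?_pairs (A.val i) (A.prob i) (List.finRange (A.supp i))
    (((List.finRange n).drop (i + 1)).flatMap F) j (by simp)
  have e1 : offset A i + j + (offset A i + j) = 2 * offset A i + (j + j : ℕ) := by ring
  have e2 : offset A i + j + (offset A i + j) + 1 = 2 * offset A i + (j + j + 1 : ℕ) := by ring
  constructor
  · change (List.getD (ε :: (List.finRange n).flatMap F) _ 0) = _
    rw [List.getD_cons_succ, List.getD_eq_getElem?_getD, hsplit, e1,
      List.getElem?_append_right (by omega), hl, Nat.add_sub_cancel_left, key.1]
    simp
  · change (List.getD (ε :: (List.finRange n).flatMap F) _ 0) = _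
    rw [List.getD_cons_succ, List.getD_eq_getElem?_getD, hsplit, e2,
      List.getElem?_append_right (by omega), hl, Nat.add_sub_cancel_left, key.2]
    simp

/-- Distinct support points of a buyer have distinct success probabilities, so their number is
bounded by the number of possible success probabilities. -/
theorem supp_le (hA : A.OnGrid) (hn : 1 ≤ n) (i : Fin n) : A.supp i ≤ 10 * n ^ 2 := by
  have hpos : (0 : ℝ) < 10 * (n : ℝ) ^ 2 := by positivity
  have hlt : ∀ j j' : Fin (A.supp i), A.val i j < A.val i j' →
      A.successProb i (A.val i j') < A.successProb i (A.val i j) := by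
    intro j j' h
    refine Finset.sum_lt_sum (fun k _ => ?_) ⟨j, Finset.mem_univ j, ?_⟩
    · split_ifs with h1 h2
      · exact le_rfl
      · exact absurd (h.le.trans h1) h2
      · exact (A.prob_pos i k).le
      · exact le_rfl
    · rw [if_neg (not_le.2 h), if_pos le_rfl]
      exact A.prob_pos i j
  let f : Fin (A.supp i) → ℕ := fun j => Point.units (⟨i, j⟩ : Point A)
  have hf : Function.Injective f := by
    intro j j' h
    have h1 : A.successProb i (A.val i j) = A.successProb i (A.val i j') := by
      have a1 := Point.offer_eq_div hA hn ⟨i, j⟩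
      have a2 := Point.offer_eq_div hA hn ⟨i, j'⟩
      have h' : Point.units (⟨i, j⟩ : Point A) = Point.units (⟨i, j'⟩ : Point A) := h
      rw [h', ← a2] at a1
      exact a1
    rcases lt_trichotomy (A.val i j) (A.val i j') with h2 | h2 | h2
    · exact absurd h1 (hlt _ _ h2).ne'
    · exact A.val_injective i h2
    · exact absurd h1 (hlt _ _ h2).ne
  have hpos' : ∀ j, f j ∈ Finset.Icc 1 (10 * n ^ 2) := by
    intro j
    rw [Finset.mem_Icc]
    refine ⟨?_, Point.units_le _⟩
    have h1 : 0 < A.successProb i (A.val i j) := by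
      refine Finset.sum_pos' (fun k _ => ?_) ⟨j, Finset.mem_univ j, ?_⟩
      · split_ifs
        exacts [(A.prob_pos i k).le, le_rfl]
      · rw [if_pos le_rfl]
        exact A.prob_pos i j
    have h2 := Point.units_eq hA hn ⟨i, j⟩
    have h3 : (0 : ℝ) < (Point.units (⟨i, j⟩ : Point A) : ℝ) := by
      rw [h2]
      exact mul_pos h1 hpos
    exact_mod_cast h3
  have := Finset.card_le_card_of_injOn (s := Finset.univ) f (fun j _ => hpos' j) hf.injOn
  simpa using this

end PostedPrice

/-! ### Correctness of the search for one code -/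

namespace PostedPrice

open RealRAM Prog

variable {n : ℕ} {A : Auction n} {K L D : ℕ} {I : Input} {m m' : Mem}

/-- The memory holds the parameters of the search. -/
structure Params (n K L D : ℕ) (m : Mem) : Prop where
  buyers : m.nat .buyers 0 = n
  copies : m.nat .copies 0 = K
  units : m.nat .units 0 = 10 * n ^ 2
  slack : m.nat .slack 0 = D
  segs : m.nat .segs 0 = L
  digits : m.nat .digits 0 = 2 * L
  base : m.nat .base 0 = codeBase n
  codes : m.nat .codes 0 = codeBase n ^ (2 * L)
  pow : ∀ d < 2 * L, m.nat .pow d = codeBase n ^ d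
  realUnits : m.real .units 0 = 10 * (n : ℝ) ^ 2

/-- The arrays of natural numbers that hold the parameters. -/
def paramVars : List NVar :=
  [.buyers, .copies, .units, .slack, .segs, .digits, .base, .codes, .pow]

/-- Whether `c` leaves the parameters unchanged. -/
def Com.keepsParams (c : Com) : Bool :=
  paramVars.all (fun v => !c.setsNat v) && !c.setsReal .units

theorem Params.of_eq (h : Params n K L D m) (h1 : ∀ v ∈ paramVars, m'.nat v = m.nat v)
    (h2 : m'.real .units = m.real .units) : Params n K L D m' := by
  simp only [paramVars, List.forall_mem_cons] at h1
  obtain ⟨e1, e2, e3, e4, e5, e6, e7, e8, e9, -⟩ := h1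
  exact ⟨e1 ▸ h.buyers, e2 ▸ h.copies, e3 ▸ h.units, e4 ▸ h.slack, e5 ▸ h.segs, e6 ▸ h.digits,
    e7 ▸ h.base, e8 ▸ h.codes, e9 ▸ h.pow, h2 ▸ h.realUnits⟩

theorem Params.run {c : Com} (h : Params n K L D m) (hc : c.keepsParams = true) :
    Params n K L D (c.run I m) := by
  simp only [Com.keepsParams, Bool.and_eq_true, List.all_eq_true, Bool.not_eq_true'] at hc
  exact h.of_eq (fun v hv => Com.run_nat_frame I v c m (hc.1 v hv))
    (Com.run_real_frame I _ c m hc.2)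

/-- The parameters are unchanged before each iteration of a loop. -/
theorem Params.loop {c : Com} {x b : NVar} (h : Params n K L D m)
    (h1 : ∀ v, c.setsNat v = false → v ≠ x → m'.nat v = m.nat v)
    (h2 : ∀ v, c.setsReal v = false → m'.real v = m.real v)
    (hc : (Com.loop x b c).keepsParams = true) : Params n K L D m' := by
  simp only [Com.keepsParams, Bool.and_eq_true, List.all_eq_true, Bool.not_eq_true', Com.setsNat,
    Com.setsReal, Bool.or_eq_false_iff, beq_eq_false_iff_ne] at hc
  exact h.of_eq (fun v hv => h1 v (hc.1 v hv).2 (hc.1 v hv).1.symm) (h2 _ hc.2)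

theorem codeBase_pos (n : ℕ) : 0 < codeBase n := Nat.succ_pos _

theorem run_divide (h : Params n K L D m) (hq : m.nat .quo 0 < codeBase n ^ (2 * L)) :
    ((divide.run I m).nat .quo 0 = m.nat .quo 0 / codeBase n) ∧
      (divide.run I m).nat .rem 0 = m.nat .quo 0 % codeBase n := by
  set X := m.nat .quo 0 with hX
  have hB := codeBase_pos n
  rw [divide, Com.run_seq, Com.run_seq]
  set m₁ := Com.run I (.setNat .quo 0 0) (Com.run I (.setNat .rem 0 NVar.quo) m) with hm₁
  have hp : Params n K L D m₁ := (h.run rfl).run rfl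
  have key := Com.loop_induction (I := I) (x := .t) (b := .codes) (m := m₁)
    (c := .ite (NVar.base ≼ NVar.rem)
      (.setNat .rem 0 (NVar.rem - NVar.base) ;; .setNat .quo 0 (NVar.quo + 1)) .skip)
    (fun k m' => m'.nat .rem 0 + codeBase n * m'.nat .quo 0 = X ∧
      (m'.nat .rem 0 < codeBase n ∨ m'.nat .quo 0 = k)) (by simp [hm₁, hX]) (by
    intro k hk m' _ f1 f2 ⟨e1, e2⟩
    have hp' : Params n K L D m' := hp.loop f1 f2 (b := .codes) rfl
    by_cases hc : codeBase n ≤ m'.nat .rem 0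
    · rw [Com.run_ite_pos (by simpa [hp'.base] using hc)]
      simp [hp'.base]
      constructor
      · rw [mul_add]
        omega
      · omega
    · rw [Com.run_ite_neg (by simpa [hp'.base] using hc)]
      simp
      exact ⟨e1, Or.inl (by omega)⟩)
  rw [hp.codes] at key
  obtain ⟨e1, e2⟩ := key
  set r := (Com.run I (.loop .t .codes _) m₁).nat .rem 0
  set q := (Com.run I (.loop .t .codes _) m₁).nat .quo 0
  have hr : r < codeBase n := by
    rcases e2 with e2 | e2
    · exact e2
    · have : q ≤ codeBase n * q := Nat.le_mul_of_pos_left _ hB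
      omega
  rw [← e1]
  constructor
  · rw [Nat.add_mul_div_left _ _ hB, Nat.div_eq_of_lt hr, zero_add]
  · rw [Nat.add_mul_mod_self_left, Nat.mod_eq_of_lt hr]

theorem run_decode (h : Params n K L D m) (hT : m.nat .target 0 < codeBase n ^ (2 * L)) :
    ∀ d < 2 * L, (decode.run I m).nat .dig d = m.nat .target 0 / codeBase n ^ d % codeBase n := by
  set T := m.nat .target 0 with hTdef
  rw [decode, Com.run_seq]
  set m₁ := Com.run I (.setNat .quo 0 NVar.target) m with hm₁
  have hp : Params n K L D m₁ := h.run rfl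
  have key := Com.loop_induction (I := I) (x := .d) (b := .digits) (m := m₁)
    (c := divide ;; .setNat .dig NVar.d NVar.rem)
    (fun k m' => m'.nat .quo 0 = T / codeBase n ^ k ∧
      ∀ d < k, m'.nat .dig d = T / codeBase n ^ d % codeBase n) (by simp [hm₁, hTdef]) (by
    intro k hk m' hd f1 f2 ⟨e1, e2⟩
    have hp' : Params n K L D m' := hp.loop f1 f2 (b := .digits) rfl
    obtain ⟨d1, d2⟩ := run_divide (I := I) hp' (by
      rw [e1]
      exact (Nat.div_le_self _ _).trans_lt hT)
    have d3 : (divide.run I m').nat .d 0 = k := by rw [Com.run_nat_frame I _ _ _ rfl, hd]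
    have d4 : (divide.run I m').nat .dig = m'.nat .dig := Com.run_nat_frame I _ _ _ rfl
    simp only [Com.run_seq, Com.run_setNat, Mem.nat_setNat]
    simp only [NExp.eval_get, NExp.eval_const, d1, d2, d3, d4]
    constructor
    · simp [e1, Nat.div_div_eq_div_mul, pow_succ]
    · intro d hd
      by_cases h : d = k
      · simp [h, e1]
      · simpa [h] using e2 d (by omega))
  rw [hp.digits] at key
  exact key.2

/-- The memory holds the digits of `T`. -/
def HasDigits (n L T : ℕ) (m : Mem) : Prop :=
  ∀ d < 2 * L, m.nat .dig d = T / codeBase n ^ d % codeBase n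

theorem run_segMass {T s : ℕ} (h : Params n K L D m) (hd : HasDigits n L T m)
    (hs : m.nat .s 0 = s) (hsL : s < L) :
    (segMass.run I m).real .mass 0 =
      ((T / codeBase n ^ (s + s) % codeBase n : ℕ) : ℝ) / (10 * (n : ℝ) ^ 2) := by
  have hdig := hd (s + s) (by omega)
  set u := T / codeBase n ^ (s + s) % codeBase n with hu
  have hub : u < codeBase n := Nat.mod_lt _ (codeBase_pos n)
  rw [segMass, Com.run_seq, Com.run_seq]
  set m₁ := Com.run I (.setReal .mass 0 0) m with hm₁
  have hp : Params n K L D m₁ := h.run rfl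
  have key := Com.loop_induction (I := I) (x := .t) (b := .base) (m := m₁)
    (c := .ite (NVar.t + 1 ≼ .get .dig (NVar.s + NVar.s)) (.setReal .mass 0 (RVar.mass + 1)) .skip)
    (fun k m' => m'.real .mass 0 = (min k u : ℕ)) (by simp [hm₁]) (by
    intro k hk m' ht f1 f2 e
    have e1 : m'.nat .s 0 = s := by rw [f1 _ rfl (by decide), hm₁]; simpa using hs
    have e2 : m'.nat .dig (s + s) = u := by rw [f1 _ rfl (by decide), hm₁]; simpa using hdig
    by_cases hc : k + 1 ≤ u
    · rw [Com.run_ite_pos (by simpa [ht, e1, e2] using hc)]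
      rw [show min k u = k by omega] at e
      simp [e, show min (k + 1) u = k + 1 by omega]
    · rw [Com.run_ite_neg (by simpa [ht, e1, e2] using hc)]
      rw [show min k u = u by omega] at e
      simp [e, show min (k + 1) u = u by omega])
  rw [hp.base, min_eq_right hub.le] at key
  have hp' : Params n K L D (Com.run I (.loop .t .base (.ite
    (NVar.t + 1 ≼ .get .dig (NVar.s + NVar.s)) (.setReal .mass 0 (RVar.mass + 1)) .skip)) m₁) :=
    hp.run rfl
  simp [key, hp'.realUnits]

/-- The row of the array `surv` that starts at `ptr` holds the probabilities that copies are left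
at segment `s`, for all numbers of copies up to `K`. -/
def HasSurv (n K T s : ℕ) (m : Mem) : Prop :=
  ∀ k ≤ K, m.real .surv (m.nat .ptr 0 + k) = segWeight n k T s

/-- The recursion that `nextSurv` uses. -/
theorem segWeight_succ (n k T s : ℕ) : segWeight n (k + 1) T (s + 1) =
    (1 - ((T / codeBase n ^ (s + s) % codeBase n : ℕ) : ℝ) / (10 * (n : ℝ) ^ 2)) *
      segWeight n (k + 1) T s +
    ((T / codeBase n ^ (s + s) % codeBase n : ℕ) : ℝ) / (10 * (n : ℝ) ^ 2) *
      segWeight n k T s := by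
  rw [segWeight, List.range_succ, List.map_append, List.map_singleton, surv_append_singleton]
  rfl

theorem run_nextSurv {T s : ℕ} (h : Params n K L D m) (hsurv : HasSurv n K T s m)
    (hmass : m.real .mass 0 =
      ((T / codeBase n ^ (s + s) % codeBase n : ℕ) : ℝ) / (10 * (n : ℝ) ^ 2)) :
    ∀ k ≤ K, (nextSurv.run I m).real .surv (m.nat .ptr 0 + K + 1 + k) =
      segWeight n k T (s + 1) := by
  rw [nextSurv, Com.run_seq]
  set m₁ := Com.run I (.setReal .surv (NVar.ptr + NVar.copies + 1) 0) m with hm₁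
  have hp : Params n K L D m₁ := h.run rfl
  set p := m.nat .ptr 0 with hptr
  have key := Com.loop_induction (I := I) (x := .k) (b := .copies) (m := m₁)
    (c := .setReal .surv (NVar.ptr + NVar.copies + 1 + (NVar.k + 1))
      ((1 - RVar.mass) * .get .surv (NVar.ptr + (NVar.k + 1)) +
        RVar.mass * .get .surv (NVar.ptr + NVar.k)))
    (fun k m' => (∀ k' ≤ k, m'.real .surv (p + K + 1 + k') = segWeight n k' T (s + 1)) ∧
      ∀ k' ≤ K, m'.real .surv (p + k') = segWeight n k' T s) (by
    constructor
    · intro k' hk'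
      obtain rfl : k' = 0 := by omega
      simp [hm₁, h.copies, ← hptr, segWeight]
    · intro k' hk'
      have : p + k' ≠ p + K + 1 := by omega
      simpa [hm₁, h.copies, ← hptr, this] using hsurv k' hk') (by
    intro k hk m' hk' f1 f2 ⟨e1, e2⟩
    have hp' : Params n K L D m' := hp.loop f1 f2 (b := .copies) rfl
    rw [hp.copies] at hk
    have e3 : m'.nat .ptr 0 = p := by
      rw [f1 _ rfl (by decide), hm₁]
      rfl
    have e4 : m'.real .mass 0 =
        ((T / codeBase n ^ (s + s) % codeBase n : ℕ) : ℝ) / (10 * (n : ℝ) ^ 2) := by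
      rw [f2 _ rfl, hm₁]
      exact hmass
    have e5 := e2 (k + 1) (by omega)
    have e6 := e2 k (by omega)
    constructor
    · intro k' hk''
      by_cases hkk : k' = k + 1
      · rw [hkk, segWeight_succ]
        simp [e3, hp'.copies, hk', e4, e5, e6]
      · have := e1 k' (by omega)
        simpa [e3, hp'.copies, hk', hkk] using this
    · intro k' hk''
      have : p + k' ≠ p + K + 1 + (k + 1) := by omega
      simpa [e3, hp'.copies, hk', this] using e2 k' hk'')
  rw [hp.copies] at key
  exact key.1

/-- The variable `ok` is kept if segment `s` is valid, and reset otherwise. -/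
theorem run_checkSeg {T s : ℕ} (h : Params n K L D m) (hd : HasDigits n L T m)
    (hs : m.nat .s 0 = s) (hsL : s < L) :
    ((checkSeg.run I m).nat .ok 0 = m.nat .ok 0 ∧
      (T / codeBase n ^ (s + s + 1) % codeBase n ≤ 1 ∨
        T / codeBase n ^ (s + s) % codeBase n * D ≤ 10 * n ^ 2)) ∨
    ((checkSeg.run I m).nat .ok 0 = 0 ∧
      ¬ (T / codeBase n ^ (s + s + 1) % codeBase n ≤ 1 ∨
        T / codeBase n ^ (s + s) % codeBase n * D ≤ 10 * n ^ 2)) := by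
  have hdig := hd (s + s) (by omega)
  have hdig' := hd (s + s + 1) (by omega)
  set u := T / codeBase n ^ (s + s) % codeBase n with hu
  set v := T / codeBase n ^ (s + s + 1) % codeBase n with hv
  rw [checkSeg, Com.run_seq, Com.run_seq]
  set m₁ := Com.run I (.setNat .acc 0 0) m with hm₁
  have hp : Params n K L D m₁ := h.run rfl
  have key := Com.loop_induction (I := I) (x := .t) (b := .slack) (m := m₁)
    (c := .setNat .acc 0 (NVar.acc + .get .dig (NVar.s + NVar.s)))
    (fun k m' => m'.nat .acc 0 = u * k) (by simp [hm₁]) (by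
    intro k hk m' ht f1 f2 e
    have e1 : m'.nat .s 0 = s := by rw [f1 _ rfl (by decide), hm₁]; simpa using hs
    have e2 : m'.nat .dig (s + s) = u := by rw [f1 _ rfl (by decide), hm₁]; simpa using hdig
    simp [e, e1, e2, mul_add])
  rw [hp.slack] at key
  set m₂ := Com.run I (.loop .t .slack (.setNat .acc 0 (NVar.acc + .get .dig (NVar.s + NVar.s)))) m₁
    with hm₂
  have hp₂ : Params n K L D m₂ := hp.run rfl
  have f : ∀ v, v ≠ .acc → v ≠ .t → m₂.nat v = m.nat v := by
    intro v h1 h2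
    rw [hm₂, Com.run_nat_frame I v _ _ (by simp [Com.setsNat, h1.symm, h2.symm]), hm₁,
      Com.run_nat_frame I v _ _ (by simp [Com.setsNat, h1.symm])]
  have e1 : m₂.nat .s 0 = s := by rw [f _ (by decide) (by decide), hs]
  have e2 : m₂.nat .dig (s + s + 1) = v := by rw [f _ (by decide) (by decide), hdig']
  have e3 : m₂.nat .ok 0 = m.nat .ok 0 := by rw [f _ (by decide) (by decide)]
  by_cases h1 : v ≤ 1
  · left
    rw [Com.run_ite_pos (by simpa [e1, e2] using h1)]
    exact ⟨by simpa using e3, Or.inl h1⟩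
  · rw [Com.run_ite_neg (by simpa [e1, e2] using h1)]
    by_cases h2 : u * D ≤ 10 * n ^ 2
    · left
      rw [Com.run_ite_pos (by simpa [key, hp₂.units] using h2)]
      exact ⟨by simpa using e3, Or.inr h2⟩
    · right
      rw [Com.run_ite_neg (by simpa [key, hp₂.units] using h2)]
      exact ⟨by simp, by tauto⟩

theorem run_weights {T : ℕ} (h : Params n K L D m) (hd : HasDigits n L T m) :
    (∀ s < L, (weights.run I m).real .weight s = segWeight n K T s) ∧
    (1 ≤ (weights.run I m).nat .ok 0 ↔ ValidCode n L D T) := by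
  rw [weights, Com.run_seq, Com.run_seq, Com.run_seq, Com.run_seq]
  set m₁ := Com.run I (.setReal .surv 0 0) (Com.run I (.setNat .ok 0 1) m) with hm₁
  have hp₁ : Params n K L D m₁ := (h.run rfl).run rfl
  have key₁ := Com.loop_induction (I := I) (x := .k) (b := .copies) (m := m₁)
    (c := .setReal .surv (NVar.k + 1) 1)
    (fun k m' => ∀ k' ≤ k, m'.real .surv k' = if k' = 0 then 0 else 1) (by
      intro k' hk'
      obtain rfl : k' = 0 := by omega
      simp [hm₁]) (by
    intro k hk m' ht f1 f2 e k' hk'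
    by_cases h1 : k' = k + 1
    · simp [h1, ht]
    · have := e k' (by omega)
      simpa [ht, h1] using this)
  rw [hp₁.copies] at key₁
  set m₂ := Com.run I (.loop .k .copies (.setReal .surv (NVar.k + 1) 1)) m₁ with hm₂
  set m₃ := Com.run I (.setNat .ptr 0 0) m₂ with hm₃
  have hp₃ : Params n K L D m₃ := (hp₁.run rfl).run rfl
  have hok₃ : m₃.nat .ok 0 = 1 := by
    rw [hm₃, Com.run_nat_frame I _ _ _ rfl, hm₂, Com.run_nat_frame I _ _ _ rfl, hm₁,
      Com.run_nat_frame I _ _ _ rfl]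
    simp
  have hd₃ : HasDigits n L T m₃ := by
    intro d hd'
    rw [hm₃, Com.run_nat_frame I _ _ _ rfl, hm₂, Com.run_nat_frame I _ _ _ rfl, hm₁,
      Com.run_nat_frame I _ _ _ rfl, Com.run_nat_frame I _ _ _ rfl, hd d hd']
  have hs₃ : HasSurv n K T 0 m₃ := by
    intro k hk
    have := key₁ k hk
    cases k with
    | zero => simpa [hm₃, segWeight] using this
    | succ k => simpa [hm₃, segWeight] using this
  have key := Com.loop_induction (I := I) (x := .s) (b := .segs) (m := m₃) (c := segStep)
    (fun s m' => HasSurv n K T s m' ∧ (∀ s' < s, m'.real .weight s' = segWeight n K T s') ∧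
      (1 ≤ m'.nat .ok 0 ↔ ValidCode n s D T))
    ⟨fun k hk => by simpa using hs₃ k hk, by simp, by simp [hok₃, ValidCode]⟩ (by
    intro s hs m' hs' f1 f2 ⟨e1, e2, e3⟩
    have hp' : Params n K L D m' := hp₃.loop f1 f2 (b := .segs) rfl
    rw [hp₃.segs] at hs
    have hd' : HasDigits n L T m' := by
      intro d hd'
      rw [f1 _ rfl (by decide), hd₃ d hd']
    rw [segStep, Com.run_seq, Com.run_seq, Com.run_seq, Com.run_seq]
    set a₁ := Com.run I (.setReal .weight NVar.s (.get .surv (NVar.ptr + NVar.copies))) m' with ha₁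
    set a₂ := segMass.run I a₁ with ha₂
    set a₃ := nextSurv.run I a₂ with ha₃
    set a₄ := Com.run I (.setNat .ptr 0 (NVar.ptr + NVar.copies + 1)) a₃ with ha₄
    have q₁ : Params n K L D a₁ := hp'.run rfl
    have q₂ : Params n K L D a₂ := q₁.run rfl
    have q₃ : Params n K L D a₃ := q₂.run rfl
    have q₄ : Params n K L D a₄ := q₃.run rfl
    have n₁ : ∀ v, a₁.nat v = m'.nat v := fun v => by rw [ha₁, Com.run_nat_frame I _ _ _ rfl]
    have n₂ : ∀ v, v ≠ .t → a₂.nat v = m'.nat v := fun v hv => by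
      rw [ha₂, Com.run_nat_frame I _ _ _ (by simp [segMass, Com.setsNat, hv.symm]), n₁]
    have n₃ : ∀ v, v ≠ .t → v ≠ .k → a₃.nat v = m'.nat v := fun v hv hv' => by
      rw [ha₃, Com.run_nat_frame I _ _ _ (by simp [nextSurv, Com.setsNat, hv'.symm]), n₂ v hv]
    have n₄ : ∀ v, v ≠ .t → v ≠ .k → v ≠ .ptr → a₄.nat v = m'.nat v := fun v h1 h2 h3 => by
      rw [ha₄, Com.run_nat_frame I _ _ _ (by simp [Com.setsNat, h3.symm]), n₃ v h1 h2]
    have hsurv₂ : HasSurv n K T s a₂ := by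
      intro k hk
      rw [n₂ _ (by decide), ha₂, Com.run_real_frame I _ _ _ rfl, ha₁,
        Com.run_real_frame I _ _ _ rfl, e1 k hk]
    have hmass := run_segMass (I := I) (T := T) (s := s) q₁ (fun d hd => by
      rw [n₁, hd' d hd]) (by rw [n₁, hs']) hs
    have hnext := run_nextSurv (I := I) q₂ hsurv₂ (by
      rw [ha₂]
      exact hmass)
    rw [← ha₃] at hnext
    have hcheck := run_checkSeg (I := I) (T := T) (s := s) q₄ (fun d hd => by
      rw [n₄ _ (by decide) (by decide) (by decide), hd' d hd])
      (by rw [n₄ _ (by decide) (by decide) (by decide), hs']) hs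
    rw [n₄ .ok (by decide) (by decide) (by decide)] at hcheck
    have hw : ∀ s', (checkSeg.run I a₄).real .weight s' =
        if s' = s then segWeight n K T s else m'.real .weight s' := by
      intro s'
      rw [Com.run_real_frame I _ _ _ rfl, ha₄, Com.run_real_frame I _ _ _ rfl, ha₃,
        Com.run_real_frame I _ _ _ rfl, ha₂, Com.run_real_frame I _ _ _ rfl, ha₁]
      have := e1 K le_rfl
      simp [hs', hp'.copies, this]
    have hvalid : ValidCode n (s + 1) D T ↔ ValidCode n s D T ∧
        (T / codeBase n ^ (s + s + 1) % codeBase n ≤ 1 ∨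
          T / codeBase n ^ (s + s) % codeBase n * D ≤ 10 * n ^ 2) := by
      constructor
      · exact fun h => ⟨fun s' hs' => h s' (by omega), h s (by omega)⟩
      · rintro ⟨h1, h2⟩ s' hs'
        rcases Nat.lt_succ_iff_lt_or_eq.1 hs' with h | rfl
        exacts [h1 s' h, h2]
    refine ⟨?_, ?_, ?_⟩
    · intro k hk
      have r1 : ((checkSeg.run I a₄).setNat .s 0 (s + 1)).nat .ptr 0 = m'.nat .ptr 0 + K + 1 := by
        simp only [Mem.nat_setNat]
        rw [Com.run_nat_frame I .ptr checkSeg a₄ rfl, ha₄]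
        simp [q₃.copies, n₃]
      have r2 : ((checkSeg.run I a₄).setNat .s 0 (s + 1)).real .surv = a₃.real .surv := by
        rw [Mem.real_setNat, Com.run_real_frame I _ _ _ rfl, ha₄, Com.run_real_frame I _ _ _ rfl]
      rw [r1, r2, ← hnext k hk, n₂ _ (by decide)]
    · intro s' hs''
      rw [Mem.real_setNat, hw]
      split_ifs with h
      · rw [h]
      · exact e2 s' (by omega)
    · rw [hvalid, ← e3]
      simp only [Mem.nat_setNat]
      rcases hcheck with ⟨h1, h2⟩ | ⟨h1, h2⟩
      · simp [h1, h2]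
      · simp [h1, h2])
  rw [hp₃.segs] at key
  exact key.2

end PostedPrice

/-! ### Correctness of the table -/

namespace PostedPrice

open RealRAM Prog

variable {n : ℕ} {A : Auction n} {K L D : ℕ} {I : Input} {m m' : Mem}

/-- The input tapes hold the auction. -/
structure IsInput (A : Auction n) (I : Input) : Prop where
  supp : ∀ i : Fin n, I.nat (i + 2) = A.supp i
  val : ∀ (i : Fin n) (j : Fin (A.supp i)),
    I.real (offset A i + j + (offset A i + j) + 1) = A.val i j
  prob : ∀ (i : Fin n) (j : Fin (A.supp i)),
    I.real (offset A i + j + (offset A i + j) + 2) = A.prob i j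

theorem run_optionData (h : Params n K L D m) (hA : A.OnGrid) (hn : 1 ≤ n) (hI : IsInput A I)
    {i : Fin n} {j : Fin (A.supp i)} {s : ℕ} {w : ℝ} (hs : s < L) (hmi : m.nat .i 0 = i)
    (hmj : m.nat .j 0 = j) (hms : m.nat .s 0 = s) (hoff : m.nat .off 0 = offset A i)
    (hw : m.real .weight s = w) :
    (optionData.run I m).nat .cost 0 = pointCost s (⟨i, j⟩ : Point A) ∧
      (optionData.run I m).real .gain 0 = pointGain w (⟨i, j⟩ : Point A) := by
  set e : Point A := ⟨i, j⟩ with he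
  rw [optionData, Com.run_seq, Com.run_seq, Com.run_seq, Com.run_seq, Com.run_seq]
  -- The acceptance probability.
  set m₁ := Com.run I (.setReal .prob 0 0) m with hm₁
  have hp₁ : Params n K L D m₁ := h.run rfl
  let g : ℕ → ℝ := fun t => if ht : t < A.supp i then
    if A.val i j ≤ A.val i ⟨t, ht⟩ then A.prob i ⟨t, ht⟩ else 0 else 0
  have key₁ := Com.loop_induction (I := I) (x := .t) (b := .units) (m := m₁)
    (c := .ite (NVar.t + 1 ≼ .inp (NVar.i + 2))
      (.ite (valueAt (NVar.off + NVar.j) ≼ᵣ valueAt (NVar.off + NVar.t))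
        (.setReal .prob 0 (RVar.prob + probAt (NVar.off + NVar.t))) .skip) .skip)
    (fun k m' => m'.real .prob 0 = ∑ t ∈ Finset.range k, g t) (by simp [hm₁]) (by
    intro t ht m' hmt f1 f2 e1
    have e2 : m'.nat .i 0 = i := by rw [f1 _ rfl (by decide), hm₁]; exact hmi
    have e3 : m'.nat .j 0 = j := by rw [f1 _ rfl (by decide), hm₁]; exact hmj
    have e4 : m'.nat .off 0 = offset A i := by rw [f1 _ rfl (by decide), hm₁]; exact hoff
    rw [Finset.sum_range_succ, ← e1]
    by_cases h1 : t < A.supp i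
    · rw [Com.run_ite_pos (by simpa [hmt, e2, hI.supp] using h1)]
      have hv := hI.val i ⟨t, h1⟩
      have hq := hI.prob i ⟨t, h1⟩
      simp only at hv hq
      by_cases h2 : A.val i j ≤ A.val i ⟨t, h1⟩
      · rw [Com.run_ite_pos (by simpa [valueAt, hmt, e3, e4, hI.val, hv] using h2)]
        simp [probAt, hmt, e4, hq, g, h1, h2]
      · rw [Com.run_ite_neg (by simpa [valueAt, hmt, e3, e4, hI.val, hv] using h2)]
        simp [g, h1, h2]
    · rw [Com.run_ite_neg (by simpa [hmt, e2, hI.supp] using h1)]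
      simp [g, h1])
  rw [hp₁.units] at key₁
  have hsum : ∑ t ∈ Finset.range (10 * n ^ 2), g t = e.offer.1 := by
    have h1 : ∑ t ∈ Finset.range (A.supp i), g t = ∑ t ∈ Finset.range (10 * n ^ 2), g t := by
      refine Finset.sum_subset (Finset.range_mono (supp_le hA hn i)) fun t _ ht => ?_
      simp only [Finset.mem_range] at ht
      simp [g, ht]
    rw [← h1, Finset.sum_range]
    refine Finset.sum_congr rfl fun t _ => ?_
    simp only [g, t.2, dif_pos]
    rfl
  rw [hsum] at key₁
  set m₂ := Com.run I (.loop .t .units _) m₁ with hm₂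
  -- The cost, by counting up to the acceptance probability.
  set m₃ := Com.run I (.setReal .cnt 0 0)
    (Com.run I (.setNat .cost 0 (.get .pow (NVar.s + NVar.s + 1))) m₂) with hm₃
  have hp₂ : Params n K L D m₂ := hp₁.run rfl
  have hp₃ : Params n K L D m₃ := (hp₂.run rfl).run rfl
  have n₂ : ∀ v, v ≠ .t → m₂.nat v = m.nat v := fun v hv => by
    rw [hm₂, Com.run_nat_frame I _ _ _ (by simp [Com.setsNat, hv.symm]), hm₁]
    rfl
  have n₃ : ∀ v, v ≠ .t → v ≠ .cost → m₃.nat v = m.nat v := fun v hv hv' => by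
    rw [hm₃, Com.run_nat_frame I _ _ _ rfl,
      Com.run_nat_frame I _ _ _ (by simp [Com.setsNat, hv'.symm]), n₂ v hv]
  have hprob₃ : m₃.real .prob 0 = e.offer.1 := by
    rw [hm₃, Com.run_real_frame I _ _ _ rfl, Com.run_real_frame I _ _ _ rfl]
    exact key₁
  have hs₂ : m₂.nat .s 0 = s := by rw [n₂ _ (by decide), hms]
  have key₃ := Com.loop_induction (I := I) (x := .t) (b := .units) (m := m₃)
    (c := .ite (RVar.cnt + 1 ≼ᵣ RVar.prob * RVar.units)
      (.setReal .cnt 0 (RVar.cnt + 1) ;;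
        .setNat .cost 0 (NVar.cost + .get .pow (NVar.s + NVar.s))) .skip)
    (fun k m' => m'.real .cnt 0 = (min k e.units : ℕ) ∧
      m'.nat .cost 0 = codeBase n ^ (s + s + 1) + min k e.units * codeBase n ^ (s + s))
    (by simp [hm₃, hs₂, hp₂.pow (s + s + 1) (by omega)]) (by
    intro t ht m' hmt f1 f2 ⟨e1, e2⟩
    have hp' : Params n K L D m' := hp₃.loop f1 f2 (b := .units) rfl
    have e3 : m'.nat .s 0 = s := by
      rw [f1 _ rfl (by decide), n₃ _ (by decide) (by decide), hms]
    have e4 : m'.real .prob 0 * m'.real .units 0 = (e.units : ℝ) := by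
      rw [hp'.realUnits, f2 _ rfl, hprob₃, e.units_eq hA hn]
    have hiff : (m'.real .cnt 0 + 1 ≤ (e.units : ℝ)) ↔ min t e.units + 1 ≤ e.units := by
      rw [e1]
      exact_mod_cast Iff.rfl
    by_cases h1 : t + 1 ≤ e.units
    · rw [show min t e.units = t by omega] at e1 e2 hiff
      rw [Com.run_ite_pos (by simpa [e4, hiff] using h1)]
      rw [show min (t + 1) e.units = t + 1 by omega]
      simp [e1, e2, e3, hp'.pow (s + s) (by omega)]
      ring
    · rw [show min t e.units = e.units by omega] at e1 e2 hiff
      rw [Com.run_ite_neg (by simp [e4, hiff])]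
      rw [show min (t + 1) e.units = e.units by omega]
      simp [e1, e2])
  rw [hp₃.units, min_eq_right e.units_le] at key₃
  set m₄ := Com.run I (.loop .t .units _) m₃ with hm₄
  have n₄ : ∀ v, v ≠ .t → v ≠ .cost → m₄.nat v = m.nat v := fun v hv hv' => by
    rw [hm₄, Com.run_nat_frame I _ _ _ (by simp [Com.setsNat, hv.symm, hv'.symm]), n₃ v hv hv']
  have r₄ : ∀ v, v ≠ .prob → v ≠ .cnt → m₄.real v = m.real v := fun v hv hv' => by
    rw [hm₄, Com.run_real_frame I _ _ _ (by simp [Com.setsReal, hv'.symm]), hm₃,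
      Com.run_real_frame I _ _ _ (by simp [Com.setsReal, hv'.symm]),
      Com.run_real_frame I _ _ _ rfl, hm₂,
      Com.run_real_frame I _ _ _ (by simp [Com.setsReal, hv.symm]), hm₁,
      Com.run_real_frame I _ _ _ (by simp [Com.setsReal, hv.symm])]
  constructor
  · rw [Com.run_nat_frame I _ _ _ rfl, key₃.2, pointCost]
    ring
  · have hprob₄ : m₄.real .prob 0 = e.offer.1 := by
      rw [hm₄, Com.run_real_frame I _ _ _ rfl, hprob₃]
    have hw₄ : m₄.real .weight s = w := by rw [r₄ _ (by decide) (by decide), hw]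
    have hx₄ : e.offer.2 = A.val i j := rfl
    simp [n₄, hms, hoff, hmj, hprob₄, hw₄, valueAt, hI.val, pointGain, hx₄]

/-- The table and the recorded choices agree at position `p`. -/
def SameCell (m m' : Mem) (p : ℕ) : Prop :=
  m'.real .table p = m.real .table p ∧ m'.real .chPrice p = m.real .chPrice p ∧
    m'.nat .chSeg p = m.nat .chSeg p ∧ m'.nat .chCost p = m.nat .chCost p

theorem SameCell.trans {m'' : Mem} {p : ℕ} (h : SameCell m m' p) (h' : SameCell m' m'' p) :
    SameCell m m'' p :=
  ⟨h'.1.trans h.1, h'.2.1.trans h.2.1, h'.2.2.1.trans h.2.2.1, h'.2.2.2.trans h.2.2.2⟩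

theorem SameCell.of_eq {p : ℕ} (h1 : m'.real .table = m.real .table)
    (h2 : m'.real .chPrice = m.real .chPrice) (h3 : m'.nat .chSeg = m.nat .chSeg)
    (h4 : m'.nat .chCost = m.nat .chCost) : SameCell m m' p :=
  ⟨by rw [h1], by rw [h2], by rw [h3], by rw [h4]⟩

/-- Exactly those entries of the next row are overwritten that are improved by the option. The
entries below `0` mark codes that cannot be attained, and are never extended. -/
theorem run_relax (h : Params n K L D m) {R C q s : ℕ} {g x : ℝ}
    (hC : C = codeBase n ^ (2 * L))
    (hR : m.nat .row 0 = R) (hq : m.nat .cost 0 = q) (hg : m.real .gain 0 = g)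
    (hs : m.nat .s 0 = s) (hx : (valueAt (NVar.off + NVar.j)).eval I m = x) :
    (∀ p < R + C, SameCell m (relax.run I m) p) ∧
    ∀ c < C,
      ((q ≤ c ∧ 0 ≤ m.real .table (R + (c - q)) ∧
          m.real .table (R + C + c) ≤ m.real .table (R + (c - q)) + g) ∧
        (relax.run I m).real .table (R + C + c) = m.real .table (R + (c - q)) + g ∧
        (relax.run I m).real .chPrice (R + C + c) = x ∧
        (relax.run I m).nat .chSeg (R + C + c) = s + 1 ∧
        (relax.run I m).nat .chCost (R + C + c) = q) ∨
      (¬ (q ≤ c ∧ 0 ≤ m.real .table (R + (c - q)) ∧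
          m.real .table (R + C + c) ≤ m.real .table (R + (c - q)) + g) ∧
        SameCell m (relax.run I m) (R + C + c)) := by
  have key := Com.loop_induction (I := I) (x := .c) (b := .codes) (m := m)
    (c := .ite (NVar.cost ≼ NVar.c)
      (.ite (0 ≼ᵣ .get .table (NVar.row + (NVar.c - NVar.cost)))
        (.ite (.get .table (NVar.row + NVar.codes + NVar.c) ≼ᵣ
            .get .table (NVar.row + (NVar.c - NVar.cost)) + RVar.gain)
          (.setReal .table (NVar.row + NVar.codes + NVar.c)
              (.get .table (NVar.row + (NVar.c - NVar.cost)) + RVar.gain) ;;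
            .setReal .chPrice (NVar.row + NVar.codes + NVar.c) (valueAt (NVar.off + NVar.j)) ;;
            .setNat .chSeg (NVar.row + NVar.codes + NVar.c) (NVar.s + 1) ;;
            .setNat .chCost (NVar.row + NVar.codes + NVar.c) NVar.cost)
          .skip) .skip) .skip)
    (fun k m' => (∀ p < R + C, SameCell m m' p) ∧
      (∀ c, k ≤ c → SameCell m m' (R + C + c)) ∧
      ∀ c < k,
      ((q ≤ c ∧ 0 ≤ m.real .table (R + (c - q)) ∧
          m.real .table (R + C + c) ≤ m.real .table (R + (c - q)) + g) ∧
        m'.real .table (R + C + c) = m.real .table (R + (c - q)) + g ∧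
        m'.real .chPrice (R + C + c) = x ∧
        m'.nat .chSeg (R + C + c) = s + 1 ∧
        m'.nat .chCost (R + C + c) = q) ∨
      (¬ (q ≤ c ∧ 0 ≤ m.real .table (R + (c - q)) ∧
          m.real .table (R + C + c) ≤ m.real .table (R + (c - q)) + g) ∧
        SameCell m m' (R + C + c)))
    ⟨fun p _ => .of_eq rfl rfl rfl rfl, fun p _ => .of_eq rfl rfl rfl rfl, by simp⟩ (by
    intro c hc m' hmc f1 f2 ⟨e1, e2, e3⟩
    rw [h.codes, ← hC] at hc
    have hp' : Params n K L D m' := h.loop f1 f2 (b := .codes) rfl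
    have a1 : m'.nat .row 0 = R := by rw [f1 _ rfl (by decide), hR]
    have a2 : m'.nat .cost 0 = q := by rw [f1 _ rfl (by decide), hq]
    have a3 : m'.real .gain 0 = g := by rw [f2 _ rfl, hg]
    have a4 : m'.nat .s 0 = s := by rw [f1 _ rfl (by decide), hs]
    have a5 : m'.nat .codes 0 = C := by rw [hp'.codes, hC]
    have a6 : m'.nat .off 0 = m.nat .off 0 := by rw [f1 _ rfl (by decide)]
    have a7 : m'.nat .j 0 = m.nat .j 0 := by rw [f1 _ rfl (by decide)]
    have b1 : m'.real .table (R + (c - q)) = m.real .table (R + (c - q)) :=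
      (e1 _ (by omega)).1
    have b2 : m'.real .table (R + C + c) = m.real .table (R + C + c) := (e2 c le_rfl).1
    -- If the cell is not improved, nothing happens.
    have hskip : ¬ (q ≤ c ∧ 0 ≤ m.real .table (R + (c - q)) ∧
        m.real .table (R + C + c) ≤ m.real .table (R + (c - q)) + g) →
        (∀ p < R + C, SameCell m (m'.setNat .c 0 (c + 1)) p) ∧
        (∀ c', c + 1 ≤ c' → SameCell m (m'.setNat .c 0 (c + 1)) (R + C + c')) ∧
        ∀ c' < c + 1,
        ((q ≤ c' ∧ 0 ≤ m.real .table (R + (c' - q)) ∧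
            m.real .table (R + C + c') ≤ m.real .table (R + (c' - q)) + g) ∧
          (m'.setNat .c 0 (c + 1)).real .table (R + C + c') = m.real .table (R + (c' - q)) + g ∧
          (m'.setNat .c 0 (c + 1)).real .chPrice (R + C + c') = x ∧
          (m'.setNat .c 0 (c + 1)).nat .chSeg (R + C + c') = s + 1 ∧
          (m'.setNat .c 0 (c + 1)).nat .chCost (R + C + c') = q) ∨
        (¬ (q ≤ c' ∧ 0 ≤ m.real .table (R + (c' - q)) ∧
            m.real .table (R + C + c') ≤ m.real .table (R + (c' - q)) + g) ∧
          SameCell m (m'.setNat .c 0 (c + 1)) (R + C + c')) := by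
      intro hno
      refine ⟨fun p hp => e1 p hp, fun c' hc' => e2 c' (by omega), fun c' hc' => ?_⟩
      rcases Nat.lt_succ_iff_lt_or_eq.1 hc' with h1 | rfl
      · exact e3 c' h1
      · exact Or.inr ⟨hno, e2 c' le_rfl⟩
    by_cases h1 : q ≤ c
    swap
    · rw [Com.run_ite_neg (by simpa [a2, hmc] using h1)]
      exact hskip fun h => h1 h.1
    rw [Com.run_ite_pos (by simpa [a2, hmc] using h1)]
    by_cases h2 : 0 ≤ m.real .table (R + (c - q))
    swap
    · rw [Com.run_ite_neg (by simpa [a1, a2, hmc, b1] using h2)]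
      exact hskip fun h => h2 h.2.1
    rw [Com.run_ite_pos (by simpa [a1, a2, hmc, b1] using h2)]
    by_cases h3 : m.real .table (R + C + c) ≤ m.real .table (R + (c - q)) + g
    swap
    · rw [Com.run_ite_neg (by simpa [a1, a2, a3, a5, hmc, b1, b2] using h3)]
      exact hskip fun h => h3 h.2.2
    rw [Com.run_ite_pos (by simpa [a1, a2, a3, a5, hmc, b1, b2] using h3)]
    have hx' : ∀ m'' : Mem, m''.nat = m'.nat →
        (valueAt (NVar.off + NVar.j)).eval I m'' = x := by
      intro m'' hm''
      rw [← hx]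
      simp [valueAt, hm'', a6, a7]
    have hother : ∀ p, p ≠ R + C + c → SameCell m' ((Com.run I
        (.setReal .table (NVar.row + NVar.codes + NVar.c)
              (.get .table (NVar.row + (NVar.c - NVar.cost)) + RVar.gain) ;;
            .setReal .chPrice (NVar.row + NVar.codes + NVar.c) (valueAt (NVar.off + NVar.j)) ;;
            .setNat .chSeg (NVar.row + NVar.codes + NVar.c) (NVar.s + 1) ;;
            .setNat .chCost (NVar.row + NVar.codes + NVar.c) NVar.cost) m').setNat .c 0 (c + 1)) p := by
      intro p hp
      refine ⟨?_, ?_, ?_, ?_⟩ <;> simp [a1, a5, hmc, hp]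
    refine ⟨fun p hp => (e1 p hp).trans (hother p (by omega)),
      fun c' hc' => (e2 c' (by omega)).trans (hother _ (by omega)), fun c' hc' => ?_⟩
    rcases Nat.lt_succ_iff_lt_or_eq.1 hc' with h4 | rfl
    · rcases e3 c' h4 with ⟨i1, i2, i3, i4, i5⟩ | ⟨i1, i2⟩
      · obtain ⟨j1, j2, j3, j4⟩ := hother (R + C + c') (by omega)
        exact Or.inl ⟨i1, j1.trans i2, j2.trans i3, j3.trans i4, j4.trans i5⟩
      · exact Or.inr ⟨i1, i2.trans (hother _ (by omega))⟩
    · refine Or.inl ⟨⟨h1, h2, h3⟩, ?_, ?_, ?_, ?_⟩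
      · simp [a1, a2, a3, a5, hmc, b1]
      · simp only [Com.run_seq, Com.run_setNat, Com.run_setReal, Mem.real_setNat,
          Mem.real_setReal]
        simp [a1, a5, hmc]
        exact hx' _ rfl
      · simp [a1, a4, a5, hmc]
      · simp [a1, a2, a5, hmc])
  rw [h.codes, ← hC] at key
  exact ⟨key.1, key.2.2⟩

theorem run_copyRow (h : Params n K L D m) {R C : ℕ} (hC : C = codeBase n ^ (2 * L))
    (hR : m.nat .row 0 = R) :
    (∀ p < R + C, SameCell m (copyRow.run I m) p) ∧
    ∀ c < C, (copyRow.run I m).real .table (R + C + c) = m.real .table (R + c) ∧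
      (copyRow.run I m).nat .chSeg (R + C + c) = 0 ∧
      (copyRow.run I m).nat .chCost (R + C + c) = 0 := by
  have key := Com.loop_induction (I := I) (x := .c) (b := .codes) (m := m)
    (c := .setReal .table (NVar.row + NVar.codes + NVar.c) (.get .table (NVar.row + NVar.c)) ;;
      .setNat .chSeg (NVar.row + NVar.codes + NVar.c) 0 ;;
      .setNat .chCost (NVar.row + NVar.codes + NVar.c) 0)
    (fun k m' => (∀ p < R + C, SameCell m m' p) ∧
      ∀ c < k, m'.real .table (R + C + c) = m.real .table (R + c) ∧
        m'.nat .chSeg (R + C + c) = 0 ∧ m'.nat .chCost (R + C + c) = 0)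
    ⟨fun p _ => .of_eq rfl rfl rfl rfl, by simp⟩ (by
    intro c hc m' hmc f1 f2 ⟨e1, e2⟩
    rw [h.codes, ← hC] at hc
    have hp' : Params n K L D m' := h.loop f1 f2 (b := .codes) rfl
    have a1 : m'.nat .row 0 = R := by rw [f1 _ rfl (by decide), hR]
    have a5 : m'.nat .codes 0 = C := by rw [hp'.codes, hC]
    have b1 := (e1 (R + c) (by omega)).1
    constructor
    · intro p hp
      have hne : p ≠ R + C + c := by omega
      refine (e1 p hp).trans ⟨?_, ?_, ?_, ?_⟩ <;> simp [a1, a5, hmc, hne]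
    · intro c' hc'
      by_cases hcc : c' = c
      · subst hcc
        simp [a1, a5, hmc, b1]
      · have := e2 c' (by omega)
        simpa [a1, a5, hmc, hcc] using this)
  rw [h.codes, ← hC] at key
  exact key

/-- The segment number `sg` (`0` for none) and the price `x` describe the choice `o` for
buyer `i`. -/
def Describes (i : Fin n) (o : Option (Fin L × Fin (A.supp i))) (sg : ℕ) (x : ℝ) : Prop :=
  sg = o.elim 0 (fun y => (y.1 : ℕ) + 1) ∧ ∀ y, o = some y → x = A.val i y.2

/-- The entry of row `i + 1` of the table at `c` is accounted for by the recorded choice for buyer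
`i`. -/
def Recorded (A : Auction n) (L : ℕ) (w : ℕ → ℝ) (C : ℕ) (i : Fin n) (c : ℕ) (m : Mem) : Prop :=
  ∃ o : Option (Fin L × Fin (A.supp i)), optCost i o ≤ c ∧
    m.nat .chCost (i * C + C + c) = optCost i o ∧
    m.real .table (i * C + C + c) = m.real .table (i * C + (c - optCost i o)) + optGain w i o ∧
    (0 ≤ m.real .table (i * C + C + c) → 0 ≤ m.real .table (i * C + (c - optCost i o))) ∧
    Describes i o (m.nat .chSeg (i * C + C + c)) (m.real .chPrice (i * C + C + c))

/-- Row `i + 1` of the table is as good as the choices in `done` for buyer `i` allow. -/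
def RowInv (A : Auction n) (L : ℕ) (w : ℕ → ℝ) (C : ℕ) (i : Fin n)
    (done : Fin L → Fin (A.supp i) → Prop) (m : Mem) : Prop :=
  ∀ c < C, m.real .table (i * C + c) ≤ m.real .table (i * C + C + c) ∧
    (∀ s j, done s j → pointCost s (⟨i, j⟩ : Point A) ≤ c →
      0 ≤ m.real .table (i * C + (c - pointCost s (⟨i, j⟩ : Point A))) →
      m.real .table (i * C + (c - pointCost s (⟨i, j⟩ : Point A))) +
        pointGain (w s) (⟨i, j⟩ : Point A) ≤ m.real .table (i * C + C + c)) ∧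
    Recorded A L w C i c m

theorem RowInv.mono {w : ℕ → ℝ} {C : ℕ} {i : Fin n} {P Q : Fin L → Fin (A.supp i) → Prop}
    (h : RowInv A L w C i P m) (hPQ : ∀ s j, Q s j → P s j) : RowInv A L w C i Q m :=
  fun c hc => ⟨(h c hc).1, fun s j hQ => (h c hc).2.1 s j (hPQ s j hQ), (h c hc).2.2⟩

theorem RowInv.congr {w : ℕ → ℝ} {C : ℕ} {i : Fin n} {P : Fin L → Fin (A.supp i) → Prop}
    (h : RowInv A L w C i P m) (hm : ∀ p < i * C + C + C, SameCell m m' p) :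
    RowInv A L w C i P m' := by
  intro c hc
  obtain ⟨h1, h2, o, o1, o2, o3, o4, o5⟩ := h c hc
  obtain ⟨c1, c2, c3, c4⟩ := hm (i * C + C + c) (by omega)
  have d : ∀ q, m'.real .table (i * C + (c - q)) = m.real .table (i * C + (c - q)) :=
    fun q => (hm _ (by omega)).1
  refine ⟨?_, ?_, o, o1, ?_, ?_, ?_, ?_⟩
  · rw [c1, (hm _ (by omega)).1]
    exact h1
  · intro s j
    rw [c1, d]
    exact h2 s j
  · rw [c4, o2]
  · rw [c1, d, o3]
  · rw [c1, d]
    exact o4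
  · rw [c2, c3]
    exact o5

/-- An improvement step by one option for buyer `i` preserves the invariant. -/
theorem RowInv.relax {w : ℕ → ℝ} {C : ℕ} {i : Fin n} {P : Fin L → Fin (A.supp i) → Prop}
    (h : Params n K L D m) (hC : C = codeBase n ^ (2 * L)) (hinv : RowInv A L w C i P m)
    {s : Fin L} {j : Fin (A.supp i)}
    (hR : m.nat .row 0 = i * C) (hq : m.nat .cost 0 = pointCost s (⟨i, j⟩ : Point A))
    (hg : m.real .gain 0 = pointGain (w s) (⟨i, j⟩ : Point A))
    (hs : m.nat .s 0 = s) (hx : (valueAt (NVar.off + NVar.j)).eval I m = A.val i j) :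
    (∀ p < i * C + C, SameCell m (Prog.relax.run I m) p) ∧
    RowInv A L w C i (fun s' j' => P s' j' ∨ (s' = s ∧ j' = j)) (Prog.relax.run I m) := by
  obtain ⟨hlow, hrow⟩ := run_relax (I := I) h hC hR hq hg hs hx
  refine ⟨hlow, fun c hc => ?_⟩
  obtain ⟨h1, h2, o, o1, o2, o3, o4, o5⟩ := hinv c hc
  set q := pointCost s (⟨i, j⟩ : Point A) with hqdef
  set g := pointGain (w s) (⟨i, j⟩ : Point A) with hgdef
  set m' := Prog.relax.run I m
  have d : ∀ c' < C, m'.real .table (i * C + c') = m.real .table (i * C + c') :=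
    fun c' hc' => (hlow _ (by omega)).1
  have d' : ∀ q', m'.real .table (i * C + (c - q')) = m.real .table (i * C + (c - q')) :=
    fun q' => d _ (by omega)
  rcases hrow c hc with ⟨⟨i1, i2, i3⟩, i4, i5, i6, i7⟩ | ⟨hno, c1, c2, c3, c4⟩
  · refine ⟨?_, ?_, some (s, j), i1, i7, ?_, ?_, ?_⟩
    · rw [d c hc, i4]
      exact h1.trans i3
    · rintro s' j' (hP | ⟨rfl, rfl⟩)
      · rw [d', i4]
        exact fun a b => (h2 s' j' hP a b).trans i3
      · rw [d', i4]
        exact fun a b => le_rfl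
    · rw [i4, d']
      rfl
    · rw [i4, d']
      exact fun _ => i2
    · rw [i5, i6]
      refine ⟨rfl, ?_⟩
      rintro y hy
      cases hy
      rfl
  · refine ⟨?_, ?_, o, o1, ?_, ?_, ?_, ?_⟩
    · rw [d c hc, c1]
      exact h1
    · rintro s' j' (hP | ⟨rfl, rfl⟩)
      · rw [d', c1]
        exact h2 s' j' hP
      · rw [d', c1]
        intro a b
        by_contra hlt
        exact hno ⟨a, b, le_of_not_ge hlt⟩
    · rw [c4, o2]
    · rw [c1, d', o3]
    · rw [c1, d']
      exact o4
    · rw [c2, c3]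
      exact o5

theorem run_tryOptions (h : Params n K L D m) (hA : A.OnGrid) (hn : 1 ≤ n) (hI : IsInput A I)
    {w : ℕ → ℝ} {C : ℕ} (hC : C = codeBase n ^ (2 * L)) {i : Fin n}
    (hw : ∀ s < L, m.real .weight s = w s) (hmi : m.nat .i 0 = i) (hR : m.nat .row 0 = i * C)
    (hoff : m.nat .off 0 = offset A i) (hinv : RowInv A L w C i (fun _ _ => False) m) :
    (∀ p < i * C + C, SameCell m (tryOptions.run I m) p) ∧
    RowInv A L w C i (fun _ _ => True) (tryOptions.run I m) := by
  have key := Com.loop_induction (I := I) (x := .s) (b := .segs) (m := m)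
    (c := .loop .j .units
      (.ite (NVar.j + 1 ≼ .inp (NVar.i + 2)) (optionData ;; Prog.relax) .skip))
    (fun s m' => (∀ p < i * C + C, SameCell m m' p) ∧
      RowInv A L w C i (fun s' _ => (s' : ℕ) < s) m')
    ⟨fun p _ => .of_eq rfl rfl rfl rfl, by
      refine (hinv.mono ?_).congr (fun p _ => .of_eq rfl rfl rfl rfl)
      simp⟩ (by
    intro s hs m₁ hms f1 f2 ⟨e1, e2⟩
    rw [h.segs] at hs
    have hp₁ : Params n K L D m₁ := h.loop f1 f2 (b := .segs) rfl
    have key₂ := Com.loop_induction (I := I) (x := .j) (b := .units) (m := m₁)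
      (c := .ite (NVar.j + 1 ≼ .inp (NVar.i + 2)) (optionData ;; Prog.relax) .skip)
      (fun j m' => (∀ p < i * C + C, SameCell m m' p) ∧
        RowInv A L w C i (fun s' j' => (s' : ℕ) < s ∨ ((s' : ℕ) = s ∧ (j' : ℕ) < j)) m')
      ⟨fun p hp => (e1 p hp).trans (.of_eq rfl rfl rfl rfl), by
        refine (e2.mono ?_).congr (fun p _ => .of_eq rfl rfl rfl rfl)
        simp⟩ (by
      intro j hj m₂ hmj g1 g2 ⟨e3, e4⟩
      have hp₂ : Params n K L D m₂ := hp₁.loop g1 g2 (b := .units) rfl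
      have a1 : m₂.nat .i 0 = i := by rw [g1 _ rfl (by decide), f1 _ rfl (by decide), hmi]
      have a2 : m₂.nat .row 0 = i * C := by rw [g1 _ rfl (by decide), f1 _ rfl (by decide), hR]
      have a3 : m₂.nat .off 0 = offset A i := by
        rw [g1 _ rfl (by decide), f1 _ rfl (by decide), hoff]
      have a4 : m₂.nat .s 0 = s := by rw [g1 _ rfl (by decide), hms]
      have a5 : m₂.real .weight s = w s := by rw [g2 _ rfl, f2 _ rfl, hw s hs]
      by_cases h1 : j < A.supp i
      · rw [Com.run_ite_pos (by simpa [hmj, a1, hI.supp] using h1), Com.run_seq]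
        obtain ⟨o1, o2⟩ := run_optionData hp₂ hA hn hI (j := ⟨j, h1⟩) hs a1 hmj a4 a3 a5
        set m₃ := optionData.run I m₂ with hm₃
        have hp₃ : Params n K L D m₃ := hp₂.run rfl
        have n₃ : ∀ v, optionData.setsNat v = false → m₃.nat v = m₂.nat v :=
          fun v hv => Com.run_nat_frame I v _ _ hv
        have r₃ : ∀ v, optionData.setsReal v = false → m₃.real v = m₂.real v :=
          fun v hv => Com.run_real_frame I v _ _ hv
        have hsame : ∀ p, SameCell m₂ m₃ p :=
          fun p => .of_eq (r₃ _ rfl) (r₃ _ rfl) (n₃ _ rfl) (n₃ _ rfl)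
        obtain ⟨l1, l2⟩ := RowInv.relax (I := I) hp₃ hC (e4.congr fun p _ => hsame p)
          (s := ⟨s, hs⟩) (j := ⟨j, h1⟩) (by rw [n₃ _ rfl, a2]) o1 o2 (by rw [n₃ _ rfl, a4]) (by
            have := hI.val i ⟨j, h1⟩
            simp only at this
            simp [valueAt, n₃ .off rfl, n₃ .j rfl, a3, hmj, this])
        constructor
        · exact fun p hp => (e3 p hp).trans ((hsame p).trans ((l1 p hp).trans
            (.of_eq rfl rfl rfl rfl)))
        · refine (l2.mono ?_).congr fun p _ => .of_eq rfl rfl rfl rfl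
          rintro s' j' (h2 | ⟨h2, h3⟩)
          · exact Or.inl (Or.inl h2)
          · rcases Nat.lt_succ_iff_lt_or_eq.1 h3 with h3 | h3
            · exact Or.inl (Or.inr ⟨h2, h3⟩)
            · exact Or.inr ⟨Fin.ext h2, Fin.ext h3⟩
      · rw [Com.run_ite_neg (by simpa [hmj, a1, hI.supp] using h1)]
        constructor
        · exact fun p hp => (e3 p hp).trans (.of_eq rfl rfl rfl rfl)
        · refine (e4.mono ?_).congr fun p _ => .of_eq rfl rfl rfl rfl
          rintro s' j' (h2 | ⟨h2, h3⟩)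
          · exact Or.inl h2
          · exact Or.inr ⟨h2, by omega⟩)
    rw [hp₁.units] at key₂
    constructor
    · exact fun p hp => (key₂.1 p hp).trans (.of_eq rfl rfl rfl rfl)
    · refine (key₂.2.mono ?_).congr fun p _ => .of_eq rfl rfl rfl rfl
      intro s' j' h2
      rcases Nat.lt_succ_iff_lt_or_eq.1 h2 with h2 | h2
      · exact Or.inl h2
      · exact Or.inr ⟨h2, j'.2.trans_le (supp_le hA hn i)⟩)
  rw [h.segs] at key
  exact ⟨key.1, key.2.mono fun s' _ _ => s'.2⟩

/-- The rows of the table up to row `i₀` are filled in. -/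
structure IsTable (A : Auction n) (L : ℕ) (w : ℕ → ℝ) (C : ℕ) (i₀ : ℕ) (m : Mem) : Prop where
  start : ∀ c < C, m.real .table c = if c = 0 then 0 else -1
  row : ∀ i : Fin n, (i : ℕ) < i₀ → RowInv A L w C i (fun _ _ => True) m

theorem run_fillTable (h : Params n K L D m) (hA : A.OnGrid) (hn : 1 ≤ n) (hI : IsInput A I)
    {w : ℕ → ℝ} {C : ℕ} (hC : C = codeBase n ^ (2 * L))
    (hw : ∀ s < L, m.real .weight s = w s) :
    IsTable A L w C n (fillTable.run I m) ∧ (fillTable.run I m).nat .row 0 = n * C := by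
  rw [fillTable, Com.run_seq, Com.run_seq, Com.run_seq, Com.run_seq]
  have key₁ := Com.loop_induction (I := I) (x := .c) (b := .codes) (m := m)
    (c := .setReal .table NVar.c (0 - 1))
    (fun k m' => ∀ c < k, m'.real .table c = -1) (by simp) (by
    intro k hk m' hmc f1 f2 e1 c hc
    by_cases h1 : c = k
    · simp [h1, hmc]
    · simpa [hmc, h1] using e1 c (by omega))
  rw [h.codes, ← hC] at key₁
  set m₁ := Com.run I (.loop .c .codes (.setReal .table NVar.c (0 - 1))) m with hm₁
  set m₂ := Com.run I (.setNat .off 0 0) (Com.run I (.setNat .row 0 0)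
    (Com.run I (.setReal .table 0 0) m₁)) with hm₂
  have hp₂ : Params n K L D m₂ := ((((h.run rfl : Params n K L D m₁).run rfl :
    Params n K L D (Com.run I (.setReal .table 0 0) m₁)).run rfl :
    Params n K L D (Com.run I (.setNat .row 0 0) _)).run rfl)
  have hw₂ : ∀ s < L, m₂.real .weight s = w s := by
    intro s hs
    rw [hm₂, Com.run_real_frame I _ _ _ rfl, Com.run_real_frame I _ _ _ rfl,
      Com.run_real_frame I _ _ _ rfl, hm₁, Com.run_real_frame I _ _ _ rfl, hw s hs]
  have key := Com.loop_induction (I := I) (x := .i) (b := .buyers) (m := m₂)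
    (c := copyRow ;; tryOptions ;; .setNat .row 0 (NVar.row + NVar.codes) ;;
      .setNat .off 0 (NVar.off + .inp (NVar.i + 2)))
    (fun i m' => IsTable A L w C i m' ∧ m'.nat .row 0 = i * C ∧ m'.nat .off 0 = offset A i) (by
    refine ⟨⟨fun c hc => ?_, fun i hi => by omega⟩, by simp [hm₂], by simp [hm₂, offset_zero]⟩
    have := key₁ c hc
    by_cases h1 : c = 0
    · simp [hm₂, h1]
    · simpa [hm₂, h1] using this) (by
    intro i hi m' hmi f1 f2 ⟨e1, e2, e3⟩
    rw [hp₂.buyers] at hi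
    obtain ⟨i, rfl⟩ : ∃ i' : Fin n, (i' : ℕ) = i := ⟨⟨i, hi⟩, rfl⟩
    have hp' : Params n K L D m' := hp₂.loop f1 f2 (b := .buyers) rfl
    rw [Com.run_seq, Com.run_seq, Com.run_seq]
    obtain ⟨c1, c2⟩ := run_copyRow (I := I) hp' hC e2
    set a₁ := copyRow.run I m' with ha₁
    have q₁ : Params n K L D a₁ := hp'.run rfl
    have n₁ : ∀ v, copyRow.setsNat v = false → a₁.nat v = m'.nat v :=
      fun v hv => Com.run_nat_frame I v _ _ hv
    have hrow₁ : RowInv A L w C i (fun _ _ => False) a₁ := by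
      intro c hc
      obtain ⟨d1, d2, d3⟩ := c2 c hc
      have d4 := (c1 (i * C + c) (by omega)).1
      refine ⟨by rw [d4, d1], fun s j h => h.elim, none, Nat.zero_le _, d3, ?_, ?_, ?_⟩
      · rw [d1, optCost_none, optGain_none, Nat.sub_zero, d4, add_zero]
      · rw [d1, optCost_none, Nat.sub_zero, d4]
        exact id
      · exact ⟨d2, fun y hy => by cases hy⟩
    obtain ⟨t1, t2⟩ := run_tryOptions (I := I) (m := a₁) q₁ hA hn hI hC (fun s hs => by
      rw [ha₁, Com.run_real_frame I _ _ _ rfl, f2 _ rfl, hw₂ s hs]) (by rw [n₁ _ rfl, hmi])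
      (by rw [n₁ _ rfl, e2]) (by rw [n₁ _ rfl, e3]) hrow₁
    set a₂ := tryOptions.run I a₁ with ha₂
    have q₂ : Params n K L D a₂ := q₁.run rfl
    have n₂ : ∀ v, copyRow.setsNat v = false → tryOptions.setsNat v = false →
        a₂.nat v = m'.nat v :=
      fun v hv hv' => (Com.run_nat_frame I v _ _ hv').trans (n₁ v hv)
    have hlow : ∀ p < i * C + C, SameCell m' a₂ p := fun p hp => (c1 p hp).trans (t1 p hp)
    have hiC : ∀ i' : Fin n, (i' : ℕ) < i → (i' : ℕ) * C + C + C ≤ i * C + C := by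
      intro i' hi'
      have := Nat.mul_le_mul_right C (Nat.succ_le_of_lt hi')
      rw [Nat.succ_mul] at this
      omega
    refine ⟨⟨fun c hc => ?_, fun i' hi' => ?_⟩, ?_, ?_⟩
    · rw [← e1.start c hc]
      exact (hlow c (by omega)).1
    · rcases Nat.lt_succ_iff_lt_or_eq.1 hi' with h1 | h1
      · exact ((e1.row i' h1).congr fun p hp => hlow p (hp.trans_le (hiC i' h1))).congr
          fun p _ => .of_eq rfl rfl rfl rfl
      · obtain rfl : i' = i := Fin.ext h1
        exact t2.congr fun p _ => .of_eq rfl rfl rfl rfl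
    · have := n₂ .row rfl rfl
      have h5 : a₂.nat .codes 0 = C := by rw [q₂.codes, hC]
      simp [this, e2, h5, Nat.succ_mul]
    · have h1 := n₂ .off rfl rfl
      have h2 := n₂ .i rfl rfl
      simp [h1, h2, e3, hmi, hI.supp, offset_succ])
  rw [hp₂.buyers] at key
  exact ⟨key.1, key.2.1⟩

end PostedPrice

/-! ### Correctness of the search -/

namespace PostedPrice

open RealRAM Prog

variable {n : ℕ} {A : Auction n} {K L D : ℕ} {I : Input} {m m' : Mem}

theorem segWeight_nonneg (hA : A.OnGrid) (hn : 1 ≤ n) (a : Plan A L) (k s : ℕ) (hs : s ≤ L)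
    {B : ℕ} (hB : a.Valid B) (hB1 : 1 ≤ B) : 0 ≤ segWeight n k a.code s := by
  refine (surv_mem_Icc (fun q hq => ?_) k).1
  obtain ⟨s', hs', rfl⟩ := List.mem_map.1 hq
  rw [List.mem_range] at hs'
  rw [a.code_digit_mass ⟨s', by omega⟩]
  refine ⟨by positivity, ?_⟩
  have h1 := (Plan.valid_iff hA hn hB1 (fun M _ s f => (a.sum_map_seg s f).symm)).1 hB
    ⟨s', by omega⟩
  have h2 := h1.mass_le_one (by
    rw [div_le_one (by positivity)]
    exact_mod_cast hB1) (isOffer_map_offer _)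
  rwa [mass_map_offer hA hn, a.sum_map_seg] at h2

theorem pointGain_nonneg {w : ℝ} (hw : 0 ≤ w) (e : Point A) : 0 ≤ pointGain w e :=
  mul_nonneg hw (mul_nonneg e.isOffer.1 e.isOffer.2.2)

/-- The last row of the table bounds the weighted worth of all plans. -/
theorem IsTable.le {w : ℕ → ℝ} {C : ℕ} (h : IsTable A L w C n m) (hw : ∀ s < L, 0 ≤ w s)
    (a : Plan A L) (ha : a.code < C) :
    ∑ i, optGain w i (a i) ≤ m.real .table (n * C + a.code) := by
  let q : ℕ → ℕ := fun i => if h : i < n then optCost ⟨i, h⟩ (a ⟨i, h⟩) else 0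
  let g : ℕ → ℝ := fun i => if h : i < n then optGain w ⟨i, h⟩ (a ⟨i, h⟩) else 0
  have hq : ∑ i ∈ Finset.range n, q i = a.code := by
    rw [Finset.sum_range, Plan.code]
    simp [q]
  have hg : ∑ i ∈ Finset.range n, g i = ∑ i, optGain w i (a i) := by
    rw [Finset.sum_range]
    simp [g]
  have key : ∀ k ≤ n, 0 ≤ m.real .table (k * C + ∑ i ∈ Finset.range k, q i) ∧
      ∑ i ∈ Finset.range k, g i ≤ m.real .table (k * C + ∑ i ∈ Finset.range k, q i) := by
    intro k
    induction k with
    | zero =>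
      intro _
      have := h.start 0 (by omega)
      simp [this]
    | succ k ih =>
      intro hk
      obtain ⟨i1, i2⟩ := ih (by omega)
      have hle : ∑ i ∈ Finset.range (k + 1), q i ≤ a.code := by
        rw [← hq]
        exact Finset.sum_le_sum_of_subset (Finset.range_mono hk)
      rw [Finset.sum_range_succ] at hle
      obtain ⟨r1, r2, -⟩ := h.row ⟨k, by omega⟩ (by simp; omega)
        (∑ i ∈ Finset.range k, q i + q k) (by omega)
      rw [Finset.sum_range_succ, Finset.sum_range_succ, Nat.succ_mul]
      simp only at r1 r2
      cases hak : a ⟨k, by omega⟩ with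
      | none =>
        have e1 : q k = 0 := by simp [q, hak]
        have e2 : g k = 0 := by simp [g, hak]
        rw [e1, add_zero] at r1 ⊢
        rw [e2, add_zero]
        exact ⟨i1.trans r1, i2.trans r1⟩
      | some o =>
        have hk' : k < n := by omega
        have e1 : q k = pointCost o.1 (⟨⟨k, by omega⟩, o.2⟩ : Point A) := by simp [q, hak, hk']
        have e2 : g k = pointGain (w o.1) (⟨⟨k, by omega⟩, o.2⟩ : Point A) := by
          simp [g, hak, hk']
        have r3 := r2 o.1 o.2 trivial (by rw [← e1]; omega)
        rw [← e1, ← e2, Nat.add_sub_cancel] at r3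
        have r4 := r3 i1
        have h0 : 0 ≤ g k := by
          rw [e2]
          exact pointGain_nonneg (hw _ o.1.2) _
        exact ⟨by linarith, by linarith⟩
  have := (key n le_rfl).2
  rwa [hq, hg] at this

/-- The choices read off from the last buyer to the first form a plan with code `T` that is worth
the table entry at `T`. -/
theorem run_traceBack (h : Params n K L D m) {w : ℕ → ℝ} {C T : ℕ}
    (hC : C = codeBase n ^ (2 * L)) (ht : IsTable A L w C n m)
    (hT : m.nat .target 0 = T) (hTC : T < C) (hR : m.nat .row 0 = n * C)
    (h0 : 0 ≤ m.real .table (n * C + T)) :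
    ∃ a : Plan A L, a.code = T ∧ ∑ i, optGain w i (a i) = m.real .table (n * C + T) ∧
      ∀ i : Fin n, Describes i (a i) ((traceBack.run I m).nat .bestSeg i)
        ((traceBack.run I m).real .bestPrice i) := by
  rw [traceBack, Com.run_seq]
  set m₁ := Com.run I (.setNat .cur 0 NVar.target) m with hm₁
  have hp₁ : Params n K L D m₁ := h.run rfl
  have ht₁ : ∀ p, SameCell m m₁ p := fun p => .of_eq rfl rfl rfl rfl
  have key := Com.loop_induction (I := I) (x := .t) (b := .buyers) (m := m₁)
    (c := .setNat .bestSeg (NVar.buyers - (NVar.t + 1)) (.get .chSeg (NVar.row + NVar.cur)) ;;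
      .setReal .bestPrice (NVar.buyers - (NVar.t + 1)) (.get .chPrice (NVar.row + NVar.cur)) ;;
      .setNat .cur 0 (NVar.cur - .get .chCost (NVar.row + NVar.cur)) ;;
      .setNat .row 0 (NVar.row - NVar.codes))
    (fun k m' => k ≤ n ∧ m'.nat .row 0 = (n - k) * C ∧
      0 ≤ m.real .table ((n - k) * C + m'.nat .cur 0) ∧
      ∃ a : Plan A L, (∀ i : Fin n, n - k ≤ i → Describes i (a i) (m'.nat .bestSeg i)
        (m'.real .bestPrice i)) ∧
        (∀ i : Fin n, (i : ℕ) < n - k → a i = none) ∧ a.code + m'.nat .cur 0 = T ∧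
        ∑ i, optGain w i (a i) + m.real .table ((n - k) * C + m'.nat .cur 0) =
          m.real .table (n * C + T)) (by
    refine ⟨Nat.zero_le _, by simp [hm₁, hR], by simpa [hm₁, hT] using h0, fun _ => none, ?_, ?_,
      ?_, ?_⟩
    · intro i hi
      omega
    · exact fun _ _ => rfl
    · simp [hm₁, hT, Plan.code]
    · simp [hm₁, hT]) (by
    rintro k hk m' hmk f1 f2 ⟨-, e1, e2, a, e3, e4, e5, e6⟩
    rw [hp₁.buyers] at hk
    have hp' : Params n K L D m' := hp₁.loop f1 f2 (b := .buyers) rfl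
    have ht' : ∀ p, SameCell m m' p := fun p => (ht₁ p).trans
      (.of_eq (f2 _ rfl) (f2 _ rfl) (f1 _ rfl (by decide)) (f1 _ rfl (by decide)))
    -- The buyer whose choice is read off, and the entry of the table that records it.
    let i : Fin n := ⟨n - (k + 1), by omega⟩
    have hi : n - k = i + 1 := by simp only [i]; omega
    have hi' : n - (k + 1) = (i : ℕ) := rfl
    rw [hi] at e1 e2 e3 e4 e6
    rw [hi']
    set c := m'.nat .cur 0 with hc
    have hcC : c < C := by omega
    rw [Nat.succ_mul] at e1 e2 e6
    obtain ⟨-, -, o, o1, o2, o3, o4, o5⟩ := ht.row i i.2 c hcC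
    obtain ⟨d1, d2, d3, d4⟩ := ht' (i * C + C + c)
    have hcodes : m'.nat .codes 0 = C := by rw [hp'.codes, hC]
    have hai : a i = none := e4 i (by omega)
    refine ⟨hk, ?_, ?_, Function.update a i o, ?_, ?_, ?_, ?_⟩
    · simp [e1, hcodes]
    · simpa [e1, hcodes, ← hc, d4, o2] using o4 e2
    · intro i' hi''
      by_cases hii : i' = i
      · subst hii
        rw [Function.update_self]
        simpa [e1, hp'.buyers, hmk, hi', ← hc, d2, d3] using o5
      · have hne : (i' : ℕ) ≠ i := fun h => hii (Fin.ext h)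
        rw [Function.update_of_ne hii]
        simpa [e1, hp'.buyers, hmk, hi', hne] using e3 i' (by omega)
    · intro i' hi''
      have hii : i' ≠ i := by
        rintro rfl
        omega
      rw [Function.update_of_ne hii]
      exact e4 i' (by omega)
    · have hcode : Plan.code (Function.update a i o) = a.code + optCost i o := by
        rw [Plan.code, Plan.code, ← Finset.add_sum_erase _ _ (Finset.mem_univ i),
          ← Finset.add_sum_erase (a := i) _ (fun i => optCost i (a i)) (Finset.mem_univ i), hai,
          Function.update_self, optCost_none, zero_add, add_comm]
        congr 1
        refine Finset.sum_congr rfl fun i' hi' => ?_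
        rw [Function.update_of_ne (Finset.ne_of_mem_erase hi')]
      rw [hcode]
      simp [e1, ← hc, d4, o2]
      omega
    · have hgain : ∑ i', optGain w i' (Function.update a i o i') =
          ∑ i', optGain w i' (a i') + optGain w i o := by
        rw [← Finset.add_sum_erase _ _ (Finset.mem_univ i),
          ← Finset.add_sum_erase (a := i) _ (fun i => optGain w i (a i)) (Finset.mem_univ i), hai,
          Function.update_self, optGain_none, zero_add, add_comm]
        congr 1
        refine Finset.sum_congr rfl fun i' hi' => ?_
        rw [Function.update_of_ne (Finset.ne_of_mem_erase hi')]
      rw [hgain, ← e6, o3]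
      simp [e1, ← hc, d4, o2]
      ring)
  rw [hp₁.buyers] at key
  obtain ⟨-, -, e2, a, e3, -, e5, e6⟩ := key
  rw [Nat.sub_self, zero_mul, zero_add] at e2 e6
  have hcur := ht.start _ (((Nat.le_add_left _ a.code).trans_eq e5).trans_lt hTC)
  split_ifs at hcur with hc0
  · rw [hc0, add_zero] at e5
    rw [hc0] at hcur e6
    rw [hcur, add_zero] at e6
    exact ⟨a, e5, e6, fun i => e3 i (by omega)⟩
  · rw [hcur] at e2
    norm_num at e2

/-- The memory holds a best valid plan among those with code below `T`, and its merged revenue. -/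
def HasBest (A : Auction n) (K L D T : ℕ) (m : Mem) : Prop :=
  ∃ a : Plan A L, a.Valid D ∧ m.real .best 0 = a.approx K ∧
    (∀ i : Fin n, Describes i (a i) (m.nat .bestSeg i) (m.real .bestPrice i)) ∧
    ∀ b : Plan A L, b.Valid D → b.code < T → b.approx K ≤ a.approx K

theorem HasBest.congr {T : ℕ} (h : HasBest A K L D T m) (h1 : m'.real .best = m.real .best)
    (h2 : m'.nat .bestSeg = m.nat .bestSeg) (h3 : m'.real .bestPrice = m.real .bestPrice) :
    HasBest A K L D T m' := by
  obtain ⟨a, a1, a2, a3, a4⟩ := h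
  exact ⟨a, a1, by rw [h1, a2], fun i => by rw [h2, h3]; exact a3 i, a4⟩

/-- All plans with code `T` have the same weights, so that the table entry at `T` is the best merged
revenue among them. -/
theorem run_keepBest (h : Params n K L D m) (hA : A.OnGrid) (hn : 1 ≤ n) (hD : 1 ≤ D) {C T : ℕ}
    (hC : C = codeBase n ^ (2 * L)) (hbest : HasBest A K L D T m)
    (ht : IsTable A L (segWeight n K T) C n m)
    (hok : 1 ≤ m.nat .ok 0 ↔ ValidCode n L D T)
    (hT : m.nat .target 0 = T) (hTC : T < C) (hR : m.nat .row 0 = n * C) :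
    HasBest A K L D (T + 1) (keepBest.run I m) := by
  obtain ⟨a, a1, a2, a3, a4⟩ := hbest
  have happrox : 0 ≤ a.approx K := by
    rw [← a.sum_optGain]
    refine Finset.sum_nonneg fun i _ => ?_
    cases a i with
    | none => simp
    | some o => exact pointGain_nonneg (segWeight_nonneg hA hn a K _ o.1.2.le a1 hD) _
  have hle : ∀ b : Plan A L, b.Valid D → b.code = T → b.approx K ≤ m.real .table (n * C + T) := by
    intro b hb hbT
    subst hbT
    have := ht.le (fun s hs => segWeight_nonneg hA hn b K s hs.le hb hD) b hTC
    rwa [b.sum_optGain] at this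
  rw [keepBest]
  by_cases h1 : ValidCode n L D T
  swap
  · rw [Com.run_ite_neg (by simpa using fun h => h1 (hok.1 h))]
    refine ⟨a, a1, a2, a3, fun b hb hbT => ?_⟩
    rcases Nat.lt_succ_iff_lt_or_eq.1 hbT with h2 | rfl
    · exact a4 b hb h2
    · exact absurd ((b.validCode_iff D).2 hb) h1
  rw [Com.run_ite_pos (by simpa using hok.2 h1)]
  by_cases h2 : m.real .best 0 ≤ m.real .table (n * C + T)
  swap
  · rw [Com.run_ite_neg (by simpa [hR, hT] using h2)]
    refine ⟨a, a1, a2, a3, fun b hb hbT => ?_⟩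
    rcases Nat.lt_succ_iff_lt_or_eq.1 hbT with h3 | h3
    · exact a4 b hb h3
    · rw [← a2]
      exact (hle b hb h3).trans (le_of_not_ge h2)
  rw [Com.run_ite_pos (by simpa [hR, hT] using h2), Com.run_seq]
  set m₁ := Com.run I (.setReal .best 0 (.get .table (NVar.row + NVar.target))) m with hm₁
  have hp₁ : Params n K L D m₁ := h.run rfl
  have htab : m₁.real .table = m.real .table := Com.run_real_frame I _ _ _ rfl
  have ht₁ : IsTable A L (segWeight n K T) C n m₁ :=
    ⟨fun c hc => by rw [htab, ht.start c hc],
      fun i hi => (ht.row i hi).congr fun p _ => .of_eq htab rfl rfl rfl⟩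
  obtain ⟨b, b1, b2, b3⟩ := run_traceBack (I := I) hp₁ hC ht₁ (by simpa [hm₁] using hT) hTC
    (by simpa [hm₁] using hR) (by rw [htab]; exact happrox.trans (a2 ▸ h2))
  rw [htab] at b2
  have hb : b.approx K = m.real .table (n * C + T) := by
    rw [← b2, ← b1, b.sum_optGain]
  refine ⟨b, (b.validCode_iff D).1 (by rwa [b1]), ?_, b3, fun b' hb' hb'T => ?_⟩
  · rw [Com.run_real_frame I _ _ _ rfl, hb]
    simp [hm₁, hR, hT]
  · rw [hb]
    rcases Nat.lt_succ_iff_lt_or_eq.1 hb'T with h3 | h3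
    · exact (a4 b' hb' h3).trans (a2 ▸ h2)
    · exact hle b' hb' h3

theorem run_search (h : Params n K L D m) (hA : A.OnGrid) (hn : 1 ≤ n) (hD : 1 ≤ D)
    (hI : IsInput A I) (hbest : HasBest A K L D 0 m) :
    HasBest A K L D (codeBase n ^ (2 * L)) (search.run I m) := by
  set C := codeBase n ^ (2 * L) with hC
  have key := Com.loop_induction (I := I) (x := .target) (b := .codes) (m := m)
    (c := decode ;; weights ;; fillTable ;; keepBest)
    (fun T m' => HasBest A K L D T m') (hbest.congr rfl rfl rfl) (by
    intro T hT m' hmT f1 f2 e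
    rw [h.codes, ← hC] at hT
    have hp' : Params n K L D m' := h.loop f1 f2 (b := .codes) rfl
    rw [Com.run_seq, Com.run_seq, Com.run_seq]
    have hdig := run_decode (I := I) hp' (by rw [hmT]; exact hT)
    rw [hmT] at hdig
    set m₁ := decode.run I m' with hm₁
    have hp₁ : Params n K L D m₁ := hp'.run rfl
    obtain ⟨w1, w2⟩ := run_weights (I := I) hp₁ hdig
    set m₂ := weights.run I m₁ with hm₂
    have hp₂ : Params n K L D m₂ := hp₁.run rfl
    obtain ⟨t1, t2⟩ := run_fillTable (I := I) (A := A) hp₂ hA hn hI hC w1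
    set m₃ := fillTable.run I m₂ with hm₃
    have hp₃ : Params n K L D m₃ := hp₂.run rfl
    have hn₃ : ∀ v, decode.setsNat v = false → weights.setsNat v = false →
        fillTable.setsNat v = false → m₃.nat v = m'.nat v := fun v u1 u2 u3 => by
      rw [hm₃, Com.run_nat_frame I _ _ _ u3, hm₂, Com.run_nat_frame I _ _ _ u2, hm₁,
        Com.run_nat_frame I _ _ _ u1]
    have hr₃ : ∀ v, decode.setsReal v = false → weights.setsReal v = false →
        fillTable.setsReal v = false → m₃.real v = m'.real v := fun v u1 u2 u3 => by
      rw [hm₃, Com.run_real_frame I _ _ _ u3, hm₂, Com.run_real_frame I _ _ _ u2, hm₁,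
        Com.run_real_frame I _ _ _ u1]
    have hok : 1 ≤ m₃.nat .ok 0 ↔ ValidCode n L D T := by
      rw [hm₃, Com.run_nat_frame I _ _ _ rfl]
      exact w2
    exact (run_keepBest (I := I) hp₃ hA hn hD hC
      (e.congr (hr₃ _ rfl rfl rfl) (hn₃ _ rfl rfl rfl) (hr₃ _ rfl rfl rfl)) t1 hok
      (by rw [hn₃ _ rfl rfl rfl, hmT]) hT t2).congr rfl rfl rfl)
  rwa [h.codes] at key

theorem take_ofFn_succ {α : Type} {L : ℕ} (f : Fin L → α) (s : Fin L) :
    (List.ofFn f).take (s + 1) = (List.ofFn f).take s ++ [f s] := by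
  rw [← List.take_concat_get' _ _ (by simp), List.getElem_ofFn]

/-- The output statement writes the plan that is held in the memory. -/
theorem run_output (h : Params n K L D m) (a : Plan A L)
    (ha : ∀ i : Fin n, Describes i (a i) (m.nat .bestSeg i) (m.real .bestPrice i))
    (hN : m.outNat = []) (hR : m.outReal = []) :
    (output.run I m).outNat = a.points.map (fun e => (e.1 : ℕ)) ∧
    (output.run I m).outReal = a.points.map fun e => A.val e.1 e.2 := by
  have key := Com.loop_induction (I := I) (x := .s) (b := .segs) (m := m)
    (c := .loop .i .buyers
      (.ite (.get .bestSeg NVar.i ≼ NVar.s + 1)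
        (.ite (NVar.s + 1 ≼ .get .bestSeg NVar.i)
          (.writeNat NVar.i ;; .writeReal (.get .bestPrice NVar.i)) .skip) .skip))
    (fun s m' =>
      m'.outNat = ((List.ofFn a.seg).take s).flatten.map (fun e => (e.1 : ℕ)) ∧
      m'.outReal = ((List.ofFn a.seg).take s).flatten.map fun e => A.val e.1 e.2)
    (by simp [hN, hR]) (by
    intro s hs m₁ hms f1 f2 ⟨e1, e2⟩
    rw [h.segs] at hs
    obtain ⟨s, rfl⟩ : ∃ s' : Fin L, (s' : ℕ) = s := ⟨⟨s, hs⟩, rfl⟩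
    have hp₁ : Params n K L D m₁ := h.loop f1 f2 (b := .segs) rfl
    let F : Fin n → Option (Point A) := fun i =>
      (a i).bind fun o => if o.1 = s then some ⟨i, o.2⟩ else none
    have key₂ := Com.loop_induction (I := I) (x := .i) (b := .buyers) (m := m₁)
      (c := .ite (.get .bestSeg NVar.i ≼ NVar.s + 1)
        (.ite (NVar.s + 1 ≼ .get .bestSeg NVar.i)
          (.writeNat NVar.i ;; .writeReal (.get .bestPrice NVar.i)) .skip) .skip)
      (fun i m' =>
        m'.outNat = m₁.outNat ++
          (((List.finRange n).take i).filterMap F).map (fun e => (e.1 : ℕ)) ∧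
        m'.outReal = m₁.outReal ++
          (((List.finRange n).take i).filterMap F).map fun e => A.val e.1 e.2)
      (by simp) (by
      intro i hi m₂ hmi g1 g2 ⟨e3, e4⟩
      rw [hp₁.buyers] at hi
      obtain ⟨i, rfl⟩ : ∃ i' : Fin n, (i' : ℕ) = i := ⟨⟨i, hi⟩, rfl⟩
      have a1 : m₂.nat .s 0 = s := by rw [g1 _ rfl (by decide), hms]
      have a2 : m₂.nat .bestSeg = m.nat .bestSeg := by
        rw [g1 _ rfl (by decide), f1 _ rfl (by decide)]
      have a3 : m₂.real .bestPrice = m.real .bestPrice := by rw [g2 _ rfl, f2 _ rfl]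
      obtain ⟨d1, d2⟩ := ha i
      rw [take_finRange_succ, List.filterMap_append, List.map_append, List.map_append,
        ← List.append_assoc, ← List.append_assoc, ← e3, ← e4]
      by_cases hF : ∃ j, a i = some (s, j)
      · obtain ⟨j, hj⟩ := hF
        have hFi : F i = some ⟨i, j⟩ := by simp [F, hj]
        have b1 : m.nat .bestSeg i = s + 1 := by rw [d1, hj]; rfl
        have b2 : m.real .bestPrice i = A.val i j := d2 _ hj
        rw [Com.run_ite_pos (by simp [hmi, a1, a2, b1]),
          Com.run_ite_pos (by simp [hmi, a1, a2, b1])]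
        simp [hmi, a3, b2, hFi]
      · have hFi : F i = none := by
          cases hi : a i with
          | none => simp [F, hi]
          | some o =>
            have : o.1 ≠ s := fun h => hF ⟨o.2, by rw [hi, ← h]⟩
            simp [F, hi, this]
        have b1 : m.nat .bestSeg i ≠ s + 1 := by
          rw [d1]
          cases hi : a i with
          | none => simp
          | some o =>
            have h1 : o.1 ≠ s := fun h => hF ⟨o.2, by rw [hi, ← h]⟩
            have h2 : (o.1 : ℕ) ≠ s := fun h => h1 (Fin.ext h)
            simpa using h2
        have hskip : ∀ m' : Mem, m' = m₂ → (m'.setNat .i 0 (i + 1)).outNat =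
            m₂.outNat ++ (([i].filterMap F).map fun e => (e.1 : ℕ)) ∧
            (m'.setNat .i 0 (i + 1)).outReal =
              m₂.outReal ++ (([i].filterMap F).map fun e => A.val e.1 e.2) := by
          rintro m' rfl
          simp [hFi]
        apply hskip
        by_cases h1 : m.nat .bestSeg i ≤ s + 1
        · rw [Com.run_ite_pos (by simpa [hmi, a1, a2] using h1),
            Com.run_ite_neg (by simp [hmi, a1, a2]; omega), Com.run_skip]
        · rw [Com.run_ite_neg (by simpa [hmi, a1, a2] using h1), Com.run_skip])
    rw [hp₁.buyers] at key₂
    have hall : ((List.finRange n).take n).filterMap F = a.seg s := by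
      rw [List.take_of_length_le (by simp)]
      rfl
    rw [hall] at key₂
    rw [take_ofFn_succ, List.flatten_append, List.map_append, List.map_append]
    simp only [List.flatten_cons, List.flatten_nil, List.append_nil, Mem.outNat_setNat,
      Mem.outReal_setNat]
    rw [← e1, ← e2]
    exact key₂)
  rw [h.segs, List.take_of_length_le (by simp)] at key
  exact key

end PostedPrice

/-! ### The preparation of the search -/

namespace PostedPrice

open RealRAM Prog

variable {n : ℕ} {A : Auction n} {K L D : ℕ} {I : Input} {m m' : Mem} {s : State}

namespace Prog

/-- The condition of the loop that computes an integer which exceeds `1 / ε`. -/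
def countTest : BExp := RVar.invEps * RExp.inp 0 ≼ᵣ 1

/-- Increase both copies of the counter, which is needed as a natural number and as a real. -/
def countStep : Com :=
  .setNat .invEps 0 (NVar.invEps + 1) ;; .setReal .invEps 0 (RVar.invEps + 1)

/-- The part of the program that consists of counting loops. -/
def main : Com := readInput ;; parameters ;; (powers ;; setCodes) ;; search ;; output

/-- The whole program. Its first loop is not a counting loop: the number of its iterations depends
on a real number. -/
def program : Cmd := .seq (.loop countTest.compile countStep.compile) main.compile

end Prog

/-- The memory in which both variables `invEps` have the value `k` and everything else is zero. -/
def Mem.counted (k : ℕ) : Mem where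
  nat v i := if v = .invEps ∧ i = 0 then k else 0
  real v i := if v = .invEps ∧ i = 0 then (k : ℝ) else 0
  outNat := []
  outReal := []

theorem Mem.counted_zero : (Mem.counted 0).Repr State.init where
  nat v i := by simp [Mem.counted, State.init]
  real v i := by simp [Mem.counted, State.init]
  outNat := rfl
  outReal := rfl

theorem run_countStep (k : ℕ) : countStep.run I (Mem.counted k) = Mem.counted (k + 1) := by
  simp only [countStep, Com.run_seq, Com.run_setNat, Com.run_setReal, Mem.counted, Mem.setNat,
    Mem.setReal, NExp.eval_add, NExp.eval_get, NExp.eval_const, NExp.eval_ofNat, RExp.eval_add,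
    RExp.eval_get, RExp.eval_ofNat]
  congr 1
  · funext v i
    split_ifs <;> simp_all
  · funext v i
    split_ifs <;> simp_all

/-- The first loop finds the least natural number that exceeds `1 / ε`. -/
theorem exec_count {ε : ℝ} (hI : I.real 0 = ε) (hε : 0 < ε) :
    ∃ s t, Exec I (.loop countTest.compile countStep.compile) State.init s t ∧
      t ≤ (countTest.compile.cost + 1 + countStep.cost 0) * (⌊1 / ε⌋₊ + 2) ∧
      (Mem.counted (⌊1 / ε⌋₊ + 1)).Repr s := by
  set w := countTest.compile.cost + 1 + countStep.cost 0 with hw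
  have key : ∀ j k : ℕ, k + j = ⌊1 / ε⌋₊ + 1 → ∀ s : State, (Mem.counted k).Repr s →
      ∃ s' t, Exec I (.loop countTest.compile countStep.compile) s s' t ∧ t ≤ w * (j + 1) ∧
        (Mem.counted (⌊1 / ε⌋₊ + 1)).Repr s' := by
    intro j
    induction j with
    | zero =>
      intro k hk s hs
      obtain rfl : k = ⌊1 / ε⌋₊ + 1 := hk
      refine ⟨s, _, Exec.loop_false ?_, by omega, hs⟩
      rw [BExp.holds_compile hs]
      have := Nat.lt_floor_add_one (1 / ε)
      rw [div_lt_iff₀ hε] at this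
      simpa [countTest, Mem.counted, hI] using this
    | succ j ih =>
      intro k hk s hs
      have hcond : countTest.compile.Holds I s := by
        rw [BExp.holds_compile hs]
        have : (k : ℝ) ≤ 1 / ε := by
          rw [← Nat.le_floor_iff (by positivity)]
          omega
        rw [le_div_iff₀ hε] at this
        simpa [countTest, Mem.counted, hI] using this
      obtain ⟨s₁, t₁, e₁, l₁, r₁⟩ := Com.exec_compile (I := I) (fx := fun _ => false) (N := 0)
        countStep rfl (by simp) hs
      rw [run_countStep] at r₁
      obtain ⟨s₂, t₂, e₂, l₂, r₂⟩ := ih (k + 1) (by omega) s₁ r₁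
      refine ⟨s₂, _, Exec.loop_true hcond e₁ e₂, ?_, r₂⟩
      rw [mul_add w (j + 1) 1]
      omega
  exact key _ 0 (zero_add _) _ Mem.counted_zero

/-- A loop whose body adds `q` to a variable. -/
theorem loop_add_nat {x b v : NVar} {c : Com} {q N : ℕ} (hv : v ≠ x) (hb : b ≠ x)
    (hc : c.setsNat b = false)
    (h : ∀ m, m.nat b 0 = N → (c.run I m).nat v 0 = m.nat v 0 + q) (m : Mem)
    (hm : m.nat b 0 = N) : ((Com.loop x b c).run I m).nat v 0 = m.nat v 0 + N * q := by
  have key := Com.loop_induction (I := I) (x := x) (b := b) (m := m) (c := c)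
    (fun k m' => m'.nat v 0 = m.nat v 0 + k * q) (by simp [hv]) (by
    intro k hk m' _ f1 f2 e
    have := h m' (by rw [f1 _ hc hb, hm])
    simp [hv, this, e]
    ring)
  rwa [hm] at key

/-- A loop whose body adds `q` to a variable. -/
theorem loop_add_real {x b : NVar} {v : RVar} {c : Com} {q : ℝ} {N : ℕ} (hb : b ≠ x)
    (hc : c.setsNat b = false)
    (h : ∀ m, m.nat b 0 = N → (c.run I m).real v 0 = m.real v 0 + q) (m : Mem)
    (hm : m.nat b 0 = N) : ((Com.loop x b c).run I m).real v 0 = m.real v 0 + N * q := by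
  have key := Com.loop_induction (I := I) (x := x) (b := b) (m := m) (c := c)
    (fun k m' => m'.real v 0 = m.real v 0 + k * q) (by simp) (by
    intro k hk m' _ f1 f2 e
    have := h m' (by rw [f1 _ hc hb, hm])
    simp [this, e]
    ring)
  rwa [hm] at key

theorem run_parameters {H : ℕ} (hn : m.nat .buyers 0 = n) (hH : m.nat .scale 0 = H)
    (h0 : ∀ v ∈ [NVar.units, .slack, .segs, .digits], m.nat v 0 = 0) (h1 : m.real .units 0 = 0) :
    (parameters.run I m).nat .units 0 = 10 * n ^ 2 ∧
    (parameters.run I m).nat .base 0 = codeBase n ∧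
    (parameters.run I m).nat .slack 0 = 82 * H ^ 2 ∧
    (parameters.run I m).nat .segs 0 = 820 * H ^ 3 ∧
    (parameters.run I m).nat .digits 0 = 2 * (820 * H ^ 3) ∧
    (parameters.run I m).real .units 0 = 10 * (n : ℝ) ^ 2 := by
  simp only [List.forall_mem_cons] at h0
  obtain ⟨h2, h3, h4, h5, -⟩ := h0
  rw [parameters, Com.run_seq, Com.run_seq]
  set m₁ := Com.run I (.setNat .base 0 1) m with hm₁
  have n₁ : m₁.nat .buyers 0 = n := by simpa [hm₁] using hn
  set c₁ : Com := .loop .i .buyers (.loop .j .buyers (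
    .setNat .units 0 (NVar.units + 10) ;; .setReal .units 0 (RVar.units + 10) ;;
    .loop .k .buyers (.setNat .base 0 (NVar.base + 10)))) with hc₁
  set m₂ := c₁.run I m₁ with hm₂
  have n₂ : m₂.nat .scale 0 = H := by
    rw [hm₂, Com.run_nat_frame I .scale c₁ _ rfl]
    simpa [hm₁] using hH
  have f₂ : ∀ v, c₁.setsNat v = false → v ≠ .base → m₂.nat v 0 = m.nat v 0 := by
    intro v h1 h2
    rw [hm₂, Com.run_nat_frame I v c₁ _ h1]
    simp [hm₁, h2]
  have units : m₂.nat .units 0 = m₁.nat .units 0 + n * (n * 10) :=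
    loop_add_nat (by decide) (by decide) rfl (loop_add_nat (by decide) (by decide) rfl fun m' _ => by
      rw [Com.run_seq, Com.run_seq, Com.run_nat_frame I .units (.loop _ _ _) _ rfl]
      simp) m₁ n₁
  have base : m₂.nat .base 0 = m₁.nat .base 0 + n * (n * (n * 10)) :=
    loop_add_nat (by decide) (by decide) rfl (loop_add_nat (by decide) (by decide) rfl fun m' hm' => by
      rw [Com.run_seq, Com.run_seq, loop_add_nat (by decide) (by decide) rfl (q := 10)
        (fun m' _ => by simp) _ (N := n) (by simpa using hm')]
      simp) m₁ n₁
  have realUnits : m₂.real .units 0 = m₁.real .units 0 + n * (n * 10) :=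
    loop_add_real (by decide) rfl (loop_add_real (by decide) rfl fun m' _ => by
      rw [Com.run_seq, Com.run_seq, Com.run_real_frame I .units (.loop _ _ _) _ rfl]
      simp) m₁ n₁
  set c₂ : Com := .loop .i .scale (.loop .j .scale (
    .setNat .slack 0 (NVar.slack + 82) ;;
    .loop .k .scale (.setNat .segs 0 (NVar.segs + 820) ;;
      .setNat .digits 0 (NVar.digits + 1640)))) with hc₂
  have slack : (c₂.run I m₂).nat .slack 0 = m₂.nat .slack 0 + H * (H * 82) :=
    loop_add_nat (by decide) (by decide) rfl (loop_add_nat (by decide) (by decide) rfl fun m' _ => by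
      rw [Com.run_seq, Com.run_nat_frame I .slack (.loop _ _ _) _ rfl]
      simp) m₂ n₂
  have segs : (c₂.run I m₂).nat .segs 0 = m₂.nat .segs 0 + H * (H * (H * 820)) :=
    loop_add_nat (by decide) (by decide) rfl (loop_add_nat (by decide) (by decide) rfl fun m' hm' => by
      rw [Com.run_seq, loop_add_nat (by decide) (by decide) rfl (q := 820)
        (fun m' _ => by simp) _ (N := H) (by simpa using hm')]
      simp) m₂ n₂
  have digits : (c₂.run I m₂).nat .digits 0 = m₂.nat .digits 0 + H * (H * (H * 1640)) :=
    loop_add_nat (by decide) (by decide) rfl (loop_add_nat (by decide) (by decide) rfl fun m' hm' => by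
      rw [Com.run_seq, loop_add_nat (by decide) (by decide) rfl (q := 1640)
        (fun m' _ => by simp) _ (N := H) (by simpa using hm')]
      simp) m₂ n₂
  rw [Com.run_nat_frame I .units c₂ _ rfl, Com.run_nat_frame I .base c₂ _ rfl,
    Com.run_real_frame I .units c₂ _ rfl, units, base, realUnits, slack, segs, digits,
    f₂ .slack rfl (by decide), f₂ .segs rfl (by decide), f₂ .digits rfl (by decide), h3, h4, h5]
  simp only [hm₁, Com.run_setNat, Mem.nat_setNat, Mem.real_setNat, h1, codeBase]
  simp [h2]
  refine ⟨?_, ?_, ?_, ?_, ?_, ?_⟩ <;> ring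

theorem run_powers {b d : ℕ} (hb : m.nat .base 0 = b) (hd : m.nat .digits 0 = d) :
    ∀ d' ≤ d, (powers.run I m).nat .pow d' = b ^ d' := by
  rw [powers, Com.run_seq]
  set m₁ := Com.run I (.setNat .pow 0 1) m with hm₁
  have key := Com.loop_induction (I := I) (x := .d) (b := .digits) (m := m₁)
    (c := .setNat .acc 0 0 ;;
      .loop .t .base (.setNat .acc 0 (NVar.acc + .get .pow NVar.d)) ;;
      .setNat .pow (NVar.d + 1) NVar.acc)
    (fun k m' => ∀ d' ≤ k, m'.nat .pow d' = b ^ d') (by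
    intro d' hd'
    obtain rfl : d' = 0 := by omega
    simp [hm₁]) (by
    intro k hk m' hmk f1 f2 e d' hd'
    rw [Com.run_seq, Com.run_seq]
    set m₂ := Com.run I (.setNat .acc 0 0) m' with hm₂
    have hb₂ : m₂.nat .base 0 = b := by
      rw [hm₂, Com.run_nat_frame I _ _ _ rfl, f1 _ rfl (by decide), hm₁]
      simpa using hb
    have key := Com.loop_induction (I := I) (x := .t) (b := .base) (m := m₂)
      (c := .setNat .acc 0 (NVar.acc + .get .pow NVar.d))
      (fun t m'' => m''.nat .acc 0 = t * b ^ k) (by simp [hm₂]) (by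
      intro t _ m'' _ g1 g2 e'
      have h1 : m''.nat .pow k = b ^ k := by
        rw [g1 _ rfl (by decide), hm₂]
        simpa using e k le_rfl
      have h2 : m''.nat .d 0 = k := by
        rw [g1 _ rfl (by decide), hm₂]
        simpa using hmk
      simp [e', h1, h2, add_mul])
    rw [hb₂] at key
    set m₃ := Com.run I (.loop .t .base (.setNat .acc 0 (NVar.acc + .get .pow NVar.d))) m₂ with hm₃
    have h1 : m₃.nat .pow = m'.nat .pow := by
      rw [hm₃, Com.run_nat_frame I _ _ _ rfl, hm₂, Com.run_nat_frame I _ _ _ rfl]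
    have h2 : m₃.nat .d 0 = k := by
      rw [hm₃, Com.run_nat_frame I _ _ _ rfl, hm₂, Com.run_nat_frame I _ _ _ rfl, hmk]
    by_cases hdk : d' = k + 1
    · simp [h2, hdk, key, pow_succ']
    · simpa [h2, hdk, h1] using e d' (by omega))
  have hd₁ : m₁.nat .digits 0 = d := by simpa [hm₁] using hd
  rwa [hd₁] at key

theorem isInput_encode (K : ℕ) (ε : ℝ) : IsInput A (A.encode K ε) where
  supp := encode_nat_supp K ε
  val i j := (encode_real K ε i j).1
  prob i j := (encode_real K ε i j).2

/-- The plan without offers is the best one as long as no code has been tried. -/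
theorem hasBest_zero (h1 : m.real .best 0 = 0) (h2 : ∀ i, m.nat .bestSeg i = 0) :
    HasBest A K L D 0 m := by
  refine ⟨fun _ => none, fun s => ?_, ?_, fun i => ?_, fun b _ h => by omega⟩
  · left
    simp [Plan.count, Plan.segSum]
  · rw [h1, ← Plan.sum_optGain]
    simp
  · exact ⟨by simp [h2], by simp⟩

end PostedPrice

/-! ### The running time -/

namespace PostedPrice

open RealRAM Prog

variable {n : ℕ} {A : Auction n} {K : ℕ} {I : Input} {m : Mem}

/-- The number of codes that are searched when `H` is the sum of `K` and of the integer that stands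
for `1 / ε`. -/
def codes (n H : ℕ) : ℕ := codeBase n ^ (2 * (820 * H ^ 3))

theorem two_le_codeBase (hn : 1 ≤ n) : 2 ≤ codeBase n := by
  have : 1 ≤ n ^ 3 := Nat.one_le_pow _ _ hn
  unfold codeBase
  omega

theorem le_codes {H : ℕ} (hn : 1 ≤ n) (hH : 1 ≤ H) :
    n ≤ codes n H ∧ 10 * n ^ 2 ≤ codes n H ∧ codeBase n ≤ codes n H ∧ H ≤ codes n H ∧
      82 * H ^ 2 ≤ codes n H ∧ 820 * H ^ 3 ≤ codes n H ∧ 2 * (820 * H ^ 3) ≤ codes n H := by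
  have h1 : 2 * (820 * H ^ 3) < codes n H := Nat.lt_pow_self (two_le_codeBase hn)
  have h2 : H ^ 2 ≤ H ^ 3 := Nat.pow_le_pow_right hH (by norm_num)
  have h3 : H ≤ H ^ 3 := Nat.le_self_pow (by norm_num) H
  have h4 : n ^ 2 ≤ n ^ 3 := Nat.pow_le_pow_right hn (by norm_num)
  have h5 : n ≤ n ^ 3 := Nat.le_self_pow (by norm_num) n
  have h6 : codeBase n ≤ codes n H := Nat.le_self_pow (by omega) _
  have h7 : codeBase n = 10 * n ^ 3 + 1 := rfl
  omega

theorem codes_add_one_le {H : ℕ} (hn : 1 ≤ n) (hH : 1 ≤ H) :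
    codes n H + 1 ≤ codeBase n ^ (1641 * H ^ 3) := by
  have h2 := two_le_codeBase hn
  have h3 : 1 ≤ codes n H := Nat.one_le_pow _ _ (by omega)
  have h4 : 1 ≤ H ^ 3 := Nat.one_le_pow _ _ hH
  calc codes n H + 1 ≤ codes n H * codeBase n := by nlinarith
    _ = codeBase n ^ (2 * (820 * H ^ 3) + 1) := (pow_succ _ _).symm
    _ ≤ _ := Nat.pow_le_pow_right (by omega) (by omega)

/-- The counting loops output an optimal mechanism in a number of steps that is bounded in terms of
the number of codes. -/
theorem exec_main (hA : A.OnGrid) (hn : 1 ≤ n) (hK : 1 ≤ K) {E : ℕ} {ε : ℝ}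
    (hE : 1 ≤ (E : ℝ) * ε) (hε : ε < 1) {s : State} (hs : (Mem.counted E).Repr s) :
    ∃ (σ : SPM n) (s' : State) (t : ℕ), Exec (A.encode K ε) main.compile s s' t ∧
      t ≤ main.cost (codes n (K + E)) ∧ s'.Outputs σ ∧
      ∀ τ, (1 - ε) * A.expectedRevenue K τ ≤ A.expectedRevenue K σ := by
  set I := A.encode K ε with hI
  set H := K + E with hH
  set N := codes n H with hN
  obtain ⟨l1, l2, l3, l4, l5, l6, l7⟩ := le_codes hn (show 1 ≤ H by omega)
  rw [← hN] at l1 l2 l3 l4 l5 l6 l7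
  have hD : 1 ≤ 82 * H ^ 2 := by
    have : 1 ≤ H ^ 2 := Nat.one_le_pow _ _ (by omega)
    omega
  set m₀ := Mem.counted E with hm₀
  set m₁ := readInput.run I m₀ with hm₁
  set m₂ := parameters.run I m₁ with hm₂
  set m₃ := (powers ;; setCodes).run I m₂ with hm₃
  have hn₁ : m₁.nat .buyers 0 = n := by
    simp [hm₁, readInput, hI, encode_nat_zero]
  have hK₁ : m₁.nat .copies 0 = K := by
    simp [hm₁, readInput, hI, encode_nat_one]
  have hH₁ : m₁.nat .scale 0 = H := by
    simp [hm₁, readInput, hI, encode_nat_one, hm₀, Mem.counted, hH]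
  obtain ⟨p1, p2, p3, p4, p5, p6⟩ := run_parameters (I := I) hn₁ hH₁ (by
    simp only [List.forall_mem_cons]
    simp [hm₁, readInput, hm₀, Mem.counted]) (by simp [hm₁, readInput, hm₀, Mem.counted])
  rw [← hm₂] at p1 p2 p3 p4 p5 p6
  have hpow := run_powers (I := I) p2 p5
  have nat₃ : ∀ v, (powers ;; setCodes).setsNat v = false → m₃.nat v = m₂.nat v :=
    fun v hv => Com.run_nat_frame _ _ _ _ hv
  have hp : Params n K (820 * H ^ 3) (82 * H ^ 2) m₃ := by
    refine ⟨?_, ?_, ?_, ?_, ?_, ?_, ?_, ?_, fun d hd => ?_, ?_⟩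
    · rw [nat₃ _ rfl, hm₂, Com.run_nat_frame _ _ _ _ rfl, hn₁]
    · rw [nat₃ _ rfl, hm₂, Com.run_nat_frame _ _ _ _ rfl, hK₁]
    · rw [nat₃ _ rfl, p1]
    · rw [nat₃ _ rfl, p3]
    · rw [nat₃ _ rfl, p4]
    · rw [nat₃ _ rfl, p5]
    · rw [nat₃ _ rfl, p2]
    · have h1 : (powers.run I m₂).nat .digits 0 = 2 * (820 * H ^ 3) := by
        rw [Com.run_nat_frame _ _ _ _ rfl, p5]
      have h2 := hpow _ le_rfl
      rw [hm₃, Com.run_seq, setCodes]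
      simp [h1, h2]
    · rw [hm₃, Com.run_seq, Com.run_nat_frame _ _ setCodes _ rfl, hpow d hd.le]
    · rw [hm₃, Com.run_real_frame _ _ _ _ rfl, p6]
  have hbest : HasBest A K (820 * H ^ 3) (82 * H ^ 2) 0 m₃ := by
    refine hasBest_zero ?_ fun i => ?_
    · rw [hm₃, Com.run_real_frame _ _ _ _ rfl, hm₂, Com.run_real_frame _ _ _ _ rfl, hm₁,
        Com.run_real_frame _ _ _ _ rfl]
      simp [hm₀, Mem.counted]
    · rw [hm₃, Com.run_nat_frame _ _ _ _ rfl, hm₂, Com.run_nat_frame _ _ _ _ rfl, hm₁,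
        Com.run_nat_frame _ _ _ _ rfl]
      simp [hm₀, Mem.counted]
  obtain ⟨a, a1, -, a3, a4⟩ := run_search hp hA hn hD (hI ▸ isInput_encode K ε) hbest
  have hp₄ : Params n K (820 * H ^ 3) (82 * H ^ 2) (search.run I m₃) := hp.run rfl
  have hout : (search.run I m₃).outNat = [] ∧ (search.run I m₃).outReal = [] := by
    rw [(Com.run_out_frame _ _ _ rfl).1, (Com.run_out_frame _ _ _ rfl).2, hm₃,
      (Com.run_out_frame _ _ _ rfl).1, (Com.run_out_frame _ _ _ rfl).2, hm₂,
      (Com.run_out_frame _ _ _ rfl).1, (Com.run_out_frame _ _ _ rfl).2, hm₁,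
      (Com.run_out_frame _ _ _ rfl).1, (Com.run_out_frame _ _ _ rfl).2]
    exact ⟨rfl, rfl⟩
  obtain ⟨o1, o2⟩ := run_output (I := I) hp₄ a a3 hout.1 hout.2
  obtain ⟨s₁, t₁, e₁, c₁, r₁⟩ := Com.exec_compile (I := I) (fx := fun _ => false) (N := N)
    readInput rfl (by simp) hs
  obtain ⟨s₂, t₂, e₂, c₂, r₂⟩ := Com.exec_compile (I := I)
    (fx := fun v => v == .buyers || v == .scale) (N := N) parameters rfl (by
      rintro v hv
      simp only [Bool.or_eq_true, beq_iff_eq] at hv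
      rcases hv with rfl | rfl
      · exact hn₁.trans_le l1
      · exact hH₁.trans_le l4) r₁
  obtain ⟨s₃, t₃, e₃, c₃, r₃⟩ := Com.exec_compile (I := I)
    (fx := fun v => v == .base || v == .digits) (N := N) (powers ;; setCodes) rfl (by
      rintro v hv
      simp only [Bool.or_eq_true, beq_iff_eq] at hv
      rcases hv with rfl | rfl
      · exact p2.trans_le l3
      · exact p5.trans_le l7) r₂
  obtain ⟨s₄, t₄, e₄, c₄, r₄⟩ := Com.exec_compile (I := I)
    (fx := fun v => paramVars.contains v && v != .pow) (N := N) (search ;; output) rfl (by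
      rintro v hv
      simp only [paramVars, List.contains_cons, List.contains_nil, Bool.and_eq_true,
        Bool.or_eq_true, beq_iff_eq, bne_iff_ne, Bool.or_false] at hv
      obtain ⟨hv, hv'⟩ := hv
      rcases hv with rfl | rfl | rfl | rfl | rfl | rfl | rfl | rfl | rfl
      · exact hp.buyers.trans_le l1
      · exact hp.copies.trans_le (by omega)
      · exact hp.units.trans_le l2
      · exact hp.slack.trans_le l5
      · exact hp.segs.trans_le l6
      · exact hp.digits.trans_le l7
      · exact hp.base.trans_le l3
      · exact hp.codes.le
      · exact absurd rfl hv') r₃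
  refine ⟨a.toSPM, s₄, _, Exec.seq e₁ (Exec.seq e₂ (Exec.seq e₃ e₄)), ?_, ⟨?_, ?_⟩,
    expectedRevenue_optimal_plan hA hn hK hE hε a1 fun b hb => a4 b hb b.code_lt⟩
  · exact Nat.add_le_add c₁ (Nat.add_le_add c₂ (Nat.add_le_add c₃ c₄))
  · rw [r₄.outNat, Com.run_seq, o1, Plan.toSPM, List.map_map]
    rfl
  · rw [r₄.outReal, Com.run_seq, o2, Plan.toSPM, List.map_map]
    rfl

/-- The program computes a nearly optimal mechanism in time polynomial in the number of codes. -/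
theorem exec_program : ∃ C d : ℕ, ∀ (n K : ℕ) (ε : ℝ) (A : Auction n), 1 ≤ n → 1 ≤ K → 0 < ε →
    ε < 1 → A.OnGrid → ∃ (σ : SPM n) (s : State) (t : ℕ),
      Exec (A.encode K ε) program State.init s t ∧
      t ≤ C * (codes n (K + (⌊1 / ε⌋₊ + 1)) + 1) ^ d ∧ s.Outputs σ ∧
      ∀ τ, (1 - ε) * A.expectedRevenue K τ ≤ A.expectedRevenue K σ := by
  obtain ⟨C, d, h⟩ := main.exists_cost_le
  refine ⟨countTest.compile.cost + 1 + countStep.cost 0 + C, d + 1, ?_⟩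
  intro n K ε A hn hK h0 h1 hA
  set E := ⌊1 / ε⌋₊ + 1 with hE
  have hE1 : 1 ≤ (E : ℝ) * ε := by
    have := Nat.lt_floor_add_one (1 / ε)
    rw [div_lt_iff₀ h0] at this
    push_cast [hE]
    exact this.le
  obtain ⟨s₁, t₁, e₁, c₁, r₁⟩ := exec_count (encode_real_zero (A := A) K ε) h0
  obtain ⟨σ, s₂, t₂, e₂, c₂, r₂, r₃⟩ := exec_main hA hn hK hE1 h1 r₁
  refine ⟨σ, s₂, _, Exec.seq e₁ e₂, ?_, r₂, r₃⟩
  set N := codes n (K + E) with hN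
  set w := countTest.compile.cost + 1 + countStep.cost 0
  have l4 := (le_codes hn (show 1 ≤ K + E by omega)).2.2.2.1
  have h2 : N + 1 ≤ (N + 1) ^ (d + 1) := Nat.le_self_pow (by omega) _
  have h3 : (N + 1) ^ d ≤ (N + 1) ^ (d + 1) := Nat.pow_le_pow_right (by omega) (by omega)
  calc t₁ + t₂ ≤ w * (E + 1) + C * (N + 1) ^ d :=
        Nat.add_le_add c₁ (c₂.trans (h N))
    _ ≤ w * (N + 1) ^ (d + 1) + C * (N + 1) ^ (d + 1) := by
        gcongr
        omega
    _ = (w + C) * (N + 1) ^ (d + 1) := by ring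

/-- When `n * K / ε` is close to `1`, the number of codes is bounded by a constant, and otherwise by
a power of `n * K / ε`. -/
theorem codes_pow_le (d : ℕ) : ∃ B : ℕ, ∀ (n K : ℕ) (ε : ℝ), 1 ≤ n → 1 ≤ K → 0 < ε → ε < 1 →
    (((codes n (K + (⌊1 / ε⌋₊ + 1)) + 1) ^ d : ℕ) : ℝ) ≤
      B * ((n : ℝ) * K / ε) ^ (11487 * d * ((K : ℝ) + 1 / ε + 1) ^ 3) := by
  obtain ⟨M, hM⟩ : ∃ M, ∀ H, H = 3 → codes 1 H = M := ⟨codes 1 3, fun _ h => h ▸ rfl⟩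
  refine ⟨(M + 1) ^ d + 1, ?_⟩
  intro n K ε hn hK h0 h1
  set y := 1 / ε with hy
  set F := ⌊y⌋₊ with hF
  have hn' : (1 : ℝ) ≤ n := by exact_mod_cast hn
  have hK' : (1 : ℝ) ≤ K := by exact_mod_cast hK
  have hy1 : 1 < y := (one_lt_div h0).2 h1
  have hFy : (F : ℝ) ≤ y := Nat.floor_le (by linarith)
  have hz : (n : ℝ) * K / ε = n * K * y := by rw [hy]; ring
  rw [hz]
  set z := (n : ℝ) * K * y with hzdef
  have hnK : (n : ℝ) ≤ n * K := le_mul_of_one_le_right (by linarith) hK'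
  have hzn : (n : ℝ) ≤ z := hnK.trans (le_mul_of_one_le_right (by positivity) hy1.le)
  have hz1 : 1 ≤ z := hn'.trans hzn
  set e := 11487 * d * ((K : ℝ) + y + 1) ^ 3 with he
  have hze : 1 ≤ z ^ e := Real.one_le_rpow hz1 (by positivity)
  rcases lt_or_ge z 2 with hlt | hge
  · -- The integers `n` and `K` are `1`, and the integer part of `1 / ε` is `1`, too.
    have hnK2 : (n : ℝ) * K < 2 :=
      (le_mul_of_one_le_right (by positivity) hy1.le).trans_lt hlt
    have hnK2' : n * K < 2 := by exact_mod_cast hnK2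
    obtain ⟨rfl, rfl⟩ : n = 1 ∧ K = 1 := mul_eq_one.1 (by nlinarith)
    have hF2 : F < 2 := by
      have : (F : ℝ) < 2 := hFy.trans_lt (by simpa [hzdef] using hlt)
      exact_mod_cast this
    have hF1 : 1 ≤ F := Nat.le_floor (by simpa using hy1.le)
    rw [hM _ (show 1 + (F + 1) = 3 by omega)]
    have : (0 : ℝ) ≤ ((M + 1) ^ d : ℕ) := Nat.cast_nonneg _
    push_cast at this ⊢
    nlinarith
  · obtain ⟨H, hH⟩ : ∃ H, H = K + (F + 1) := ⟨_, rfl⟩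
    rw [← hH]
    have hb : (codeBase n : ℝ) ≤ z ^ 7 := by
      have h3 : (1 : ℝ) ≤ (n : ℝ) ^ 3 := one_le_pow₀ hn'
      have h4 : (2 : ℝ) ^ 4 ≤ z ^ 4 := pow_le_pow_left₀ (by norm_num) hge 4
      calc (codeBase n : ℝ) = 10 * (n : ℝ) ^ 3 + 1 := by simp [codeBase]
        _ ≤ 2 ^ 4 * (n : ℝ) ^ 3 := by linarith
        _ ≤ z ^ 4 * z ^ 3 := by gcongr
        _ = z ^ 7 := by ring
    have hcodes := codes_add_one_le hn (show 1 ≤ H by omega)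
    have hHe : ((7 * (1641 * H ^ 3) * d : ℕ) : ℝ) ≤ e := by
      have : (H : ℝ) ≤ K + y + 1 := by push_cast [hH]; linarith
      push_cast
      calc (7 : ℝ) * (1641 * (H : ℝ) ^ 3) * d = 11487 * d * (H : ℝ) ^ 3 := by ring
        _ ≤ e := by rw [he]; gcongr
    generalize 1641 * H ^ 3 = q at hcodes hHe
    calc (((codes n H + 1) ^ d : ℕ) : ℝ) ≤ (((codeBase n ^ q) ^ d : ℕ) : ℝ) := by
          exact_mod_cast Nat.pow_le_pow_left hcodes d
      _ = ((codeBase n : ℝ) ^ q) ^ d := by push_cast; ring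
      _ ≤ ((z ^ 7) ^ q) ^ d := by gcongr
      _ = z ^ ((7 * q * d : ℕ) : ℝ) := by
          rw [Real.rpow_natCast, pow_mul, pow_mul]
      _ ≤ z ^ e := Real.rpow_le_rpow_of_exponent_le hz1 hHe
      _ ≤ _ := le_mul_of_one_le_left (by positivity) (by
          push_cast
          linarith [pow_nonneg (by positivity : (0 : ℝ) ≤ (M : ℝ) + 1) d])

end PostedPrice

theorem mainTheorem4 :
    ∃ (prog : RealRAM.Cmd) (c : ℕ) (P : MvPolynomial (Fin 2) ℕ),
      ∀ (n K : ℕ) (ε : ℝ) (A : Auction n),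
        1 ≤ n → 1 ≤ K → 0 < ε → ε < 1 → A.OnGrid →
        ∃ (σ : SPM n) (s : RealRAM.State) (t : ℕ),
          RealRAM.Exec (A.encode K ε) prog RealRAM.State.init s t ∧
          (t : ℝ) ≤ (c : ℝ) *
            ((n : ℝ) * (K : ℝ) / ε) ^ (MvPolynomial.aeval ![(K : ℝ), 1 / ε] P : ℝ) ∧
          s.Outputs σ ∧
          ∀ τ : SPM n, (1 - ε) * A.expectedRevenue K τ ≤ A.expectedRevenue K σ := by
  obtain ⟨C, d, h⟩ := PostedPrice.exec_program
  obtain ⟨B, hB⟩ := PostedPrice.codes_pow_le d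
  refine ⟨PostedPrice.Prog.program, C * B,
    MvPolynomial.C (11487 * d) * (MvPolynomial.X 0 + MvPolynomial.X 1 + 1) ^ 3, ?_⟩
  intro n K ε A hn hK h0 h1 hA
  obtain ⟨σ, s, t, e1, e2, e3, e4⟩ := h n K ε A hn hK h0 h1 hA
  refine ⟨σ, s, t, e1, ?_, e3, e4⟩
  have hP : (MvPolynomial.aeval ![(K : ℝ), 1 / ε]
      (MvPolynomial.C (11487 * d) * (MvPolynomial.X 0 + MvPolynomial.X 1 + 1) ^ 3) : ℝ) =
      11487 * d * ((K : ℝ) + 1 / ε + 1) ^ 3 := by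
    simp
  rw [hP]
  calc (t : ℝ) ≤ C * (((PostedPrice.codes n (K + (⌊1 / ε⌋₊ + 1)) + 1) ^ d : ℕ) : ℝ) := by
        exact_mod_cast e2
    _ ≤ C * (B * ((n : ℝ) * K / ε) ^ (11487 * d * ((K : ℝ) + 1 / ε + 1) ^ 3)) :=
        mul_le_mul_of_nonneg_left (hB n K ε hn hK h0 h1) (Nat.cast_nonneg C)
    _ = _ := by
        push_cast
        ring
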